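/- For every real constant $c>0$ there are a constant $K=K(c)\in\mathbb N$ and a deterministic algorithm (depending only on $c$) with the following property. Let $n\ge 1$ be an integer such that $m:=n^c$ is an integer, and let $\rho$ be a real number with $\rho\le c\log_2 n$. On input $n$, $m$ and $\lfloor \rho m\rfloor$ (replaced by $0$ if $\rho<0$), the algorithm constructs, in time at most $K n^{K}$ on a random access machine (polynomially equivalent to a Turing machine), a multiset $\mathcal S=\mathcal S^{n,c,\rho}$ of at most $n^{K}$ elements of $[m]^n$ such that the following holds. Let $A_1,\dots,A_n\subseteq[m]$ be arbitrary, let $\mathcal R:[m]^n\to\{0,1\}$ be the combinatorial rectangle with $\mathcal R(x)=1$ if and only if $x_i\in A_i$ for all $i$, and let $q_i:=1-|A_i|/m$ be its rejecting probabilities. If $\sum_{i} q_i\le\rho$ and $\Pr_{X\sim[m]^n}[\mathcal R(X)=1]\ge p$ for some real $p\ge 1/n^c$, then $$\Pr_{X\sim\mathcal S}[\mathcal R(X)=1]\ \ge\ \frac{p}{2^{K\rho}}.$$ Here $X\sim[m]^n$ is uniform, and $X\sim\mathcal S$ is uniform on the multiset $\mathcal S$ (elements counted with multiplicity). -/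

import Mathlib

/-! ### Combinatorial rectangles and probabilities -/

/-- The `(m,n)`-combinatorial rectangle with accepting sets `A 0, …, A (n-1) ⊆ [m]`: the boolean
function on `[m]^n` that is the AND of the indicators `x i ∈ A i`. -/
def combRect {m n : ℕ} (A : Fin n → Finset (Fin m)) (x : Fin n → Fin m) : Bool :=
  decide (∀ i, x i ∈ A i)

/-- The rejecting probability `q = 1 - |B| / m` of a set `B ⊆ [m]`. -/
noncomputable def rejectProb {m : ℕ} (B : Finset (Fin m)) : ℝ :=
  1 - (B.card : ℝ) / m

/-- The probability that `f` accepts a uniformly random point of a finite type `D`. -/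
noncomputable def uniformProb {D : Type} [Fintype D] (f : D → Bool) : ℝ :=
  ((Finset.univ.filter fun x => f x = true).card : ℝ) / Fintype.card D

/-- The probability that `f` accepts a uniformly random member of the multiset listed by `S`
(members are counted with multiplicity; the probability is `0` if `S` is empty). -/
noncomputable def listProb {D : Type} (S : List D) (f : D → Bool) : ℝ :=
  (S.countP f : ℝ) / S.length

/-! ### Random access machines with a step count

A program works on registers and on arrays, both named by numerals in the program text (so a
program uses only finitely many of them); array indices are computed, which gives indirect
addressing. Additive operations, comparisons and memory accesses cost one step. Multiplication and
division cost one step plus the bit lengths of their operands, so that a computation with `t` steps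
only produces numbers with at most `t` bits more than its input and its program text, and
polynomial time on this machine is polynomial time on a Turing machine. -/

namespace RAM

/-- The contents of the memory. -/
@[ext] structure Store where
  reg : ℕ → ℕ
  arr : ℕ → ℕ → ℕ

/-- Register `x` gets the value `v`. -/
def Store.setReg (σ : Store) (x v : ℕ) : Store :=
  ⟨Function.update σ.reg x v, σ.arr⟩

/-- Entry number `i` of array `a` gets the value `v`. -/
def Store.setArr (σ : Store) (a i v : ℕ) : Store :=
  ⟨σ.reg, Function.update σ.arr a (Function.update (σ.arr a) i v)⟩

/-- Expressions. `load a e` is entry number `e` of array `a`; `lt` has value `1` or `0`. -/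
inductive Expr where
  | const (k : ℕ)
  | var (x : ℕ)
  | load (a : ℕ) (e : Expr)
  | add (e f : Expr)
  | sub (e f : Expr)
  | lt (e f : Expr)
  | mul (e f : Expr)
  | div (e f : Expr)
  | mod (e f : Expr)

/-- The value of an expression (`sub` is truncated, `x / 0 = 0`, `x % 0 = x`). -/
def Expr.eval (σ : Store) : Expr → ℕ
  | const k => k
  | var x => σ.reg x
  | load a e => σ.arr a (e.eval σ)
  | add e f => e.eval σ + f.eval σ
  | sub e f => e.eval σ - f.eval σ
  | lt e f => if e.eval σ < f.eval σ then 1 else 0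
  | mul e f => e.eval σ * f.eval σ
  | div e f => e.eval σ / f.eval σ
  | mod e f => e.eval σ % f.eval σ

/-- The number of steps that the evaluation of an expression takes. -/
def Expr.cost (σ : Store) : Expr → ℕ
  | const _ => 1
  | var _ => 1
  | load _ e => e.cost σ + 1
  | add e f => e.cost σ + f.cost σ + 1
  | sub e f => e.cost σ + f.cost σ + 1
  | lt e f => e.cost σ + f.cost σ + 1
  | mul e f => e.cost σ + f.cost σ + (Nat.size (e.eval σ) + Nat.size (f.eval σ) + 1)
  | div e f => e.cost σ + f.cost σ + (Nat.size (e.eval σ) + Nat.size (f.eval σ) + 1)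
  | mod e f => e.cost σ + f.cost σ + (Nat.size (e.eval σ) + Nat.size (f.eval σ) + 1)

/-- Programs. -/
inductive Prog where
  | skip
  /-- register `x` gets the value of `e` -/
  | assign (x : ℕ) (e : Expr)
  /-- entry number `i` of array `a` gets the value of `e` -/
  | store (a : ℕ) (i e : Expr)
  | seq (P Q : Prog)
  /-- run `P` if `e` is nonzero, otherwise run `Q` -/
  | cond (e : Expr) (P Q : Prog)
  /-- as long as `e` is nonzero, run `P` -/
  | loop (e : Expr) (P : Prog)

/-- `Run P σ τ t`: started with memory `σ`, the program `P` halts with memory `τ` after exactly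
`t` steps. -/
inductive Run : Prog → Store → Store → ℕ → Prop
  | skip (σ : Store) : Run .skip σ σ 1
  | assign (σ : Store) (x : ℕ) (e : Expr) :
      Run (.assign x e) σ (σ.setReg x (e.eval σ)) (e.cost σ + 1)
  | store (σ : Store) (a : ℕ) (i e : Expr) :
      Run (.store a i e) σ (σ.setArr a (i.eval σ) (e.eval σ))
        (i.cost σ + e.cost σ + 1)
  | seq {P Q : Prog} {σ τ υ : Store} {s t : ℕ} (h₁ : Run P σ τ s) (h₂ : Run Q τ υ t) :
      Run (.seq P Q) σ υ (s + t)
  | cond_true {e : Expr} {P Q : Prog} {σ τ : Store} {t : ℕ} (he : e.eval σ ≠ 0)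
      (h : Run P σ τ t) : Run (.cond e P Q) σ τ (e.cost σ + 1 + t)
  | cond_false {e : Expr} {P Q : Prog} {σ τ : Store} {t : ℕ} (he : e.eval σ = 0)
      (h : Run Q σ τ t) : Run (.cond e P Q) σ τ (e.cost σ + 1 + t)
  | loop_exit {e : Expr} {P : Prog} {σ : Store} (he : e.eval σ = 0) :
      Run (.loop e P) σ σ (e.cost σ + 1)
  | loop_step {e : Expr} {P : Prog} {σ τ υ : Store} {s t : ℕ} (he : e.eval σ ≠ 0)
      (h₁ : Run P σ τ s) (h₂ : Run (.loop e P) τ υ t) :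
      Run (.loop e P) σ υ (e.cost σ + 1 + s + t)

/-- The initial memory on input `a, b, k`: they stand in registers `0, 1, 2`; everything else
is `0`. -/
def input (a b k : ℕ) : Store where
  reg x := if x = 0 then a else if x = 1 then b else if x = 2 then k else 0
  arr _ _ := 0

/-- The memory `τ` holds the list `S` of vectors in `[m]^n`: register `0` holds the number of
vectors, and array `0` holds their coordinates (numbers below `m`), vector after vector. -/
def Holds {m n : ℕ} (τ : Store) (S : List (Fin n → Fin m)) : Prop :=
  τ.reg 0 = S.length ∧
    ∀ (s : Fin S.length) (i : Fin n), τ.arr 0 (s.val * n + i.val) = (S.get s i).val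

/-- On input `a, b, k`, the program `P` halts within `T` steps and outputs the list `S`. -/
def Outputs {m n : ℕ} (P : Prog) (a b k : ℕ) (S : List (Fin n → Fin m)) (T : ℕ) : Prop :=
  ∃ (τ : Store) (t : ℕ), Run P (input a b k) τ t ∧ t ≤ T ∧ Holds τ S

end RAM

/-!
The multiset consists of the outputs of a pseudorandom generator with a seed of `O(log n)` bits that
is run on all its seeds. What has to be shown is that a fraction of at least `p / 2 ^ O(ρ)` of the
seeds gives a point of the rectangle. Since a loss of `2 ^ O(ρ)` is allowed, the construction may
*guess* `O(ρ)` bits: they are made part of the seed, and it suffices that one guess is right.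

Let `k = ⌊ρ m⌋`. If `2 k < m`, then `∑ i, q i ≤ 1 / 2`, and the points with equal coordinates suffice
by the union bound (`le_listProb_diagonal`). Otherwise let `R = 2 ^ l` be the first power of two
above `k / m`. Then `ρ ≤ R ≤ 2 ρ`, so that the loss may be `2 ^ O(R)`.

* **Buckets.** The coordinates are hashed into `[96 R²]`, and then into `96 R` buckets, each of which
  should be light: apart from one coordinate, its rejecting probabilities sum up to at most `1 / 2`.
  This is done in levels. Level `D = R, R / 2, …, 1` uses `48 D` buckets of its own; those that are
  not light are guessed, and their coordinates are passed on to the next level with a fresh hash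
  function. The weight that is passed on halves with probability at least one half, so all levels
  succeed for a fraction `1 / (4 R)` of the hash functions (`card_good_hashes`,
  `pow_le_card_bucketOf_isLight`).
* **Inside a bucket** the coordinates get the pairwise independent values `x + i y`, for a point
  `(x, y)` of the torus `(ℤ/Q)²` with a prime `Q`. In a light bucket, all of them are accepted with
  probability at least `(1 - q M) / 4`, where `M` is the exceptional coordinate
  (`quarter_le_torusDensity`).
* **Across buckets** the points of the torus are the positions of a random walk whose moves are two
  translations and two shears. These moves have a spectral gap that does not depend on `Q`
  (`sum_torusAvg_sq_le`): a function that they almost preserve has an almost invariant Fourier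
  transform, and the shears play ping-pong on the nonzero frequencies. If the walk makes enough steps
  between consecutive buckets, in proportion to the logarithms of the densities of their accepted
  sets, it hits these sets with the product of the densities as probability, up to a constant factor
  per bucket (`le_card_walks`). As the densities multiply up to at least `n ^ (-c) 2 ^ (-O(R))`, the
  walk has `O(R + log n)` steps in all, and a rounded schedule of the buckets can be guessed
  (`exists_schedule`): the time of bucket `b` is the position of one number `b + 1` in a number `Z`
  with `H = O(R)` binary digits, in units of `u = O(1 + log n / R)` steps.

`le_card_seedPoint` puts these together. The seeds are numbered in a mixed radix, and there are
polynomially many of them because `R = O(log n)` (`seedCount_le_two_pow`). A program for the machine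
is written down and its run is followed with a Hoare logic for bounded time, in which a bound for
all registers and the depth of nested loops give a bound for the time (`Within`,
`within_mainProg_of_le`).
-/

/-! ### A spectral gap on the discrete torus -/

/-- The five moves of the walk on the torus `(ℤ/Q)²`: stand still, two translations and two
shears. Every digit other than `1, 2, 3, 4` stands still. -/
def torusStep {Q : ℕ} (d : ℕ) (v : ZMod Q × ZMod Q) : ZMod Q × ZMod Q :=
  match d with
  | 1 => (v.1 + 1, v.2)
  | 2 => (v.1, v.2 + 1)
  | 3 => (v.1 + v.2, v.2)
  | 4 => (v.1, v.2 + v.1)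
  | _ => v

lemma torusStep_bijective {Q : ℕ} (d : ℕ) :
    Function.Bijective (torusStep d : ZMod Q × ZMod Q → ZMod Q × ZMod Q) := by
  rw [Function.bijective_iff_has_inverse]
  match d with
  | 0 => exact ⟨id, fun v => rfl, fun v => rfl⟩
  | 1 => exact ⟨fun v => (v.1 - 1, v.2), fun v => by simp [torusStep],
      fun v => by simp [torusStep]⟩
  | 2 => exact ⟨fun v => (v.1, v.2 - 1), fun v => by simp [torusStep],
      fun v => by simp [torusStep]⟩
  | 3 => exact ⟨fun v => (v.1 - v.2, v.2), fun v => by simp [torusStep],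
      fun v => by simp [torusStep]⟩
  | 4 => exact ⟨fun v => (v.1, v.2 - v.1), fun v => by simp [torusStep],
      fun v => by simp [torusStep]⟩
  | (k + 5) => exact ⟨id, fun v => rfl, fun v => rfl⟩

lemma sum_torusStep {Q : ℕ} [NeZero Q] {E : Type*} [AddCommMonoid E] (d : ℕ)
    (f : ZMod Q × ZMod Q → E) : ∑ v, f (torusStep d v) = ∑ v, f v :=
  (torusStep_bijective d).sum_comp f

/-- The Fourier transform of a real function on the torus `(ℤ/Q)²`. -/
noncomputable def torusFourier {Q : ℕ} [NeZero Q] (f : ZMod Q × ZMod Q → ℝ)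
    (z : ZMod Q × ZMod Q) : ℂ :=
  ∑ v, (f v : ℂ) * ZMod.stdAddChar (z.1 * v.1 + z.2 * v.2)

lemma torusFourier_sub {Q : ℕ} [NeZero Q] (f g : ZMod Q × ZMod Q → ℝ) (z : ZMod Q × ZMod Q) :
    torusFourier (fun v => f v - g v) z = torusFourier f z - torusFourier g z := by
  simp only [torusFourier, Complex.ofReal_sub, sub_mul, Finset.sum_sub_distrib]

lemma torusFourier_zero {Q : ℕ} [NeZero Q] (f : ZMod Q × ZMod Q → ℝ) (hf : ∑ v, f v = 0) :
    torusFourier f 0 = 0 := by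
  simp [torusFourier, ← Complex.ofReal_sum, hf]

lemma star_stdAddChar {Q : ℕ} [NeZero Q] (a : ZMod Q) :
    (starRingEnd ℂ) (ZMod.stdAddChar a) = ZMod.stdAddChar (-a) := by
  rw [AddChar.map_neg_eq_conj]

/-- Parseval's identity. -/
lemma sum_norm_sq_torusFourier {Q : ℕ} [NeZero Q] (f : ZMod Q × ZMod Q → ℝ) :
    ∑ z, ‖torusFourier f z‖ ^ 2 = (Q : ℝ) ^ 2 * ∑ v, f v ^ 2 := by
  have key : ∀ v w : ZMod Q × ZMod Q, ∑ z : ZMod Q × ZMod Q,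
      (ZMod.stdAddChar (z.1 * v.1 + z.2 * v.2) : ℂ) *
        ZMod.stdAddChar (-(z.1 * w.1 + z.2 * w.2)) = if v = w then (Q : ℂ) ^ 2 else 0 := by
    intro v w
    have h1 : ∀ z : ZMod Q × ZMod Q, (ZMod.stdAddChar (z.1 * v.1 + z.2 * v.2) : ℂ) *
        ZMod.stdAddChar (-(z.1 * w.1 + z.2 * w.2)) =
        ZMod.stdAddChar (z.1 * (v.1 - w.1)) * ZMod.stdAddChar (z.2 * (v.2 - w.2)) := by
      intro z
      rw [← AddChar.map_add_eq_mul, ← AddChar.map_add_eq_mul]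
      congr 1
      ring
    simp_rw [h1]
    rw [Fintype.sum_prod_type]
    simp_rw [← Finset.mul_sum, ← Finset.sum_mul]
    rw [AddChar.sum_mulShift _ (ZMod.isPrimitive_stdAddChar Q),
      AddChar.sum_mulShift _ (ZMod.isPrimitive_stdAddChar Q)]
    simp only [sub_eq_zero, Prod.ext_iff, ZMod.card]
    by_cases h : v.1 = w.1 <;> by_cases h' : v.2 = w.2 <;> simp [h, h', sq]
  have h2 : ((∑ z, ‖torusFourier f z‖ ^ 2 : ℝ) : ℂ) = ((Q : ℝ) ^ 2 * ∑ v, f v ^ 2 : ℝ) := by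
    push_cast
    calc ∑ z, ((‖torusFourier f z‖ : ℂ)) ^ 2
        = ∑ z : ZMod Q × ZMod Q, ∑ v, ∑ w, ((f v : ℂ) * f w) *
            ((ZMod.stdAddChar (z.1 * v.1 + z.2 * v.2) : ℂ) *
              ZMod.stdAddChar (-(z.1 * w.1 + z.2 * w.2))) := by
          refine Finset.sum_congr rfl fun z _ => ?_
          rw [← Complex.mul_conj']
          simp only [torusFourier, map_sum, map_mul, Complex.conj_ofReal, star_stdAddChar,
            Finset.sum_mul_sum]
          refine Finset.sum_congr rfl fun v _ => Finset.sum_congr rfl fun w _ => ?_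
          ring
      _ = ∑ v, ∑ w, ((f v : ℂ) * f w) * (if v = w then (Q : ℂ) ^ 2 else 0) := by
          rw [Finset.sum_comm]
          refine Finset.sum_congr rfl fun v _ => ?_
          rw [Finset.sum_comm]
          refine Finset.sum_congr rfl fun w _ => ?_
          rw [← key, Finset.mul_sum]
      _ = (Q : ℂ) ^ 2 * ∑ v, (f v : ℂ) ^ 2 := by
          simp only [mul_ite, mul_zero, Finset.sum_ite_eq, Finset.mem_univ, if_true]
          rw [Finset.mul_sum]
          refine Finset.sum_congr rfl fun v _ => ?_
          ring
  exact_mod_cast h2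

lemma torusFourier_step_one {Q : ℕ} [NeZero Q] (f : ZMod Q × ZMod Q → ℝ) (z : ZMod Q × ZMod Q) :
    torusFourier (fun v => f (torusStep 1 v)) z = ZMod.stdAddChar (-z.1) * torusFourier f z := by
  simp only [torusFourier]
  rw [← sum_torusStep 1 (fun v => (f v : ℂ) * ZMod.stdAddChar (z.1 * v.1 + z.2 * v.2)),
    Finset.mul_sum]
  refine Finset.sum_congr rfl fun v _ => ?_
  rw [mul_left_comm, ← AddChar.map_add_eq_mul]
  congr 2
  simp only [torusStep]
  ring

lemma torusFourier_step_two {Q : ℕ} [NeZero Q] (f : ZMod Q × ZMod Q → ℝ) (z : ZMod Q × ZMod Q) :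
    torusFourier (fun v => f (torusStep 2 v)) z = ZMod.stdAddChar (-z.2) * torusFourier f z := by
  simp only [torusFourier]
  rw [← sum_torusStep 2 (fun v => (f v : ℂ) * ZMod.stdAddChar (z.1 * v.1 + z.2 * v.2)),
    Finset.mul_sum]
  refine Finset.sum_congr rfl fun v _ => ?_
  rw [mul_left_comm, ← AddChar.map_add_eq_mul]
  congr 2
  simp only [torusStep]
  ring

lemma torusFourier_step_three {Q : ℕ} [NeZero Q] (f : ZMod Q × ZMod Q → ℝ)
    (z : ZMod Q × ZMod Q) :
    torusFourier (fun v => f (torusStep 3 v)) z = torusFourier f (z.1, z.2 - z.1) := by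
  simp only [torusFourier]
  rw [← sum_torusStep 3 (fun v => (f v : ℂ) * ZMod.stdAddChar (z.1 * v.1 + (z.2 - z.1) * v.2))]
  refine Finset.sum_congr rfl fun v _ => ?_
  congr 2
  simp only [torusStep]
  ring

lemma torusFourier_step_four {Q : ℕ} [NeZero Q] (f : ZMod Q × ZMod Q → ℝ)
    (z : ZMod Q × ZMod Q) :
    torusFourier (fun v => f (torusStep 4 v)) z = torusFourier f (z.1 - z.2, z.2) := by
  simp only [torusFourier]
  rw [← sum_torusStep 4 (fun v => (f v : ℂ) * ZMod.stdAddChar ((z.1 - z.2) * v.1 + z.2 * v.2))]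
  refine Finset.sum_congr rfl fun v _ => ?_
  congr 2
  simp only [torusStep]
  ring

/-- The ping-pong step: a set `X` that two permutations `σ`, `τ` map into disjoint parts of
`X ∪ Z`, up to which `F` is almost invariant, carries at most slightly more of the mass of
`|F|²` than `Z`. -/
lemma sum_norm_sq_le_of_pingpong {V : Type*} [Fintype V] [DecidableEq V] (F : V → ℂ)
    (σ τ : V ≃ V) (M : ℝ) (hM : ∑ z, ‖F z‖ ^ 2 = M)
    (hσ : ∑ z, ‖F (σ z) - F z‖ ^ 2 ≤ M / 400) (hτ : ∑ z, ‖F (τ z) - F z‖ ^ 2 ≤ M / 400)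
    (X Z : Finset V) (h1 : ∀ z ∈ X, σ z ∈ X ∪ Z) (h2 : ∀ z ∈ X, τ z ∈ X ∪ Z)
    (hd : ∀ z ∈ X, ∀ w ∈ X, σ z ≠ τ w) :
    ∑ z ∈ X, ‖F z‖ ^ 2 ≤ M / 4 + ∑ z ∈ Z, ‖F z‖ ^ 2 := by
  have aux : ∀ π : V ≃ V, ∑ z, ‖F (π z) - F z‖ ^ 2 ≤ M / 400 →
      ∑ z ∈ X, ‖F z‖ ^ 2 ≤ ∑ z ∈ X.map π.toEmbedding, ‖F z‖ ^ 2 + M / 8 := by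
    intro π hπ
    rw [Finset.sum_map]
    have hb : ∀ z, ‖F z‖ ^ 2 - ‖F (π z)‖ ^ 2 ≤
        10 * ‖F (π z) - F z‖ ^ 2 + (1 / 20) * (‖F z‖ ^ 2 + ‖F (π z)‖ ^ 2) := by
      intro z
      have h := norm_sub_norm_le (F z) (F (π z))
      rw [norm_sub_rev] at h
      have ha := norm_nonneg (F z)
      have hb := norm_nonneg (F (π z))
      have hc := norm_nonneg (F (π z) - F z)
      set a := ‖F z‖
      set b := ‖F (π z)‖
      set c := ‖F (π z) - F z‖
      have : a ^ 2 - b ^ 2 ≤ c * (a + b) := by nlinarith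
      nlinarith [sq_nonneg (20 * c - (a + b)), sq_nonneg (a - b)]
    have hpos : ∀ z, 0 ≤ 10 * ‖F (π z) - F z‖ ^ 2 +
        (1 / 20) * (‖F z‖ ^ 2 + ‖F (π z)‖ ^ 2) := fun z => by positivity
    have h3 : ∑ z ∈ X, (‖F z‖ ^ 2 - ‖F (π z)‖ ^ 2) ≤ M / 8 := by
      calc ∑ z ∈ X, (‖F z‖ ^ 2 - ‖F (π z)‖ ^ 2)
          ≤ ∑ z ∈ X, (10 * ‖F (π z) - F z‖ ^ 2 + (1 / 20) * (‖F z‖ ^ 2 + ‖F (π z)‖ ^ 2)) :=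
            Finset.sum_le_sum fun z _ => hb z
        _ ≤ ∑ z, (10 * ‖F (π z) - F z‖ ^ 2 + (1 / 20) * (‖F z‖ ^ 2 + ‖F (π z)‖ ^ 2)) :=
            Finset.sum_le_sum_of_subset_of_nonneg (Finset.subset_univ _) fun z _ _ => hpos z
        _ ≤ M / 8 := by
            rw [Finset.sum_add_distrib, ← Finset.mul_sum, ← Finset.mul_sum,
              Finset.sum_add_distrib, π.sum_comp (fun z => ‖F z‖ ^ 2), hM]
            linarith
    rw [Finset.sum_sub_distrib] at h3
    simp only [Equiv.coe_toEmbedding]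
    linarith
  have hdis : Disjoint (X.map σ.toEmbedding) (X.map τ.toEmbedding) := by
    rw [Finset.disjoint_left]
    intro a ha hb
    obtain ⟨z, hz, rfl⟩ := Finset.mem_map.1 ha
    obtain ⟨w, hw, h⟩ := Finset.mem_map.1 hb
    exact hd z hz w hw h.symm
  have hsub : X.map σ.toEmbedding ∪ X.map τ.toEmbedding ⊆ X ∪ Z := by
    intro a ha
    rcases Finset.mem_union.1 ha with ha | ha
    · obtain ⟨z, hz, rfl⟩ := Finset.mem_map.1 ha
      exact h1 z hz
    · obtain ⟨z, hz, rfl⟩ := Finset.mem_map.1 ha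
      exact h2 z hz
  have h4 := Finset.sum_le_sum_of_subset_of_nonneg hsub
    (f := fun z => ‖F z‖ ^ 2) (fun z _ _ => by positivity)
  rw [Finset.sum_union hdis] at h4
  have h5 : ∑ z ∈ X ∪ Z, ‖F z‖ ^ 2 ≤ ∑ z ∈ X, ‖F z‖ ^ 2 + ∑ z ∈ Z, ‖F z‖ ^ 2 := by
    rw [← Finset.sum_union_inter]
    have : 0 ≤ ∑ z ∈ X ∩ Z, ‖F z‖ ^ 2 := Finset.sum_nonneg fun z _ => by positivity
    linarith
  have h6 := aux σ hσ
  have h7 := aux τ hτ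
  linarith

/-- Characters at arguments far from `0` are far from `1`. -/
lemma two_le_norm_stdAddChar_sub_one_sq {Q : ℕ} [NeZero Q] (a : ZMod Q)
    (ha : (Q : ℤ) ≤ 4 * |a.valMinAbs|) : 2 ≤ ‖(ZMod.stdAddChar (-a) : ℂ) - 1‖ ^ 2 := by
  have hQ : (0 : ℝ) < Q := by exact_mod_cast Nat.pos_of_ne_zero (NeZero.ne Q)
  have e1 : (ZMod.stdAddChar (-a) : ℂ) =
      Complex.exp ((2 * Real.pi * (-a.valMinAbs) / Q : ℝ) * Complex.I) := by
    conv_lhs => rw [← ZMod.coe_valMinAbs a]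
    rw [← Int.cast_neg, ZMod.stdAddChar_coe]
    congr 1
    push_cast
    ring
  set t : ℝ := 2 * Real.pi * (-a.valMinAbs) / Q with ht
  have hcos : Real.cos t ≤ 0 := by
    rw [← Real.cos_abs]
    have hR : (Q : ℝ) ≤ 4 * |(a.valMinAbs : ℝ)| := by exact_mod_cast ha
    have h2 := ZMod.natAbs_valMinAbs_le a
    have h3 : (2 : ℝ) * |(a.valMinAbs : ℝ)| ≤ Q := by
      have : 2 * a.valMinAbs.natAbs ≤ Q := by omega
      have h' : (2 : ℝ) * (a.valMinAbs.natAbs : ℝ) ≤ Q := by exact_mod_cast this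
      rwa [Nat.cast_natAbs, Int.cast_abs] at h'
    have habs : |t| = Real.pi * (2 * |(a.valMinAbs : ℝ)| / Q) := by
      rw [ht, abs_div, abs_mul, abs_mul, abs_neg, abs_of_pos Real.pi_pos, abs_of_pos hQ]
      simp only [abs_two]
      ring
    have hpi := Real.pi_pos
    apply Real.cos_nonpos_of_pi_div_two_le_of_le
    · rw [habs]
      have : 1 / 2 ≤ 2 * |(a.valMinAbs : ℝ)| / Q := by rw [le_div_iff₀ hQ]; linarith
      nlinarith
    · rw [habs]
      have : 2 * |(a.valMinAbs : ℝ)| / Q ≤ 1 := by rw [div_le_one hQ]; linarith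
      nlinarith
  rw [e1, Complex.sq_norm, Complex.normSq_apply]
  simp only [Complex.sub_re, Complex.sub_im, Complex.exp_ofReal_mul_I_re,
    Complex.exp_ofReal_mul_I_im, Complex.one_re, Complex.one_im]
  nlinarith [Real.sin_sq_add_cos_sq t]

lemma valMinAbs_add_of_lt {Q : ℕ} [NeZero Q] (a b : ZMod Q)
    (ha : 4 * |a.valMinAbs| < (Q : ℤ)) (hb : 4 * |b.valMinAbs| < (Q : ℤ)) :
    (a + b).valMinAbs = a.valMinAbs + b.valMinAbs := by
  rw [ZMod.valMinAbs_spec]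
  refine ⟨by simp, ?_⟩
  rw [Set.mem_Ioc]
  have h1 := abs_lt.1 (show |a.valMinAbs| < (Q : ℤ) from by have := abs_nonneg a.valMinAbs; omega)
  have h2 := neg_abs_le a.valMinAbs
  have h3 := le_abs_self a.valMinAbs
  have h4 := neg_abs_le b.valMinAbs
  have h5 := le_abs_self b.valMinAbs
  constructor <;> omega

lemma valMinAbs_sub_of_lt {Q : ℕ} [NeZero Q] (a b : ZMod Q)
    (ha : 4 * |a.valMinAbs| < (Q : ℤ)) (hb : 4 * |b.valMinAbs| < (Q : ℤ)) :
    (a - b).valMinAbs = a.valMinAbs - b.valMinAbs := by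
  rw [ZMod.valMinAbs_spec]
  refine ⟨by simp, ?_⟩
  rw [Set.mem_Ioc]
  have h2 := neg_abs_le a.valMinAbs
  have h3 := le_abs_self a.valMinAbs
  have h4 := neg_abs_le b.valMinAbs
  have h5 := le_abs_self b.valMinAbs
  constructor <;> omega

/-- A nonzero function of mean zero is moved noticeably by one of the four nontrivial moves. -/
lemma exists_torusStep_moves {Q : ℕ} [NeZero Q] (f : ZMod Q × ZMod Q → ℝ) (hf : ∑ v, f v = 0) :
    ∃ d ∈ Finset.Icc 1 4, (∑ v, f v ^ 2) / 400 ≤ ∑ v, (f (torusStep d v) - f v) ^ 2 := by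
  by_contra! hcon
  have hS : 0 < ∑ v, f v ^ 2 := by
    have h := hcon 1 (by simp)
    have : 0 ≤ ∑ v, (f (torusStep 1 v) - f v) ^ 2 := Finset.sum_nonneg fun v _ => sq_nonneg _
    linarith
  have hQ : (0 : ℝ) < (Q : ℝ) ^ 2 := by
    have : (0 : ℝ) < Q := by exact_mod_cast Nat.pos_of_ne_zero (NeZero.ne Q)
    positivity
  set F := torusFourier f with hF
  set M := ∑ z, ‖F z‖ ^ 2 with hM
  have hMf : M = (Q : ℝ) ^ 2 * ∑ v, f v ^ 2 := sum_norm_sq_torusFourier f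
  have hMpos : 0 < M := by rw [hMf]; positivity
  have hinv : ∀ d ∈ Finset.Icc 1 4,
      ∑ z, ‖torusFourier (fun v => f (torusStep d v)) z - F z‖ ^ 2 ≤ M / 400 := by
    intro d hd
    have h := sum_norm_sq_torusFourier (fun v => f (torusStep d v) - f v)
    simp_rw [torusFourier_sub] at h
    rw [h, hMf, mul_div_assoc]
    exact mul_le_mul_of_nonneg_left (hcon d hd).le hQ.le
  have i1 := hinv 1 (by simp)
  have i2 := hinv 2 (by simp)
  have i3 := hinv 3 (by simp)
  have i4 := hinv 4 (by simp)
  simp_rw [torusFourier_step_one] at i1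
  simp_rw [torusFourier_step_two] at i2
  simp_rw [torusFourier_step_three] at i3
  simp_rw [torusFourier_step_four] at i4
  -- The two shears of the frequency torus.
  let σ : ZMod Q × ZMod Q ≃ ZMod Q × ZMod Q :=
    ⟨fun z => (z.1, z.2 - z.1), fun z => (z.1, z.2 + z.1), fun z => by simp, fun z => by simp⟩
  let τ : ZMod Q × ZMod Q ≃ ZMod Q × ZMod Q :=
    ⟨fun z => (z.1 - z.2, z.2), fun z => (z.1 + z.2, z.2), fun z => by simp, fun z => by simp⟩
  have j3 : ∑ z, ‖F (σ z) - F z‖ ^ 2 ≤ M / 400 := i3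
  have j4 : ∑ z, ‖F (τ z) - F z‖ ^ 2 ≤ M / 400 := i4
  have hsymm : ∀ π : ZMod Q × ZMod Q ≃ ZMod Q × ZMod Q, ∑ z, ‖F (π z) - F z‖ ^ 2 ≤ M / 400 →
      ∑ z, ‖F (π.symm z) - F z‖ ^ 2 ≤ M / 400 := by
    intro π h
    rw [← π.sum_comp]
    simpa [norm_sub_rev] using h
  classical
  -- `Z` is the set of frequencies far from `0`.
  let Z : Finset (ZMod Q × ZMod Q) := Finset.univ.filter fun z =>
    (Q : ℤ) ≤ 4 * |z.1.valMinAbs| ∨ (Q : ℤ) ≤ 4 * |z.2.valMinAbs|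
  let X : Finset (ZMod Q × ZMod Q) := Finset.univ.filter fun z =>
    z ∉ Z ∧ ((0 < z.1.valMinAbs ∧ 0 ≤ z.2.valMinAbs) ∨ (z.1.valMinAbs < 0 ∧ z.2.valMinAbs ≤ 0))
  let X' : Finset (ZMod Q × ZMod Q) := Finset.univ.filter fun z =>
    z ∉ Z ∧ ((0 < z.2.valMinAbs ∧ z.1.valMinAbs ≤ 0) ∨ (z.2.valMinAbs < 0 ∧ 0 ≤ z.1.valMinAbs))
  have memZ : ∀ z, z ∉ Z ↔ 4 * |z.1.valMinAbs| < (Q : ℤ) ∧ 4 * |z.2.valMinAbs| < (Q : ℤ) := by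
    intro z
    simp [Z]
  have memX : ∀ z, z ∈ X ↔ z ∉ Z ∧ ((0 < z.1.valMinAbs ∧ 0 ≤ z.2.valMinAbs) ∨
      (z.1.valMinAbs < 0 ∧ z.2.valMinAbs ≤ 0)) := fun z => by simp [X]
  have memX' : ∀ z, z ∈ X' ↔ z ∉ Z ∧ ((0 < z.2.valMinAbs ∧ z.1.valMinAbs ≤ 0) ∨
      (z.2.valMinAbs < 0 ∧ 0 ≤ z.1.valMinAbs)) := fun z => by simp [X']
  have hZ : ∑ z ∈ Z, ‖F z‖ ^ 2 ≤ M / 400 := by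
    have h1 : ∑ z ∈ Z, 2 * ‖F z‖ ^ 2 ≤ ∑ z ∈ Z,
        (‖ZMod.stdAddChar (-z.1) * F z - F z‖ ^ 2 + ‖ZMod.stdAddChar (-z.2) * F z - F z‖ ^ 2) := by
      refine Finset.sum_le_sum fun z hz => ?_
      have e : ∀ a : ZMod Q, ‖ZMod.stdAddChar (-a) * F z - F z‖ ^ 2 =
          ‖(ZMod.stdAddChar (-a) : ℂ) - 1‖ ^ 2 * ‖F z‖ ^ 2 := by
        intro a
        rw [← mul_pow, ← norm_mul]
        congr 2
        ring
      have hp : 0 ≤ ‖F z‖ ^ 2 := by positivity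
      rcases (Finset.mem_filter.1 hz).2 with h | h
      · have h2 := two_le_norm_stdAddChar_sub_one_sq _ h
        rw [e z.1]
        have : 0 ≤ ‖ZMod.stdAddChar (-z.2) * F z - F z‖ ^ 2 := by positivity
        nlinarith
      · have h2 := two_le_norm_stdAddChar_sub_one_sq _ h
        rw [e z.2]
        have : 0 ≤ ‖ZMod.stdAddChar (-z.1) * F z - F z‖ ^ 2 := by positivity
        nlinarith
    have h2 := Finset.sum_le_sum_of_subset_of_nonneg (Finset.subset_univ Z)
      (f := fun z => ‖ZMod.stdAddChar (-z.1) * F z - F z‖ ^ 2 +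
        ‖ZMod.stdAddChar (-z.2) * F z - F z‖ ^ 2) (fun z _ _ => by positivity)
    rw [← hF] at i1 i2
    simp only [Finset.sum_add_distrib] at h1 h2
    rw [← Finset.mul_sum] at h1
    linarith
  have hX : ∑ z ∈ X, ‖F z‖ ^ 2 ≤ M / 4 + ∑ z ∈ Z, ‖F z‖ ^ 2 := by
    refine sum_norm_sq_le_of_pingpong F σ.symm τ.symm M rfl (hsymm σ j3) (hsymm τ j4) X Z ?_ ?_ ?_
    · intro z hz
      obtain ⟨hzZ, hz2⟩ := (memX z).1 hz
      obtain ⟨ha, hb⟩ := (memZ z).1 hzZ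
      have e1 : ((σ.symm z).2).valMinAbs = z.2.valMinAbs + z.1.valMinAbs :=
        valMinAbs_add_of_lt _ _ hb ha
      have e2 : ((σ.symm z).1).valMinAbs = z.1.valMinAbs := rfl
      rw [Finset.mem_union, or_iff_not_imp_right]
      intro hn
      rw [memX, e1, e2]
      exact ⟨hn, by omega⟩
    · intro z hz
      obtain ⟨hzZ, hz2⟩ := (memX z).1 hz
      obtain ⟨ha, hb⟩ := (memZ z).1 hzZ
      have e1 : ((τ.symm z).1).valMinAbs = z.1.valMinAbs + z.2.valMinAbs :=
        valMinAbs_add_of_lt _ _ ha hb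
      have e2 : ((τ.symm z).2).valMinAbs = z.2.valMinAbs := rfl
      rw [Finset.mem_union, or_iff_not_imp_right]
      intro hn
      rw [memX, e1, e2]
      exact ⟨hn, by omega⟩
    · intro z hz w hw he
      obtain ⟨hzZ, hz2⟩ := (memX z).1 hz
      obtain ⟨ha, hb⟩ := (memZ z).1 hzZ
      obtain ⟨hwZ, hw2⟩ := (memX w).1 hw
      obtain ⟨hc, hd⟩ := (memZ w).1 hwZ
      have e1 : ((σ.symm z).2).valMinAbs = z.2.valMinAbs + z.1.valMinAbs :=
        valMinAbs_add_of_lt _ _ hb ha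
      have e2 : ((σ.symm z).1).valMinAbs = z.1.valMinAbs := rfl
      have e3 : ((τ.symm w).1).valMinAbs = w.1.valMinAbs + w.2.valMinAbs :=
        valMinAbs_add_of_lt _ _ hc hd
      have e4 : ((τ.symm w).2).valMinAbs = w.2.valMinAbs := rfl
      rw [he] at e1 e2
      rw [e3] at e2
      rw [e4] at e1
      omega
  have hX' : ∑ z ∈ X', ‖F z‖ ^ 2 ≤ M / 4 + ∑ z ∈ Z, ‖F z‖ ^ 2 := by
    refine sum_norm_sq_le_of_pingpong F σ τ M rfl j3 j4 X' Z ?_ ?_ ?_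
    · intro z hz
      obtain ⟨hzZ, hz2⟩ := (memX' z).1 hz
      obtain ⟨ha, hb⟩ := (memZ z).1 hzZ
      have e1 : ((σ z).2).valMinAbs = z.2.valMinAbs - z.1.valMinAbs :=
        valMinAbs_sub_of_lt _ _ hb ha
      have e2 : ((σ z).1).valMinAbs = z.1.valMinAbs := rfl
      rw [Finset.mem_union, or_iff_not_imp_right]
      intro hn
      rw [memX', e1, e2]
      exact ⟨hn, by omega⟩
    · intro z hz
      obtain ⟨hzZ, hz2⟩ := (memX' z).1 hz
      obtain ⟨ha, hb⟩ := (memZ z).1 hzZ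
      have e1 : ((τ z).1).valMinAbs = z.1.valMinAbs - z.2.valMinAbs :=
        valMinAbs_sub_of_lt _ _ ha hb
      have e2 : ((τ z).2).valMinAbs = z.2.valMinAbs := rfl
      rw [Finset.mem_union, or_iff_not_imp_right]
      intro hn
      rw [memX', e1, e2]
      exact ⟨hn, by omega⟩
    · intro z hz w hw he
      obtain ⟨hzZ, hz2⟩ := (memX' z).1 hz
      obtain ⟨ha, hb⟩ := (memZ z).1 hzZ
      obtain ⟨hwZ, hw2⟩ := (memX' w).1 hw
      obtain ⟨hc, hd⟩ := (memZ w).1 hwZ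
      have e1 : ((σ z).2).valMinAbs = z.2.valMinAbs - z.1.valMinAbs :=
        valMinAbs_sub_of_lt _ _ hb ha
      have e2 : ((σ z).1).valMinAbs = z.1.valMinAbs := rfl
      have e3 : ((τ w).1).valMinAbs = w.1.valMinAbs - w.2.valMinAbs :=
        valMinAbs_sub_of_lt _ _ hc hd
      have e4 : ((τ w).2).valMinAbs = w.2.valMinAbs := rfl
      rw [he] at e1 e2
      rw [e3] at e2
      rw [e4] at e1
      omega
  -- `X`, `X'`, `Z` and the origin, where `F` vanishes, cover all frequencies.
  have hcover : M ≤ ∑ z ∈ X, ‖F z‖ ^ 2 + ∑ z ∈ X', ‖F z‖ ^ 2 + ∑ z ∈ Z, ‖F z‖ ^ 2 := by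
    have hpt : ∀ z, ‖F z‖ ^ 2 ≤ (if z ∈ X then ‖F z‖ ^ 2 else 0) +
        (if z ∈ X' then ‖F z‖ ^ 2 else 0) + (if z ∈ Z then ‖F z‖ ^ 2 else 0) := by
      intro z
      have hp : 0 ≤ ‖F z‖ ^ 2 := by positivity
      by_cases h0 : z = 0
      · have : F z = 0 := by rw [h0]; exact torusFourier_zero f hf
        simp [this]
      · have hmem : z ∈ X ∨ z ∈ X' ∨ z ∈ Z := by
          by_contra! hn
          have hn1 : ¬_ := fun h => hn.1 ((memX z).2 ⟨hn.2.2, h⟩)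
          have hn2 : ¬_ := fun h => hn.2.1 ((memX' z).2 ⟨hn.2.2, h⟩)
          apply h0
          have hz1 : z.1.valMinAbs = 0 := by omega
          have hz2 : z.2.valMinAbs = 0 := by omega
          rw [ZMod.valMinAbs_eq_zero] at hz1 hz2
          exact Prod.ext hz1 hz2
        rcases hmem with h | h | h <;> rw [if_pos h] <;> split_ifs <;> linarith
    calc M ≤ ∑ z, ((if z ∈ X then ‖F z‖ ^ 2 else 0) +
        (if z ∈ X' then ‖F z‖ ^ 2 else 0) + (if z ∈ Z then ‖F z‖ ^ 2 else 0)) :=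
          Finset.sum_le_sum fun z _ => hpt z
      _ = _ := by
          simp only [Finset.sum_add_distrib, Finset.sum_ite_mem, Finset.univ_inter]
  linarith

/-- The averaging operator of the walk. -/
noncomputable def torusAvg {Q : ℕ} (f : ZMod Q × ZMod Q → ℝ) (v : ZMod Q × ZMod Q) : ℝ :=
  (∑ d ∈ Finset.range 5, f (torusStep d v)) / 5

/-- The spectral gap: the averaging operator contracts functions of mean zero by a factor that
does not depend on `Q`. -/
lemma sum_torusAvg_sq_le {Q : ℕ} [NeZero Q] (f : ZMod Q × ZMod Q → ℝ) (hf : ∑ v, f v = 0) :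
    ∑ v, torusAvg f v ^ 2 ≤ (9999 / 10000) * ∑ v, f v ^ 2 := by
  obtain ⟨d, hd, h⟩ := exists_torusStep_moves f hf
  have hpt : ∀ v, 25 * torusAvg f v ^ 2 ≤
      5 * (∑ e ∈ Finset.range 5, f (torusStep e v) ^ 2) - (f (torusStep d v) - f v) ^ 2 := by
    intro v
    simp only [torusAvg, Finset.sum_range_succ, Finset.sum_range_zero]
    have e0 : torusStep 0 v = v := rfl
    rw [e0]
    generalize ha : f (torusStep 1 v) = a
    generalize hb : f (torusStep 2 v) = b
    generalize hc : f (torusStep 3 v) = c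
    generalize hdd : f (torusStep 4 v) = d'
    rw [Finset.mem_Icc] at hd
    obtain ⟨hd1, hd2⟩ := hd
    -- `(∑ a k)² = 5 ∑ (a k)² - ∑_{k < l} (a k - a l)²`
    interval_cases d
    · rw [ha]
      linarith [sq_nonneg (b - f v), sq_nonneg (c - f v), sq_nonneg (d' - f v), sq_nonneg (a - b),
        sq_nonneg (a - c), sq_nonneg (a - d'), sq_nonneg (b - c), sq_nonneg (b - d'),
        sq_nonneg (c - d')]
    · rw [hb]
      linarith [sq_nonneg (a - f v), sq_nonneg (c - f v), sq_nonneg (d' - f v), sq_nonneg (a - b),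
        sq_nonneg (a - c), sq_nonneg (a - d'), sq_nonneg (b - c), sq_nonneg (b - d'),
        sq_nonneg (c - d')]
    · rw [hc]
      linarith [sq_nonneg (b - f v), sq_nonneg (a - f v), sq_nonneg (d' - f v), sq_nonneg (a - b),
        sq_nonneg (a - c), sq_nonneg (a - d'), sq_nonneg (b - c), sq_nonneg (b - d'),
        sq_nonneg (c - d')]
    · rw [hdd]
      linarith [sq_nonneg (b - f v), sq_nonneg (c - f v), sq_nonneg (a - f v), sq_nonneg (a - b),
        sq_nonneg (a - c), sq_nonneg (a - d'), sq_nonneg (b - c), sq_nonneg (b - d'),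
        sq_nonneg (c - d')]
  have hsum := Finset.sum_le_sum fun v (_ : v ∈ Finset.univ) => hpt v
  rw [← Finset.mul_sum, Finset.sum_sub_distrib, ← Finset.mul_sum, Finset.sum_comm] at hsum
  simp_rw [fun e => sum_torusStep e (fun v => f v ^ 2)] at hsum
  simp only [Finset.sum_const, Finset.card_range, nsmul_eq_mul] at hsum
  push_cast at hsum
  linarith

/-! ### Walks on the torus that stay in prescribed sets -/

lemma Finset.sum_range_mul_eq {E : Type*} [AddCommMonoid E] (a b : ℕ) (f : ℕ → ℕ → E) :
    ∑ x ∈ Finset.range (a * b), f (x % a) (x / a) =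
      ∑ i ∈ Finset.range a, ∑ j ∈ Finset.range b, f i j := by
  rw [← Finset.sum_product']
  refine Finset.sum_bij' (fun x _ => (x % a, x / a)) (fun p _ => p.1 + a * p.2) ?_ ?_ ?_ ?_ ?_
  · intro x hx
    rw [Finset.mem_range] at hx
    have ha : 0 < a := Nat.pos_of_ne_zero fun h => by simp [h] at hx
    simp only [Finset.mem_product, Finset.mem_range]
    exact ⟨Nat.mod_lt _ ha, Nat.div_lt_of_lt_mul hx⟩
  · rintro ⟨i, j⟩ hp
    simp only [Finset.mem_product, Finset.mem_range] at hp ⊢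
    calc i + a * j < a * (j + 1) := by rw [mul_add]; omega
      _ ≤ a * b := Nat.mul_le_mul_left _ hp.2
  · intro x _
    exact Nat.mod_add_div x a
  · rintro ⟨i, j⟩ hp
    simp only [Finset.mem_product, Finset.mem_range] at hp
    have ha : 0 < a := by omega
    ext
    · simp [Nat.mod_eq_of_lt hp.1]
    · simp [Nat.add_mul_div_left _ _ ha, Nat.div_eq_of_lt hp.1]
  · intro x _
    rfl

/-- The position after `t` steps of the walk that starts at `v` and reads its moves from the digits
of `G` in base `5`, the least significant one first. -/
def torusPos {Q : ℕ} (G : ℕ) : ℕ → ZMod Q × ZMod Q → ZMod Q × ZMod Q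
  | 0, v => v
  | t + 1, v => torusPos (G / 5) t (torusStep (G % 5) v)

lemma torusPos_add {Q : ℕ} (G t e : ℕ) (v : ZMod Q × ZMod Q) :
    torusPos G (t + e) v = torusPos (G / 5 ^ t) e (torusPos G t v) := by
  induction t generalizing G v with
  | zero => simp [torusPos]
  | succ t ih =>
    rw [Nat.add_right_comm, torusPos, ih, torusPos, Nat.div_div_eq_div_mul, ← pow_succ']

lemma sum_torusPos {Q : ℕ} (e M : ℕ) (φ : ZMod Q × ZMod Q → ℕ → ℝ) (v : ZMod Q × ZMod Q) :
    ∑ G ∈ Finset.range (5 ^ e * M), φ (torusPos G e v) (G / 5 ^ e) =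
      5 ^ e * torusAvg^[e] (fun w => ∑ G ∈ Finset.range M, φ w G) v := by
  induction e generalizing v with
  | zero => simp [torusPos]
  | succ e ih =>
    have h1 : ∀ G : ℕ, φ (torusPos G (e + 1) v) (G / 5 ^ (e + 1)) =
        (fun d G' => φ (torusPos G' e (torusStep d v)) (G' / 5 ^ e)) (G % 5) (G / 5) := by
      intro G
      simp only [torusPos]
      rw [Nat.div_div_eq_div_mul, ← pow_succ']
    rw [Finset.sum_congr rfl fun G _ => h1 G, pow_succ' 5 e, mul_assoc,
      Finset.sum_range_mul_eq 5 (5 ^ e * M)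
        (fun d G' => φ (torusPos G' e (torusStep d v)) (G' / 5 ^ e))]
    simp_rw [ih]
    rw [← Finset.mul_sum, Function.iterate_succ_apply', torusAvg, pow_succ]
    ring

/-- `VisitsAll l v G` says that the walk from `v` with moves `G` visits the sets of the list in
order: for a list of pairs `(e, B)`, it is in `B` after `e` more steps. -/
def VisitsAll {Q : ℕ} : List (ℕ × Finset (ZMod Q × ZMod Q)) → ZMod Q × ZMod Q → ℕ → Prop
  | [], _, _ => True
  | (e, B) :: l, v, G => torusPos G e v ∈ B ∧ VisitsAll l (torusPos G e v) (G / 5 ^ e)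

open Classical in
/-- The probability that a walk with random moves from `v` visits the sets of the list in order. -/
noncomputable def visitProb {Q : ℕ} :
    List (ℕ × Finset (ZMod Q × ZMod Q)) → ZMod Q × ZMod Q → ℝ
  | [] => fun _ => 1
  | (e, B) :: l => torusAvg^[e] fun v => if v ∈ B then visitProb l v else 0

open Classical in
lemma sum_visitsAll {Q : ℕ} (l : List (ℕ × Finset (ZMod Q × ZMod Q))) (M : ℕ)
    (v : ZMod Q × ZMod Q) :
    ∑ G ∈ Finset.range (5 ^ (l.map Prod.fst).sum * M), (if VisitsAll l v G then (1 : ℝ) else 0) =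
      5 ^ (l.map Prod.fst).sum * M * visitProb l v := by
  induction l generalizing v with
  | nil => simp [VisitsAll, visitProb]
  | cons p l ih =>
    obtain ⟨e, B⟩ := p
    have hcongr : ∀ G : ℕ, (if VisitsAll ((e, B) :: l) v G then (1 : ℝ) else 0) =
        (fun w G' => if w ∈ B ∧ VisitsAll l w G' then (1 : ℝ) else 0) (torusPos G e v)
          (G / 5 ^ e) := fun G => if_congr Iff.rfl rfl rfl
    rw [Finset.sum_congr rfl fun G _ => hcongr G]
    simp only [List.map_cons, List.sum_cons, visitProb]
    rw [pow_add, mul_assoc, sum_torusPos e _ (fun w G' =>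
      if w ∈ B ∧ VisitsAll l w G' then (1 : ℝ) else 0) v]
    have h : (fun w => ∑ G ∈ Finset.range (5 ^ (l.map Prod.fst).sum * M),
        if w ∈ B ∧ VisitsAll l w G then (1 : ℝ) else 0) =
        fun w => (5 ^ (l.map Prod.fst).sum * M) * (if w ∈ B then visitProb l w else 0) := by
      funext w
      by_cases hw : w ∈ B
      · simp only [hw, true_and, if_true]
        exact ih w
      · simp [hw]
    have hlin : ∀ (e : ℕ) (c : ℝ) (f : ZMod Q × ZMod Q → ℝ),
        torusAvg^[e] (fun w => c * f w) = fun w => c * torusAvg^[e] f w := by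
      intro e c f
      induction e generalizing f with
      | zero => rfl
      | succ e ihe =>
        rw [Function.iterate_succ_apply', Function.iterate_succ_apply', ihe]
        funext w
        simp only [torusAvg]
        rw [← Finset.mul_sum, mul_div_assoc]
    rw [h, hlin]
    ring

lemma sum_torusAvg {Q : ℕ} [NeZero Q] (f : ZMod Q × ZMod Q → ℝ) :
    ∑ v, torusAvg f v = ∑ v, f v := by
  simp only [torusAvg]
  rw [← Finset.sum_div, Finset.sum_comm]
  simp_rw [fun e => sum_torusStep e f]
  simp

lemma sum_torusAvg_iterate {Q : ℕ} [NeZero Q] (f : ZMod Q × ZMod Q → ℝ) (e : ℕ) :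
    ∑ v, torusAvg^[e] f v = ∑ v, f v := by
  induction e with
  | zero => rfl
  | succ e ih => rw [Function.iterate_succ_apply', sum_torusAvg, ih]

lemma sum_torusAvg_iterate_sq_le {Q : ℕ} [NeZero Q] (f : ZMod Q × ZMod Q → ℝ) (E : ℝ)
    (hE : ∑ v, (f v - E) = 0) (e : ℕ) :
    ∑ v, (torusAvg^[e] f v - E) ^ 2 ≤ (9999 / 10000) ^ e * ∑ v, (f v - E) ^ 2 := by
  have hsub : ∀ g : ZMod Q × ZMod Q → ℝ,
      torusAvg (fun v => g v - E) = fun v => torusAvg g v - E := by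
    intro g
    funext v
    simp only [torusAvg, Finset.sum_sub_distrib, Finset.sum_const, Finset.card_range, nsmul_eq_mul]
    push_cast
    ring
  induction e with
  | zero => simp
  | succ e ih =>
    have h0 : ∑ v, (torusAvg^[e] f v - E) = 0 := by
      rw [Finset.sum_sub_distrib, sum_torusAvg_iterate, ← Finset.sum_sub_distrib, hE]
    have h1 := sum_torusAvg_sq_le _ h0
    rw [hsub] at h1
    rw [Function.iterate_succ_apply', pow_succ]
    nlinarith

/-- The density of a set of points of the torus. -/
noncomputable def torusDensity {Q : ℕ} (B : Finset (ZMod Q × ZMod Q)) : ℝ :=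
  (B.card : ℝ) / (Q : ℝ) ^ 2

open Classical in
/-- One link of the walk. The hypothesis `hg` says that `g` behaves, up to a constant, like a
multiple of the indicator function of a set of density `β'`; the conclusion says the same of the
product of the indicator function of `B` with the `e`-fold average of `g`, and that its mean is
within a constant factor of what independence would give. -/
lemma walk_link {Q : ℕ} [NeZero Q] (g : ZMod Q × ZMod Q → ℝ) (B : Finset (ZMod Q × ZMod Q))
    (e : ℕ) (E β' : ℝ) (hE : 0 < E) (hβ' : 0 < β') (hB : 0 < torusDensity B)
    (hsum : ∑ v, g v = (Q : ℝ) ^ 2 * E) (hg : ∑ v, g v ^ 2 ≤ (Q : ℝ) ^ 2 * (4 / β' * E ^ 2))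
    (he : (9999 / 10000 : ℝ) ^ e ≤ torusDensity B * β' / 64) :
    ∃ E', (∑ v, if v ∈ B then torusAvg^[e] g v else 0) = (Q : ℝ) ^ 2 * E' ∧
      3 / 4 * torusDensity B * E ≤ E' ∧
      (∑ v, (if v ∈ B then torusAvg^[e] g v else 0) ^ 2) ≤
        (Q : ℝ) ^ 2 * (4 / torusDensity B * E' ^ 2) := by
  set N : ℝ := (Q : ℝ) ^ 2 with hN
  have hNpos : 0 < N := by
    have : (0 : ℝ) < Q := by exact_mod_cast Nat.pos_of_ne_zero (NeZero.ne Q)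
    positivity
  set β := torusDensity B with hβ
  have hcard : (B.card : ℝ) = N * β := by
    rw [hβ, torusDensity, mul_div_cancel₀ _ hNpos.ne']
  set a := torusAvg^[e] g with ha
  have hVcard : ((Finset.univ : Finset (ZMod Q × ZMod Q)).card : ℝ) = N := by
    rw [Finset.card_univ, Fintype.card_prod, ZMod.card, hN]
    push_cast
    ring
  have hmean : ∑ v, (g v - E) = 0 := by
    rw [Finset.sum_sub_distrib, hsum, Finset.sum_const, nsmul_eq_mul, hVcard]
    ring
  have hvar : ∑ v, (g v - E) ^ 2 ≤ N * (4 / β' * E ^ 2) := by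
    have : ∑ v, (g v - E) ^ 2 = ∑ v, g v ^ 2 - 2 * E * ∑ v, g v + N * E ^ 2 := by
      simp only [sub_sq, Finset.sum_add_distrib, Finset.sum_sub_distrib, Finset.sum_const,
        nsmul_eq_mul, hVcard, Finset.mul_sum]
      congr 2
      refine Finset.sum_congr rfl fun v _ => ?_
      ring
    rw [this, hsum]
    nlinarith [mul_pos hNpos (mul_pos hE hE)]
  have hD : ∑ v, (a v - E) ^ 2 ≤ N * β * E ^ 2 / 16 := by
    calc ∑ v, (a v - E) ^ 2 ≤ (9999 / 10000) ^ e * ∑ v, (g v - E) ^ 2 :=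
          sum_torusAvg_iterate_sq_le g E hmean e
      _ ≤ (β * β' / 64) * (N * (4 / β' * E ^ 2)) :=
          mul_le_mul he hvar (Finset.sum_nonneg fun v _ => sq_nonneg _) (by positivity)
      _ = N * β * E ^ 2 / 16 := by field_simp; norm_num
  have hDB : ∑ v ∈ B, (a v - E) ^ 2 ≤ N * β * E ^ 2 / 16 :=
    (Finset.sum_le_sum_of_subset_of_nonneg (Finset.subset_univ _)
      fun v _ _ => sq_nonneg _).trans hD
  have hlow : 3 / 4 * β * E * N ≤ ∑ v ∈ B, a v := by
    have hpt : ∀ v ∈ B, 7 / 8 * E - 2 / E * (a v - E) ^ 2 ≤ a v := by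
      intro v _
      have : a v - (7 / 8 * E - 2 / E * (a v - E) ^ 2) =
          2 / E * ((a v - E) + E / 4) ^ 2 := by
        field_simp
        ring
      have h2 : 0 ≤ 2 / E * ((a v - E) + E / 4) ^ 2 := by positivity
      linarith
    have h := Finset.sum_le_sum hpt
    rw [Finset.sum_sub_distrib, Finset.sum_const, nsmul_eq_mul, hcard, ← Finset.mul_sum] at h
    have h3 : 2 / E * ∑ v ∈ B, (a v - E) ^ 2 ≤ 2 / E * (N * β * E ^ 2 / 16) :=
      mul_le_mul_of_nonneg_left hDB (by positivity)
    have h4 : 2 / E * (N * β * E ^ 2 / 16) = N * β * E / 8 := by field_simp; norm_num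
    nlinarith
  have hupp : ∑ v ∈ B, a v ^ 2 ≤ 17 / 8 * N * β * E ^ 2 := by
    have hpt : ∀ v ∈ B, a v ^ 2 ≤ 2 * E ^ 2 + 2 * (a v - E) ^ 2 := fun v _ => by
      nlinarith [sq_nonneg (a v - 2 * E)]
    have h := Finset.sum_le_sum hpt
    rw [Finset.sum_add_distrib, Finset.sum_const, nsmul_eq_mul, hcard, ← Finset.mul_sum] at h
    nlinarith
  have e1 : (∑ v, if v ∈ B then a v else 0) = ∑ v ∈ B, a v := by
    rw [Finset.sum_ite_mem, Finset.univ_inter]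
  have e2 : (∑ v, (if v ∈ B then a v else 0) ^ 2) = ∑ v ∈ B, a v ^ 2 := by
    simp only [ite_pow, ne_eq, OfNat.ofNat_ne_zero, not_false_eq_true, zero_pow]
    rw [Finset.sum_ite_mem, Finset.univ_inter]
  refine ⟨(∑ v ∈ B, a v) / N, ?_, ?_, ?_⟩
  · rw [e1]
    field_simp
  · rw [le_div_iff₀ hNpos]
    exact hlow
  · rw [e2]
    refine hupp.trans ?_
    set S := (∑ v ∈ B, a v) / N
    have h5 : 3 / 4 * β * E ≤ S := by
      rw [le_div_iff₀ hNpos]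
      exact hlow
    have h6 : (3 / 4 * β * E) ^ 2 ≤ S ^ 2 := pow_le_pow_left₀ (by positivity) h5 2
    have h7 : 4 / β * (3 / 4 * β * E) ^ 2 ≤ 4 / β * S ^ 2 :=
      mul_le_mul_of_nonneg_left h6 (by positivity)
    have h8 : 4 / β * (3 / 4 * β * E) ^ 2 = 9 / 4 * β * E ^ 2 := by field_simp; norm_num
    rw [h8] at h7
    have h9 := mul_le_mul_of_nonneg_left h7 hNpos.le
    have h10 : 0 ≤ N * β * E ^ 2 := by positivity
    linarith

/-- A walk that makes enough steps between consecutive sets of the list visits them all with at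
least the probability that independent points would have, up to a constant factor per set. -/
lemma prod_le_sum_visitProb {Q : ℕ} [NeZero Q] (l : List (ℕ × Finset (ZMod Q × ZMod Q)))
    (hpos : ∀ p ∈ l, 0 < torusDensity p.2)
    (hchain : l.IsChain fun p p' =>
      (9999 / 10000 : ℝ) ^ p'.1 ≤ torusDensity p.2 * torusDensity p'.2 / 64) :
    (Q : ℝ) ^ 2 * (l.map fun p => 3 / 4 * torusDensity p.2).prod ≤ ∑ v, visitProb l v := by
  classical
  have hNpos : (0 : ℝ) < (Q : ℝ) ^ 2 := by
    have : (0 : ℝ) < Q := by exact_mod_cast Nat.pos_of_ne_zero (NeZero.ne Q)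
    positivity
  have hVcard : ((Finset.univ : Finset (ZMod Q × ZMod Q)).card : ℝ) = (Q : ℝ) ^ 2 := by
    rw [Finset.card_univ, Fintype.card_prod, ZMod.card]
    push_cast
    ring
  have main : ∀ (l : List (ℕ × Finset (ZMod Q × ZMod Q))) (e : ℕ) (B : Finset (ZMod Q × ZMod Q)),
      (∀ p ∈ (e, B) :: l, 0 < torusDensity p.2) →
      ((e, B) :: l).IsChain (fun p p' =>
        (9999 / 10000 : ℝ) ^ p'.1 ≤ torusDensity p.2 * torusDensity p'.2 / 64) →
      ∃ E, (∑ v, if v ∈ B then visitProb l v else 0) = (Q : ℝ) ^ 2 * E ∧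
        (((e, B) :: l).map fun p => 3 / 4 * torusDensity p.2).prod ≤ E ∧
        (∑ v, (if v ∈ B then visitProb l v else 0) ^ 2) ≤
          (Q : ℝ) ^ 2 * (4 / torusDensity B * E ^ 2) := by
    intro l
    induction l with
    | nil =>
      intro e B hp _
      have hB : 0 < torusDensity B := hp (e, B) (by simp)
      have hcard : (B.card : ℝ) = (Q : ℝ) ^ 2 * torusDensity B := by
        rw [torusDensity, mul_div_cancel₀ _ hNpos.ne']
      refine ⟨torusDensity B, ?_, ?_, ?_⟩
      · simp [visitProb, ← hcard]
      · simp
        linarith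
      · simp only [visitProb, ite_pow, one_pow, ne_eq, OfNat.ofNat_ne_zero, not_false_eq_true,
          zero_pow, Finset.sum_ite_mem, Finset.univ_inter, Finset.sum_const, nsmul_eq_mul, mul_one]
        rw [hcard]
        refine mul_le_mul_of_nonneg_left ?_ hNpos.le
        have : 4 / torusDensity B * torusDensity B ^ 2 = 4 * torusDensity B := by field_simp
        rw [this]
        linarith
    | cons p l ih =>
      intro e B hp hc
      obtain ⟨e', B'⟩ := p
      rw [List.isChain_cons_cons] at hc
      have hB : 0 < torusDensity B := hp (e, B) (by simp)
      have hB' : 0 < torusDensity B' := hp (e', B') (by simp)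
      obtain ⟨E, h1, h2, h3⟩ := ih e' B' (fun p hpm => hp p (List.mem_cons_of_mem _ hpm)) hc.2
      have hprod : 0 < (((e', B') :: l).map fun p => 3 / 4 * torusDensity p.2).prod := by
        apply List.prod_pos
        intro x hx
        obtain ⟨p, hpm, rfl⟩ := List.mem_map.1 hx
        have := hp p (List.mem_cons_of_mem _ hpm)
        positivity
      obtain ⟨E', h4, h5, h6⟩ := walk_link _ B e' E _ (hprod.trans_le h2) hB' hB h1 h3 hc.1
      refine ⟨E', h4, ?_, h6⟩
      rw [List.map_cons, List.prod_cons]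
      exact (mul_le_mul_of_nonneg_left h2 (by positivity)).trans h5
  cases l with
  | nil => simp [visitProb, sq]
  | cons p l =>
    obtain ⟨e, B⟩ := p
    obtain ⟨E, h1, h2, -⟩ := main l e B hpos hchain
    rw [visitProb, sum_torusAvg_iterate, h1]
    exact mul_le_mul_of_nonneg_left h2 hNpos.le

lemma visitsAll_map_range {Q : ℕ} (T : ℕ) (e : ℕ → ℕ) (B : ℕ → Finset (ZMod Q × ZMod Q))
    (v : ZMod Q × ZMod Q) (G : ℕ)
    (h : VisitsAll ((List.range T).map fun b => (e b, B b)) v G) :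
    ∀ b < T, torusPos G (∑ j ∈ Finset.range (b + 1), e j) v ∈ B b := by
  induction T generalizing e B v G with
  | zero => simp
  | succ T ih =>
    rw [List.range_succ_eq_map, List.map_cons, List.map_map] at h
    obtain ⟨h1, h2⟩ := h
    intro b hb
    cases b with
    | zero => simpa using h1
    | succ b =>
      have := ih (fun b => e (b + 1)) (fun b => B (b + 1)) _ _ h2 b (by omega)
      rwa [Finset.sum_range_succ', add_comm (∑ k ∈ Finset.range (b + 1), e (k + 1)), torusPos_add]

open Classical in
/-- The number of pairs of a starting point and a sequence of moves for which the walk is in `B b`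
at time `e 0 + ⋯ + e b`, for all `b < T`. -/
lemma le_card_walks {Q : ℕ} [NeZero Q] (T M : ℕ) (e : ℕ → ℕ) (B : ℕ → Finset (ZMod Q × ZMod Q))
    (hM : ∑ j ∈ Finset.range T, e j ≤ M)
    (hpos : ∀ b < T, 0 < torusDensity (B b))
    (hchain : ∀ b, b + 1 < T → (9999 / 10000 : ℝ) ^ e (b + 1) ≤
      torusDensity (B b) * torusDensity (B (b + 1)) / 64) :
    (Q : ℝ) ^ 2 * 5 ^ M * ∏ b ∈ Finset.range T, (3 / 4 * torusDensity (B b)) ≤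
      ∑ v : ZMod Q × ZMod Q, ∑ G ∈ Finset.range (5 ^ M),
        if ∀ b < T, torusPos G (∑ j ∈ Finset.range (b + 1), e j) v ∈ B b then (1 : ℝ) else 0 := by
  set l := (List.range T).map fun b => (e b, B b) with hl
  have hsum : (l.map Prod.fst).sum = ∑ j ∈ Finset.range T, e j := by
    rw [hl, List.map_map, Finset.sum_eq_multiset_sum]
    rfl
  have h1 := prod_le_sum_visitProb l
    (by
      intro p hp
      obtain ⟨b, hb, rfl⟩ := List.mem_map.1 hp
      exact hpos b (List.mem_range.1 hb))
    (by
      rw [hl, List.isChain_map]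
      cases T with
      | zero => simp
      | succ T =>
        rw [List.isChain_range_succ]
        intro b hb
        exact hchain b (by omega))
  have hprod : (l.map fun p => 3 / 4 * torusDensity p.2).prod =
      ∏ b ∈ Finset.range T, (3 / 4 * torusDensity (B b)) := by
    rw [hl, List.map_map, Finset.prod_eq_multiset_prod]
    rfl
  rw [hprod] at h1
  obtain ⟨r, rfl⟩ := Nat.exists_eq_add_of_le hM
  calc (Q : ℝ) ^ 2 * 5 ^ (∑ j ∈ Finset.range T, e j + r) *
        ∏ b ∈ Finset.range T, (3 / 4 * torusDensity (B b))
      = 5 ^ (∑ j ∈ Finset.range T, e j + r) * ((Q : ℝ) ^ 2 *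
        ∏ b ∈ Finset.range T, (3 / 4 * torusDensity (B b))) := by ring
    _ ≤ 5 ^ (∑ j ∈ Finset.range T, e j + r) * ∑ v, visitProb l v :=
        mul_le_mul_of_nonneg_left h1 (by positivity)
    _ = ∑ v, ∑ G ∈ Finset.range (5 ^ (∑ j ∈ Finset.range T, e j + r)),
          (if VisitsAll l v G then (1 : ℝ) else 0) := by
        rw [Finset.mul_sum]
        refine Finset.sum_congr rfl fun v _ => ?_
        have := sum_visitsAll l (5 ^ r) v
        rw [hsum, ← pow_add] at this
        rw [this, pow_add]
        push_cast
        ring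
    _ ≤ _ := by
        refine Finset.sum_le_sum fun v _ => Finset.sum_le_sum fun G _ => ?_
        by_cases h : VisitsAll l v G
        · rw [if_pos h, if_pos (visitsAll_map_range T e B v G h)]
        · rw [if_neg h]
          split_ifs <;> norm_num

/-! ### Pairwise independent values -/

/-- The `i`-th value in `[m]` that a point of the torus encodes: `v.1 + i * v.2`, reduced modulo
`m`. For a prime `Q` the values at two different indices are almost independent. -/
def torusValue {Q m : ℕ} (hm : 0 < m) (i : ℕ) (v : ZMod Q × ZMod Q) : Fin m :=
  ⟨(v.1 + i * v.2).val % m, Nat.mod_lt _ hm⟩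

/-- The elements of `ℤ/Q` whose representative in `[0, Q)` is congruent modulo `m` to an element
of `A`. -/
def residueSet (Q : ℕ) [NeZero Q] {m : ℕ} (hm : 0 < m) (A : Finset (Fin m)) : Finset (ZMod Q) :=
  Finset.univ.filter fun x => (⟨x.val % m, Nat.mod_lt _ hm⟩ : Fin m) ∈ A

lemma ZMod.card_filter_val {Q : ℕ} [NeZero Q] (p : ℕ → Prop) [DecidablePred p] :
    (Finset.univ.filter fun x : ZMod Q => p x.val).card = ((Finset.range Q).filter p).card := by
  refine Finset.card_bij (fun x _ => x.val) ?_ ?_ ?_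
  · intro x hx
    simp only [Finset.mem_filter, Finset.mem_univ, true_and] at hx
    simp [hx, ZMod.val_lt]
  · intro x _ y _ h
    exact ZMod.val_injective Q h
  · intro y hy
    simp only [Finset.mem_filter, Finset.mem_range] at hy
    exact ⟨(y : ZMod Q), by simp [ZMod.val_natCast_of_lt hy.1, hy.2],
      ZMod.val_natCast_of_lt hy.1⟩

lemma card_residueSet (Q : ℕ) [NeZero Q] {m : ℕ} (hm : 0 < m) (A : Finset (Fin m)) :
    (residueSet Q hm A).card = ∑ a ∈ A, (Q / m + if a.val < Q % m then 1 else 0) := by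
  classical
  have hmaps : Set.MapsTo (fun x : ZMod Q => (⟨x.val % m, Nat.mod_lt _ hm⟩ : Fin m))
      (residueSet Q hm A) A := fun x hx => (Finset.mem_filter.1 hx).2
  rw [Finset.card_eq_sum_card_fiberwise hmaps]
  refine Finset.sum_congr rfl fun a ha => ?_
  have h1 : ((residueSet Q hm A).filter
      fun x => (⟨x.val % m, Nat.mod_lt _ hm⟩ : Fin m) = a) =
      Finset.univ.filter fun x : ZMod Q => x.val ≡ a.val [MOD m] := by
    ext x
    simp only [residueSet, Finset.mem_filter, Finset.mem_univ, true_and, Fin.ext_iff, Nat.ModEq,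
      Nat.mod_eq_of_lt a.isLt]
    refine ⟨fun h => h.2, fun h => ⟨?_, h⟩⟩
    have : (⟨x.val % m, Nat.mod_lt _ hm⟩ : Fin m) = a := Fin.ext h
    rwa [this]
  rw [h1, ZMod.card_filter_val (fun x => x ≡ a.val [MOD m]), ← Nat.count_eq_card_filter_range,
    Nat.count_modEq_card _ hm, Nat.mod_eq_of_lt a.isLt]

lemma card_residueSet_ge (Q : ℕ) [NeZero Q] {m : ℕ} (hm : 0 < m) (hQ : 4 * m ≤ Q)
    (A : Finset (Fin m)) :
    3 / 4 * (Q : ℝ) * (1 - rejectProb A) ≤ (residueSet Q hm A).card := by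
  have hmR : (0 : ℝ) < m := by exact_mod_cast hm
  have hQR : 4 * (m : ℝ) ≤ Q := by exact_mod_cast hQ
  have h1 : A.card * (Q / m) ≤ (residueSet Q hm A).card := by
    rw [card_residueSet, ← smul_eq_mul, ← Finset.sum_const]
    exact Finset.sum_le_sum fun a _ => Nat.le_add_right _ _
  have h2 : (Q : ℝ) ≤ m * ((Q / m : ℕ) : ℝ) + m := by
    have : Q ≤ m * (Q / m) + m := by
      have := Nat.div_add_mod Q m
      have := Nat.mod_lt Q hm
      omega
    exact_mod_cast this
  have h1R : (A.card : ℝ) * ((Q / m : ℕ) : ℝ) ≤ (residueSet Q hm A).card := by exact_mod_cast h1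
  refine le_trans ?_ h1R
  rw [rejectProb]
  have hA : (0 : ℝ) ≤ A.card := Nat.cast_nonneg _
  have e : 3 / 4 * (Q : ℝ) * (1 - (1 - (A.card : ℝ) / m)) = A.card * (3 / 4 * Q / m) := by
    field_simp
    ring
  rw [e]
  refine mul_le_mul_of_nonneg_left ?_ hA
  rw [div_le_iff₀ hmR]
  nlinarith

lemma card_residueSet_compl_le (Q : ℕ) [NeZero Q] {m : ℕ} (hm : 0 < m) (hQ : 4 * m ≤ Q)
    (A : Finset (Fin m)) :
    ((residueSet Q hm Aᶜ).card : ℝ) ≤ 5 / 4 * (Q : ℝ) * rejectProb A := by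
  have hmR : (0 : ℝ) < m := by exact_mod_cast hm
  have hQR : 4 * (m : ℝ) ≤ Q := by exact_mod_cast hQ
  have h1 : (residueSet Q hm Aᶜ).card ≤ (Aᶜ).card * (Q / m + 1) := by
    rw [card_residueSet, ← smul_eq_mul, ← Finset.sum_const]
    exact Finset.sum_le_sum fun a _ => by split_ifs <;> omega
  have h2 : ((Q / m : ℕ) : ℝ) ≤ (Q : ℝ) / m := Nat.cast_div_le
  have h1R : ((residueSet Q hm Aᶜ).card : ℝ) ≤ ((Aᶜ).card : ℝ) * (((Q / m : ℕ) : ℝ) + 1) := by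
    exact_mod_cast h1
  refine h1R.trans ?_
  have hc : ((Aᶜ).card : ℝ) = m * rejectProb A := by
    rw [Finset.card_compl, Fintype.card_fin, Nat.cast_sub (by simpa using Finset.card_le_univ A),
      rejectProb]
    field_simp
  have hr : 0 ≤ rejectProb A := by
    have : (0 : ℝ) ≤ (Aᶜ).card := Nat.cast_nonneg _
    rw [hc] at this
    exact nonneg_of_mul_nonneg_right this hmR
  rw [hc]
  have h3 : (m : ℝ) * (((Q / m : ℕ) : ℝ) + 1) ≤ 5 / 4 * Q := by
    have : (m : ℝ) * ((Q : ℝ) / m) = Q := by field_simp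
    nlinarith
  nlinarith

lemma rejectProb_nonneg {m : ℕ} (A : Finset (Fin m)) : 0 ≤ rejectProb A := by
  rw [rejectProb, sub_nonneg]
  apply div_le_one_of_le₀ _ (Nat.cast_nonneg _)
  exact_mod_cast (by simpa using Finset.card_le_univ A : A.card ≤ m)

lemma rejectProb_le_one {m : ℕ} (A : Finset (Fin m)) : rejectProb A ≤ 1 := by
  rw [rejectProb]
  have : 0 ≤ (A.card : ℝ) / m := by positivity
  linarith

lemma card_filter_line {Q : ℕ} [NeZero Q] (c : ZMod Q) (S : Finset (ZMod Q)) :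
    (Finset.univ.filter fun v : ZMod Q × ZMod Q => v.1 + c * v.2 ∈ S).card = S.card * Q := by
  classical
  have : (S ×ˢ (Finset.univ : Finset (ZMod Q))).card = S.card * Q := by
    rw [Finset.card_product, Finset.card_univ, ZMod.card]
  rw [← this]
  refine Finset.card_bij' (fun v _ => (v.1 + c * v.2, v.2)) (fun w _ => (w.1 - c * w.2, w.2))
    ?_ ?_ ?_ ?_
  · intro v hv
    simpa using hv
  · intro w hw
    simpa using hw
  · intro v _
    simp
  · intro w _
    simp

lemma card_filter_two_lines {Q : ℕ} [Fact Q.Prime] {c d : ZMod Q} (hcd : c ≠ d)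
    (S S' : Finset (ZMod Q)) :
    (Finset.univ.filter fun v : ZMod Q × ZMod Q =>
      v.1 + c * v.2 ∈ S ∧ v.1 + d * v.2 ∈ S').card = S.card * S'.card := by
  classical
  rw [← Finset.card_product]
  have h0 : c - d ≠ 0 := sub_ne_zero.2 hcd
  have h1 : d - c ≠ 0 := sub_ne_zero.2 hcd.symm
  refine Finset.card_bij' (fun v _ => (v.1 + c * v.2, v.1 + d * v.2))
    (fun w _ => (w.1 - c * ((w.1 - w.2) / (c - d)), (w.1 - w.2) / (c - d))) ?_ ?_ ?_ ?_
  · intro v hv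
    simpa using hv
  · intro w hw
    have e : w.1 - c * ((w.1 - w.2) / (c - d)) + d * ((w.1 - w.2) / (c - d)) = w.2 := by
      field_simp
      ring
    simp only [Finset.mem_filter, Finset.mem_univ, true_and, sub_add_cancel, e]
    exact Finset.mem_product.1 hw
  · intro v _
    ext <;> simp <;> field_simp <;> ring_nf
  · intro w _
    ext
    · simp
    · simp only
      field_simp
      ring

/-- If all coordinates of a bucket `I` but one have total rejecting probability at most `1/2`,
then a random point of the torus satisfies all constraints of the bucket with at least a quarter
of the probability that the exceptional coordinate accepts. -/
lemma quarter_le_torusDensity {Q m n : ℕ} [Fact Q.Prime] (hm : 0 < m) (hn : n ≤ Q)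
    (hQ : 4 * m ≤ Q) (A : Fin n → Finset (Fin m)) (I : Finset (Fin n)) (M : Fin n)
    (hI : ∑ i ∈ I.erase M, rejectProb (A i) ≤ 1 / 2) :
    (1 - rejectProb (A M)) / 4 ≤ torusDensity (Finset.univ.filter fun v : ZMod Q × ZMod Q =>
      ∀ i ∈ I, torusValue hm i v ∈ A i) := by
  classical
  have : NeZero Q := ⟨(Fact.out : Q.Prime).ne_zero⟩
  have hQpos : (0 : ℝ) < Q := by exact_mod_cast (Fact.out : Q.Prime).pos
  set B := Finset.univ.filter fun v : ZMod Q × ZMod Q => ∀ i ∈ I, torusValue hm i v ∈ A i with hB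
  set P := Finset.univ.filter fun v : ZMod Q × ZMod Q =>
    v.1 + (M.val : ZMod Q) * v.2 ∈ residueSet Q hm (A M) with hP
  let N : Fin n → Finset (ZMod Q × ZMod Q) := fun i => Finset.univ.filter fun v =>
    v.1 + (M.val : ZMod Q) * v.2 ∈ residueSet Q hm (A M) ∧
      v.1 + (i.val : ZMod Q) * v.2 ∈ residueSet Q hm (A i)ᶜ
  have hcover : P ⊆ B ∪ (I.erase M).biUnion N := by
    intro v hv
    rw [Finset.mem_union, or_iff_not_imp_right]
    intro hn
    rw [hB, Finset.mem_filter]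
    refine ⟨Finset.mem_univ _, fun i hi => ?_⟩
    have hvM := (Finset.mem_filter.1 hv).2
    by_cases hiM : i = M
    · rw [hiM]
      exact (Finset.mem_filter.1 hvM).2
    · by_contra hni
      apply hn
      rw [Finset.mem_biUnion]
      refine ⟨i, Finset.mem_erase.2 ⟨hiM, hi⟩, ?_⟩
      simp only [N, Finset.mem_filter, Finset.mem_univ, true_and]
      refine ⟨hvM, ?_⟩
      simp only [residueSet, Finset.mem_filter, Finset.mem_univ, true_and, Finset.mem_compl]
      exact hni
  have hcardN : ∀ i ∈ I.erase M, ((N i).card : ℝ) ≤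
      (residueSet Q hm (A M)).card * (5 / 4 * (Q : ℝ) * rejectProb (A i)) := by
    intro i hi
    have hne : (M.val : ZMod Q) ≠ (i.val : ZMod Q) := by
      intro h
      rw [ZMod.natCast_eq_natCast_iff', Nat.mod_eq_of_lt (M.isLt.trans_le hn),
        Nat.mod_eq_of_lt (i.isLt.trans_le hn)] at h
      exact (Finset.mem_erase.1 hi).1 (Fin.ext h).symm
    have : ((N i).card : ℝ) = (residueSet Q hm (A M)).card * (residueSet Q hm (A i)ᶜ).card := by
      exact_mod_cast card_filter_two_lines hne _ _
    rw [this]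
    exact mul_le_mul_of_nonneg_left (card_residueSet_compl_le Q hm hQ (A i)) (Nat.cast_nonneg _)
  have h1 : (P.card : ℝ) ≤ B.card + ∑ i ∈ I.erase M, ((N i).card : ℝ) := by
    have h := (Finset.card_le_card hcover).trans (Finset.card_union_le _ _)
    have h' := h.trans (Nat.add_le_add_left Finset.card_biUnion_le _)
    exact_mod_cast h'
  have h2 : (P.card : ℝ) = (residueSet Q hm (A M)).card * Q := by
    exact_mod_cast card_filter_line (M.val : ZMod Q) (residueSet Q hm (A M))
  have h3 := Finset.sum_le_sum hcardN
  rw [← Finset.mul_sum, ← Finset.mul_sum] at h3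
  have h4 := card_residueSet_ge Q hm hQ (A M)
  rw [torusDensity, le_div_iff₀ (by positivity)]
  set r : ℝ := ((residueSet Q hm (A M)).card : ℝ)
  have hr : 0 ≤ r := Nat.cast_nonneg _
  have h5 : r * (5 / 4 * (Q : ℝ) * ∑ i ∈ I.erase M, rejectProb (A i)) ≤ r * (5 / 8 * Q) := by
    refine mul_le_mul_of_nonneg_left ?_ hr
    nlinarith
  have h6 : 3 / 8 * (Q : ℝ) * (3 / 4 * (Q : ℝ) * (1 - rejectProb (A M))) ≤ 3 / 8 * (Q : ℝ) * r :=
    mul_le_mul_of_nonneg_left h4 (by positivity)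
  have h7 : 0 ≤ (1 - rejectProb (A M)) * (Q : ℝ) ^ 2 :=
    mul_nonneg (by linarith [rejectProb_le_one (A M)]) (by positivity)
  nlinarith

/-! ### Splitting coordinates into buckets of small weight -/

/-- Multiplicative hashing modulo a prime `q` into `[U]` is universal, up to a factor of `3`. -/
lemma card_hash_collisions_mul_le {q U x y : ℕ} (hq : q.Prime) (hU : 0 < U) (hUq : U ≤ q)
    (hx : x < q) (hy : y < q) (hxy : x ≠ y) :
    ((Finset.range q).filter fun a => a * x % q % U = a * y % q % U).card * U ≤ 3 * q := by
  have : Fact q.Prime := ⟨hq⟩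
  set k : ℕ := (q - 1) / U with hk
  have hcard : ((Finset.range q).filter fun a => a * x % q % U = a * y % q % U).card ≤
      (Finset.Icc (-(k : ℤ)) k).card := by
    -- The difference of the two residues is a multiple of `U` that determines `a`.
    refine Finset.card_le_card_of_injOn
      (fun a => (((a * x % q : ℕ) : ℤ) - ((a * y % q : ℕ) : ℤ)) / (U : ℤ)) ?_ ?_
    · intro a ha
      have hx' := Nat.mod_lt (a * x) hq.pos
      have hy' := Nat.mod_lt (a * y) hq.pos
      have hUpos : (0 : ℤ) < U := by exact_mod_cast hU
      have hkU : ((q - 1 : ℕ) : ℤ) < U * k + U := by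
        have := Nat.div_add_mod (q - 1) U
        have := Nat.mod_lt (q - 1) hU
        rw [hk]
        norm_cast
        omega
      have h1 := (Finset.mem_filter.1 ha).2
      have hq0 := hq.pos
      rw [Finset.coe_Icc, Set.mem_Icc]
      beta_reduce
      generalize a * x % q = X at hx' h1
      generalize a * y % q = Y at hy' h1
      have hXY : (X : ℤ) - Y ≤ ((q - 1 : ℕ) : ℤ) := by omega
      have hYX : (Y : ℤ) - X ≤ ((q - 1 : ℕ) : ℤ) := by omega
      constructor
      · rw [Int.le_ediv_iff_mul_le hUpos]
        obtain ⟨c, hc⟩ := (Nat.modEq_iff_dvd (n := U)).1 (h1 : _ ≡ _ [MOD U])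
        have : (c : ℤ) ≤ k := by
          by_contra hlt
          have : (k : ℤ) + 1 ≤ c := by omega
          nlinarith
        nlinarith
      · rw [← Int.lt_add_one_iff, Int.ediv_lt_iff_lt_mul hUpos]
        nlinarith
    · intro a ha b hb hab
      have hdvd : ∀ c ∈ (Finset.range q).filter fun a => a * x % q % U = a * y % q % U,
          (U : ℤ) ∣ ((c * x % q : ℕ) : ℤ) - ((c * y % q : ℕ) : ℤ) := by
        intro c hc
        exact (Nat.modEq_iff_dvd (n := U)).1 ((Finset.mem_filter.1 hc).2.symm : _ ≡ _ [MOD U])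
      have he := (Int.ediv_left_inj (hdvd a ha) (hdvd b hb)).1 hab
      have he' : ((a : ZMod q) - b) * ((x : ZMod q) - y) = 0 := by
        have h2 := congrArg (Int.cast : ℤ → ZMod q) he
        rw [Int.cast_sub, Int.cast_sub, Int.cast_natCast, Int.cast_natCast, Int.cast_natCast,
          Int.cast_natCast, ZMod.natCast_mod, ZMod.natCast_mod, ZMod.natCast_mod,
          ZMod.natCast_mod] at h2
        push_cast at h2
        linear_combination h2
      rcases mul_eq_zero.1 he' with h | h
      · rw [sub_eq_zero, ZMod.natCast_eq_natCast_iff'] at h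
        rwa [Nat.mod_eq_of_lt (Finset.mem_range.1 (Finset.mem_filter.1 ha).1),
          Nat.mod_eq_of_lt (Finset.mem_range.1 (Finset.mem_filter.1 hb).1)] at h
      · rw [sub_eq_zero, ZMod.natCast_eq_natCast_iff', Nat.mod_eq_of_lt hx, Nat.mod_eq_of_lt hy] at h
        exact absurd h hxy
  rw [Int.card_Icc] at hcard
  have h1 : k * U ≤ q - 1 := Nat.div_mul_le_self _ _
  calc _ ≤ (2 * k + 1) * U := Nat.mul_le_mul_right _ (by omega)
    _ = 2 * (k * U) + U := by ring
    _ ≤ 3 * q := by omega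

/-- The weight of the ordered pairs of distinct elements of `J` that have the same image
under `h`. -/
noncomputable def collisionWeight {ι : Type*} [DecidableEq ι] (w : ι → ℝ) (h : ι → ℕ)
    (J : Finset ι) : ℝ :=
  ∑ i ∈ J, ∑ j ∈ J, if i ≠ j ∧ h i = h j then w i * w j else 0

lemma collisionWeight_nonneg {ι : Type*} [DecidableEq ι] (w : ι → ℝ) (hw : ∀ i, 0 ≤ w i)
    (h : ι → ℕ) (J : Finset ι) : 0 ≤ collisionWeight w h J :=
  Finset.sum_nonneg fun i _ => Finset.sum_nonneg fun j _ => by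
    split_ifs
    · exact mul_nonneg (hw i) (hw j)
    · exact le_rfl

lemma collisionWeight_mono {ι : Type*} [DecidableEq ι] (w : ι → ℝ) (hw : ∀ i, 0 ≤ w i)
    (h : ι → ℕ) {J J' : Finset ι} (hJ : J ⊆ J') :
    collisionWeight w h J ≤ collisionWeight w h J' := by
  have hpos : ∀ i j, 0 ≤ if i ≠ j ∧ h i = h j then w i * w j else 0 := fun i j => by
    split_ifs
    · exact mul_nonneg (hw i) (hw j)
    · exact le_rfl
  refine (Finset.sum_le_sum fun i _ => Finset.sum_le_sum_of_subset_of_nonneg hJ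
    fun j _ _ => hpos i j).trans ?_
  exact Finset.sum_le_sum_of_subset_of_nonneg hJ fun i _ _ => Finset.sum_nonneg fun j _ => hpos i j

/-- The average collision weight of a family of functions that is universal on the pairs that `g`
separates. -/
lemma sum_collisionWeight_le {ι : Type*} [DecidableEq ι] (w : ι → ℝ) (hw : ∀ i, 0 ≤ w i)
    (q : ℕ) (U D : ℝ) (hU : 0 < U) (h : ℕ → ι → ℕ) (g : ι → ℕ) (J : Finset ι)
    (hcol : ∀ i ∈ J, ∀ j ∈ J, g i ≠ g j →
      (((Finset.range q).filter fun a => h a i = h a j).card : ℝ) * U ≤ 3 * q)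
    (hJ : ∑ i ∈ J, w i ≤ D) :
    ∑ a ∈ Finset.range q, collisionWeight w (h a) J ≤
      q * (collisionWeight w g J + 3 * D ^ 2 / U) := by
  have hpt : ∀ i ∈ J, ∀ j ∈ J,
      (∑ a ∈ Finset.range q, if i ≠ j ∧ h a i = h a j then w i * w j else 0) ≤
      q * ((if i ≠ j ∧ g i = g j then w i * w j else 0) + 3 / U * (w i * w j)) := by
    intro i hi j hj
    have hww : 0 ≤ w i * w j := mul_nonneg (hw i) (hw j)
    by_cases hij : i = j
    · simp only [hij, ne_eq, not_true_eq_false, false_and, if_false, Finset.sum_const_zero]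
      have := mul_nonneg (hw j) (hw j)
      positivity
    · have e1 : (∑ a ∈ Finset.range q, if i ≠ j ∧ h a i = h a j then w i * w j else 0) =
          ((Finset.range q).filter fun a => h a i = h a j).card * (w i * w j) := by
        simp only [ne_eq, hij, not_false_eq_true, true_and]
        rw [← Finset.sum_filter, Finset.sum_const, nsmul_eq_mul]
      rw [e1]
      by_cases hg : g i = g j
      · rw [if_pos ⟨hij, hg⟩]
        have hc : (((Finset.range q).filter fun a => h a i = h a j).card : ℝ) ≤ q := by
          exact_mod_cast (Finset.card_filter_le _ _).trans (Finset.card_range q).le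
        have h3 : 0 ≤ (q : ℝ) * (3 / U * (w i * w j)) := by positivity
        nlinarith
      · rw [if_neg fun hc => hg hc.2, zero_add, ← mul_assoc (q : ℝ)]
        refine mul_le_mul_of_nonneg_right ?_ hww
        rw [← mul_div_assoc, le_div_iff₀ hU, mul_comm (q : ℝ) 3]
        exact hcol i hi j hj hg
  have hJ0 : 0 ≤ ∑ i ∈ J, w i := Finset.sum_nonneg fun i _ => hw i
  calc ∑ a ∈ Finset.range q, collisionWeight w (h a) J
      = ∑ i ∈ J, ∑ j ∈ J, ∑ a ∈ Finset.range q,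
          (if i ≠ j ∧ h a i = h a j then w i * w j else 0) := by
        simp only [collisionWeight]
        rw [Finset.sum_comm]
        exact Finset.sum_congr rfl fun i _ => Finset.sum_comm
    _ ≤ ∑ i ∈ J, ∑ j ∈ J,
          q * ((if i ≠ j ∧ g i = g j then w i * w j else 0) + 3 / U * (w i * w j)) :=
        Finset.sum_le_sum fun i hi => Finset.sum_le_sum fun j hj => hpt i hi j hj
    _ = q * (collisionWeight w g J + 3 / U * (∑ i ∈ J, w i) ^ 2) := by
        rw [sq, Finset.sum_mul_sum]
        simp only [collisionWeight, Finset.mul_sum, ← Finset.sum_add_distrib]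
    _ ≤ q * (collisionWeight w g J + 3 * D ^ 2 / U) := by
        refine mul_le_mul_of_nonneg_left ?_ (Nat.cast_nonneg _)
        have h1 : (∑ i ∈ J, w i) ^ 2 ≤ D ^ 2 := pow_le_pow_left₀ hJ0 hJ 2
        have h2 : 3 / U * (∑ i ∈ J, w i) ^ 2 ≤ 3 / U * D ^ 2 :=
          mul_le_mul_of_nonneg_left h1 (by positivity)
        have h3 : 3 / U * D ^ 2 = 3 * D ^ 2 / U := by ring
        linarith

/-- Markov's inequality: at least half of the values are at most twice the average. -/
lemma le_two_mul_card_filter_le (q : ℕ) (f : ℕ → ℝ) (hf : ∀ a, 0 ≤ f a) (c : ℝ) (hc : 0 < c)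
    (hsum : ∑ a ∈ Finset.range q, f a ≤ q * c) :
    q ≤ 2 * ((Finset.range q).filter fun a => f a ≤ 2 * c).card := by
  have h1 : (((Finset.range q).filter fun a => ¬ f a ≤ 2 * c).card : ℝ) * (2 * c) ≤ q * c := by
    refine le_trans ?_ hsum
    rw [← nsmul_eq_mul]
    refine (Finset.card_nsmul_le_sum _ f _ fun a ha => ?_).trans
      (Finset.sum_le_sum_of_subset_of_nonneg (Finset.filter_subset _ _) fun a _ _ => hf a)
    exact (not_le.1 (Finset.mem_filter.1 ha).2).le
  have h2 := Finset.card_filter_add_card_filter_not (s := Finset.range q) (fun a => f a ≤ 2 * c)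
  rw [Finset.card_range] at h2
  have h3 : 2 * (((Finset.range q).filter fun a => ¬ f a ≤ 2 * c).card : ℝ) ≤ q := by
    nlinarith
  have h4 : 2 * ((Finset.range q).filter fun a => ¬ f a ≤ 2 * c).card ≤ q := by exact_mod_cast h3
  omega

/-- The bucket of a hashed coordinate `x`. With `i + 1` levels left, the next digit of `W` in base
`q` hashes `x` to one of the buckets `48 * 2 ^ i, …, 96 * 2 ^ i - 1`; if that bucket is marked by
`F` as too heavy, then the bucket is found with the remaining `i` levels. What is left over in the
end goes to bucket `0`. -/
def bucketOf (q : ℕ) (F : ℕ → Bool) : ℕ → ℕ → ℕ → ℕ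
  | 0, _, _ => 0
  | i + 1, W, x =>
    if F (48 * 2 ^ i + W % q * x % q % (48 * 2 ^ i)) then bucketOf q F i (W / q) x
    else 48 * 2 ^ i + W % q * x % q % (48 * 2 ^ i)

lemma bucketOf_lt (q : ℕ) (F : ℕ → Bool) (i W x : ℕ) : bucketOf q F i W x < 48 * 2 ^ i := by
  induction i generalizing W with
  | zero => simp [bucketOf]
  | succ i ih =>
    have h := Nat.mod_lt (W % q * x % q) (show 0 < 48 * 2 ^ i by positivity)
    have h2 := ih (W / q)
    rw [bucketOf]
    split_ifs <;> rw [pow_succ] <;> omega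

lemma bucketOf_congr (q : ℕ) {F F' : ℕ → Bool} (i W x : ℕ)
    (h : ∀ b < 48 * 2 ^ i, F b = F' b) : bucketOf q F i W x = bucketOf q F' i W x := by
  induction i generalizing W with
  | zero => rfl
  | succ i ih =>
    have h1 := Nat.mod_lt (W % q * x % q) (show 0 < 48 * 2 ^ i by positivity)
    rw [bucketOf, bucketOf, h _ (by rw [pow_succ]; omega),
      ih _ fun b hb => h b (by rw [pow_succ]; omega)]

/-- A set of coordinates is light if its weight without one of its elements is at most `1/2`. -/
def IsLight {ι : Type*} [DecidableEq ι] (w : ι → ℝ) (I : Finset ι) : Prop :=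
  I = ∅ ∨ ∃ M ∈ I, ∑ i ∈ I.erase M, w i ≤ 1 / 2

/-- The coordinates in buckets that are not light have a small weight, because each of them
collides with a weight of more than `1/2`. -/
lemma sum_not_isLight_le {ι : Type*} [DecidableEq ι] (w : ι → ℝ) (hw : ∀ i, 0 ≤ w i) (h : ι → ℕ)
    (J J' : Finset ι) (hJ' : J' ⊆ J)
    (hbad : ∀ j ∈ J', ¬ IsLight w (J.filter fun k => h k = h j)) :
    ∑ j ∈ J', w j ≤ 2 * collisionWeight w h J := by
  have h1 : ∀ j ∈ J', w j ≤ 2 * ∑ k ∈ J, if j ≠ k ∧ h j = h k then w j * w k else 0 := by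
    intro j hj
    have hb := hbad j hj
    simp only [IsLight, not_or, not_exists, not_and, not_le] at hb
    have h2 := hb.2 j (Finset.mem_filter.2 ⟨hJ' hj, rfl⟩)
    have h3 : (∑ k ∈ J, if j ≠ k ∧ h j = h k then w j * w k else 0) =
        w j * ∑ i ∈ (J.filter fun k => h k = h j).erase j, w i := by
      rw [Finset.mul_sum, ← Finset.sum_filter]
      refine Finset.sum_congr ?_ fun _ _ => rfl
      ext k
      simp only [Finset.mem_filter, Finset.mem_erase]
      tauto
    rw [h3]
    nlinarith [hw j]
  refine (Finset.sum_le_sum h1).trans ?_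
  rw [← Finset.mul_sum, collisionWeight]
  refine mul_le_mul_of_nonneg_left ?_ (by norm_num)
  refine Finset.sum_le_sum_of_subset_of_nonneg hJ' fun i _ _ => Finset.sum_nonneg fun j _ => ?_
  split_ifs
  · exact mul_nonneg (hw i) (hw j)
  · exact le_rfl

open Classical in
/-- Each level of hashing halves the weight of the coordinates that are not yet in a light bucket,
for at least half of the choices of its digit of `W`. -/
lemma pow_le_card_bucketOf_isLight {ι : Type*} [DecidableEq ι] (w : ι → ℝ) (hw : ∀ i, 0 ≤ w i) (q : ℕ)
    (hq : q.Prime) (x : ι → ℕ) (hx : ∀ j, x j < q) (i : ℕ) (hiq : 48 * 2 ^ i ≤ 2 * q) (J : Finset ι)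
    (hcol : collisionWeight w x J ≤ 1 / 16) (hJ : ∑ j ∈ J, w j ≤ 2 ^ i / 2) :
    q ^ i ≤ 2 ^ i * ((Finset.range (q ^ i)).filter fun W => ∃ F : ℕ → Bool,
      ∀ b, IsLight w (J.filter fun j => bucketOf q F i W (x j) = b)).card := by
  induction i generalizing J with
  | zero =>
    have : ((Finset.range (q ^ 0)).filter fun W => ∃ F : ℕ → Bool,
        ∀ b, IsLight w (J.filter fun j => bucketOf q F 0 W (x j) = b)) = Finset.range (q ^ 0) := by
      refine Finset.filter_true_of_mem fun W _ => ⟨fun _ => true, fun b => ?_⟩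
      by_cases he : (J.filter fun j => bucketOf q (fun _ => true) 0 W (x j) = b) = ∅
      · exact Or.inl he
      · obtain ⟨M, hM⟩ := Finset.nonempty_iff_ne_empty.2 he
        refine Or.inr ⟨M, hM, ?_⟩
        refine (Finset.sum_le_sum_of_subset_of_nonneg
          ((Finset.erase_subset _ _).trans (Finset.filter_subset _ _)) fun j _ _ => hw j).trans ?_
        simpa using hJ
    rw [this]
    simp
  | succ i ih =>
    set D : ℕ := 2 ^ i with hD
    have hD1 : (1 : ℝ) ≤ D := by exact_mod_cast Nat.one_le_two_pow
    have hDq : 48 * D ≤ q := by rw [pow_succ] at hiq; omega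
    let h : ℕ → ι → ℕ := fun a j => a * x j % q % (48 * D)
    have hJD : ∑ j ∈ J, w j ≤ D := by
      rw [pow_succ] at hJ
      rw [hD]
      push_cast
      linarith
    -- most digits `a` give a small collision weight
    have hhalf : q ≤ 2 * ((Finset.range q).filter fun a =>
        collisionWeight w (h a) J ≤ 2 * (1 / 16 + D / 16)).card := by
      refine le_two_mul_card_filter_le q _ (fun a => collisionWeight_nonneg w hw _ _) _
        (by positivity) ?_
      refine (sum_collisionWeight_le w hw q (48 * D) D (by positivity) h x J ?_ hJD).trans ?_
      · intro j _ k _ hjk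
        have := card_hash_collisions_mul_le hq (show 0 < 48 * D by positivity) hDq (hx j) (hx k) hjk
        exact_mod_cast this
      · refine mul_le_mul_of_nonneg_left ?_ (Nat.cast_nonneg _)
        have : 3 * (D : ℝ) ^ 2 / (48 * D) = D / 16 := by
          field_simp
          norm_num
        linarith
    set P : ℕ → Prop := fun W => ∃ F : ℕ → Bool,
      ∀ b, IsLight w (J.filter fun j => bucketOf q F (i + 1) W (x j) = b) with hP
    have hcard : ((Finset.range (q ^ (i + 1))).filter P).card =
        ∑ a ∈ Finset.range q, ((Finset.range (q ^ i)).filter fun W' => P (a + q * W')).card := by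
      simp only [Finset.card_filter]
      rw [pow_succ', ← Finset.sum_range_mul_eq q (q ^ i) fun a W' => if P (a + q * W') then 1 else 0]
      refine Finset.sum_congr rfl fun W _ => ?_
      simp only [Nat.mod_add_div]
    have hstep : ∀ a ∈ (Finset.range q).filter fun a =>
        collisionWeight w (h a) J ≤ 2 * (1 / 16 + D / 16),
        q ^ i ≤ 2 ^ i * ((Finset.range (q ^ i)).filter fun W' => P (a + q * W')).card := by
      intro a ha
      obtain ⟨haq, hac⟩ := Finset.mem_filter.1 ha
      rw [Finset.mem_range] at haq
      let bad : ℕ → Prop := fun b => ¬ IsLight w (J.filter fun j => 48 * D + h a j = b)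
      set J' := J.filter fun j => bad (48 * D + h a j) with hJ'
      have hJJ : J' ⊆ J := Finset.filter_subset _ _
      have hw' : ∑ j ∈ J', w j ≤ 2 ^ i / 2 := by
        have := sum_not_isLight_le w hw (h a) J J' hJJ (by
          intro j hj
          have := (Finset.mem_filter.1 hj).2
          simpa [bad] using this)
        refine this.trans ?_
        have : (2 : ℝ) ^ i = D := by rw [hD]; push_cast; rfl
        rw [this]
        linarith
      refine (ih (by rw [pow_succ] at hiq; omega) J'
        ((collisionWeight_mono w hw x hJJ).trans hcol) hw').trans ?_
      refine Nat.mul_le_mul_left _ (Finset.card_le_card fun W' hW' => ?_)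
      obtain ⟨hW1, F', hF'⟩ := Finset.mem_filter.1 hW'
      refine Finset.mem_filter.2 ⟨hW1, ?_⟩
      set F : ℕ → Bool := fun b => if 48 * D ≤ b then decide (bad b) else F' b with hF
      refine ⟨F, fun b => ?_⟩
      have hmod : (a + q * W') % q = a := by
        rw [Nat.add_mul_mod_self_left, Nat.mod_eq_of_lt haq]
      have hdiv : (a + q * W') / q = W' := by
        rw [Nat.add_mul_div_left _ _ hq.pos, Nat.div_eq_of_lt haq, zero_add]
      have hbo : ∀ j, bucketOf q F (i + 1) (a + q * W') (x j) =
          if bad (48 * D + h a j) then bucketOf q F' i W' (x j) else 48 * D + h a j := by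
        intro j
        have e1 : F (48 * D + h a j) = decide (bad (48 * D + h a j)) := by
          rw [hF]
          simp only [if_pos (Nat.le_add_right (48 * D) (h a j))]
        have e2 : bucketOf q F i W' (x j) = bucketOf q F' i W' (x j) := by
          refine bucketOf_congr q i W' (x j) fun b hb => ?_
          exact if_neg (not_le.2 hb)
        rw [bucketOf, hmod, hdiv]
        change (if F (48 * D + h a j) = true then bucketOf q F i W' (x j) else 48 * D + h a j) = _
        rw [e1, e2]
        simp only [decide_eq_true_eq]
      simp_rw [hbo]
      by_cases hb : 48 * D ≤ b
      · by_cases hbb : bad b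
        · left
          rw [Finset.filter_eq_empty_iff]
          intro j _ he
          split_ifs at he with hc
          · have := bucketOf_lt q F' i W' (x j)
            omega
          · rw [he] at hc
            exact hc hbb
        · have : (J.filter fun j => (if bad (48 * D + h a j) then bucketOf q F' i W' (x j)
              else 48 * D + h a j) = b) = J.filter fun j => 48 * D + h a j = b := by
            refine Finset.filter_congr fun j _ => ?_
            constructor
            · intro he
              split_ifs at he with hc
              · have := bucketOf_lt q F' i W' (x j)
                omega
              · exact he
            · intro he
              rw [if_neg (by rwa [he]), he]
          rw [this]
          exact not_not.1 hbb
      · have : (J.filter fun j => (if bad (48 * D + h a j) then bucketOf q F' i W' (x j)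
            else 48 * D + h a j) = b) = J'.filter fun j => bucketOf q F' i W' (x j) = b := by
          rw [hJ', Finset.filter_filter]
          refine Finset.filter_congr fun j _ => ?_
          constructor
          · intro he
            split_ifs at he with hc
            · exact ⟨hc, he⟩
            · omega
          · rintro ⟨hc, he⟩
            rw [if_pos hc, he]
        rw [this]
        exact hF' b
    have hsum := Finset.sum_le_sum_of_subset (f := fun a =>
      ((Finset.range (q ^ i)).filter fun W' => P (a + q * W')).card)
      (Finset.filter_subset (fun a => collisionWeight w (h a) J ≤ 2 * (1 / 16 + D / 16))
        (Finset.range q))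
    have h5 := Finset.card_nsmul_le_sum _ (fun a =>
      2 ^ i * ((Finset.range (q ^ i)).filter fun W' => P (a + q * W')).card) _ hstep
    rw [smul_eq_mul, ← Finset.mul_sum] at h5
    rw [hcard]
    calc q ^ (i + 1) = q * q ^ i := pow_succ' _ _
      _ ≤ 2 * ((Finset.range q).filter fun a =>
        collisionWeight w (h a) J ≤ 2 * (1 / 16 + D / 16)).card * q ^ i :=
          Nat.mul_le_mul_right _ hhalf
      _ = 2 * (((Finset.range q).filter fun a =>
        collisionWeight w (h a) J ≤ 2 * (1 / 16 + D / 16)).card * q ^ i) := by ring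
      _ ≤ 2 * (2 ^ i * ∑ a ∈ Finset.range q,
          ((Finset.range (q ^ i)).filter fun W' => P (a + q * W')).card) :=
          Nat.mul_le_mul_left _ (h5.trans (Nat.mul_le_mul_left _ hsum))
      _ = _ := by rw [pow_succ]; ring

/-! ### Schedules -/

/-- The number of binary digits of `Z` that have to be read until `c` ones have been seen; at most
`H` digits are read. -/
def onePos : ℕ → ℕ → ℕ → ℕ
  | 0, _, _ => 0
  | H + 1, Z, c => (if 0 < c then 1 else 0) + onePos H (Z / 2) (c - Z % 2)

lemma onePos_zero (H Z : ℕ) : onePos H Z 0 = 0 := by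
  induction H generalizing Z with
  | zero => rfl
  | succ H ih => simp [onePos, ih]

lemma onePos_le (H Z c : ℕ) : onePos H Z c ≤ H := by
  induction H generalizing Z c with
  | zero => exact le_rfl
  | succ H ih =>
    rw [onePos]
    have := ih (Z / 2) (c - Z % 2)
    split_ifs <;> omega

lemma onePos_two_pow_mul (g H Z c : ℕ) :
    onePos (g + 1 + H) (2 ^ g * (1 + 2 * Z)) (c + 1) = g + 1 + onePos H Z c := by
  induction g with
  | zero =>
    have h1 : (1 + 2 * Z) % 2 = 1 := by omega
    have h2 : (1 + 2 * Z) / 2 = Z := by omega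
    rw [pow_zero, one_mul, show 0 + 1 + H = H + 1 by ring, onePos, h1, h2]
    simp
  | succ g ih =>
    have h1 : 2 ^ (g + 1) * (1 + 2 * Z) % 2 = 0 := by rw [pow_succ', mul_assoc]; simp
    have h2 : 2 ^ (g + 1) * (1 + 2 * Z) / 2 = 2 ^ g * (1 + 2 * Z) := by
      rw [pow_succ', mul_assoc]
      simp
    rw [show g + 1 + 1 + H = (g + 1 + H) + 1 by ring, onePos, h1, h2, Nat.sub_zero, ih]
    simp
    ring

/-- Every sequence of positive gaps of total length at most `H` is the sequence of the distances
between the ones of some number with `H` binary digits. -/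
lemma exists_onePos_eq_sum (T : ℕ) (j : ℕ → ℕ) (hj : ∀ b, 0 < j b) (H : ℕ)
    (hH : ∑ b ∈ Finset.range T, j b ≤ H) :
    ∃ Z < 2 ^ H, ∀ b < T, onePos H Z (b + 1) = ∑ i ∈ Finset.range (b + 1), j i := by
  induction T generalizing j H with
  | zero => exact ⟨0, by positivity, by simp⟩
  | succ T ih =>
    rw [Finset.sum_range_succ'] at hH
    obtain ⟨g, hg⟩ := Nat.exists_eq_succ_of_ne_zero (hj 0).ne'
    obtain ⟨H', rfl⟩ : ∃ H', H = g + 1 + H' := Nat.exists_eq_add_of_le (by omega)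
    obtain ⟨Z, hZ, h⟩ := ih (fun b => j (b + 1)) (fun b => hj _) H' (by omega)
    refine ⟨2 ^ g * (1 + 2 * Z), ?_, ?_⟩
    · calc 2 ^ g * (1 + 2 * Z) < 2 ^ g * (2 * 2 ^ H') :=
            Nat.mul_lt_mul_of_pos_left (by omega) (by positivity)
        _ = 2 ^ (g + 1 + H') := by ring
    · intro b hb
      rw [onePos_two_pow_mul]
      cases b with
      | zero => simp [onePos_zero, hg]
      | succ b =>
        rw [h b (by omega), Finset.sum_range_succ' _ (b + 1), hg, Nat.succ_eq_add_one]
        ring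

/-- Numbers of half-steps that suffice to make the walk forget about sets of the densities `β b`.
Their sum is controlled by the product of the densities. -/
lemma exists_gaps (T R L C κ : ℕ) (hR : 0 < R) (hRT : R ≤ T)
    (hκ : (9999 / 10000 : ℝ) ^ κ ≤ 1 / 2) (β : ℕ → ℝ) (hpos : ∀ b < T, 0 < β b)
    (hle : ∀ b < T, β b ≤ 1)
    (hprod : (1 / 4 : ℝ) ^ T * (1 / 2) ^ (C * L) ≤ ∏ b ∈ Finset.range T, β b) :
    ∃ k : ℕ → ℕ, (∀ b, 0 < k b) ∧ ∑ b ∈ Finset.range T, k b ≤ (6 + C) * T ∧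
      ∀ b < T, (9999 / 10000 : ℝ) ^ (κ * (1 + L / R) * k b) ≤ β b / 8 := by
  set s : ℕ := 1 + L / R with hs
  have hsR : (0 : ℝ) < s := by rw [hs]; positivity
  have hs1 : (1 : ℝ) ≤ s := by rw [hs]; push_cast; linarith [Nat.cast_nonneg (α := ℝ) (L / R)]
  have hLs : (L : ℝ) ≤ R * s := by
    have : L ≤ R * s := by
      rw [hs, mul_add]
      have := Nat.div_add_mod L R
      have := Nat.mod_lt L hR
      omega
    exact_mod_cast this
  let x : ℕ → ℝ := fun b => -Real.logb 2 (β b)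
  have hx : ∀ b < T, 0 ≤ x b := fun b hb =>
    neg_nonneg.2 (Real.logb_nonpos one_lt_two (hpos b hb).le (hle b hb))
  have hxβ : ∀ b < T, (1 / 2 : ℝ) ^ (x b) = β b := by
    intro b hb
    rw [one_div, Real.inv_rpow zero_le_two, ← Real.rpow_neg zero_le_two, neg_neg,
      Real.rpow_logb two_pos (by norm_num) (hpos b hb)]
  have hsum : ∑ b ∈ Finset.range T, x b ≤ 2 * T + C * L := by
    have h1 : ∑ b ∈ Finset.range T, x b = -Real.logb 2 (∏ b ∈ Finset.range T, β b) := by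
      rw [Real.logb_prod _ _ fun b hb => (hpos b (Finset.mem_range.1 hb)).ne',
        ← Finset.sum_neg_distrib]
    have h2 : Real.logb 2 ((1 / 4 : ℝ) ^ T * (1 / 2) ^ (C * L)) = -(2 * T + C * L) := by
      have : (1 / 4 : ℝ) ^ T * (1 / 2) ^ (C * L) = (2 : ℝ) ^ (-(2 * T + C * L : ℝ)) := by
        rw [Real.rpow_neg zero_le_two, Real.rpow_add two_pos, Real.rpow_mul zero_le_two,
          Real.rpow_natCast, ← Nat.cast_mul, Real.rpow_natCast]
        rw [one_div, one_div, inv_pow, inv_pow, mul_inv]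
        norm_num
      rw [this, Real.logb_rpow two_pos (by norm_num)]
    have h3 := Real.logb_le_logb_of_le one_lt_two (by positivity) hprod
    rw [h1]
    linarith
  refine ⟨fun b => ⌊(3 + x b) / s⌋₊ + 1, fun b => Nat.succ_pos _, ?_, ?_⟩
  · have h1 : ∀ b ∈ Finset.range T, ((⌊(3 + x b) / s⌋₊ + 1 : ℕ) : ℝ) ≤ 4 + x b / s := by
      intro b hb
      have hxb := hx b (Finset.mem_range.1 hb)
      have h2 : (⌊(3 + x b) / s⌋₊ : ℝ) ≤ (3 + x b) / s := Nat.floor_le (by positivity)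
      have h3 : (3 : ℝ) / s ≤ 3 := div_le_self (by norm_num) hs1
      have h4 := add_div 3 (x b) (s : ℝ)
      push_cast
      linarith
    have h2 := Finset.sum_le_sum h1
    rw [Finset.sum_add_distrib, ← Finset.sum_div, Finset.sum_const, Finset.card_range,
      nsmul_eq_mul] at h2
    have h3 : (∑ b ∈ Finset.range T, x b) / s ≤ 2 * T + C * T := by
      rw [div_le_iff₀ hsR]
      refine hsum.trans ?_
      have hT : (0 : ℝ) ≤ T := Nat.cast_nonneg _
      have hC : (0 : ℝ) ≤ C := Nat.cast_nonneg _
      have hRT' : (R : ℝ) ≤ T := by exact_mod_cast hRT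
      have h4 : (L : ℝ) ≤ T * s := hLs.trans (mul_le_mul_of_nonneg_right hRT' hsR.le)
      have h5 : (C : ℝ) * L ≤ C * (T * s) := mul_le_mul_of_nonneg_left h4 hC
      nlinarith
    have h4 : ((∑ b ∈ Finset.range T, (⌊(3 + x b) / s⌋₊ + 1) : ℕ) : ℝ) ≤ (((6 + C) * T : ℕ) : ℝ) := by
      push_cast at h2 ⊢
      linarith
    exact_mod_cast h4
  · intro b hb
    have h1 : 3 + x b ≤ s * (⌊(3 + x b) / s⌋₊ + 1 : ℕ) := by
      have := (Nat.lt_floor_add_one ((3 + x b) / s)).le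
      rw [div_le_iff₀ hsR] at this
      push_cast
      linarith
    set k := ⌊(3 + x b) / s⌋₊ + 1
    calc (9999 / 10000 : ℝ) ^ (κ * s * k) = ((9999 / 10000 : ℝ) ^ κ) ^ (s * k) := by
          rw [← pow_mul, mul_assoc]
      _ ≤ (1 / 2) ^ (s * k) := pow_le_pow_left₀ (by positivity) hκ _
      _ = (1 / 2 : ℝ) ^ ((s * k : ℕ) : ℝ) := (Real.rpow_natCast _ _).symm
      _ ≤ (1 / 2 : ℝ) ^ (3 + x b) := by
          apply Real.rpow_le_rpow_of_exponent_ge (by norm_num) (by norm_num)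
          push_cast at h1 ⊢
          exact h1
      _ = β b / 8 := by
          rw [Real.rpow_add (by norm_num), hxβ b hb]
          norm_num
          ring

/-! ### The fraction of good seeds -/

lemma uniformProb_combRect {m n : ℕ} (hm : 0 < m) (A : Fin n → Finset (Fin m)) :
    uniformProb (combRect A) = ∏ i, (1 - rejectProb (A i)) := by
  have h1 : (Finset.univ.filter fun x => combRect A x = true) = Fintype.piFinset A := by
    ext x
    simp [combRect]
  have hmR : (m : ℝ) ≠ 0 := by exact_mod_cast hm.ne'
  rw [uniformProb, h1, Fintype.card_piFinset]
  simp only [rejectProb, sub_sub_cancel]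
  rw [Finset.prod_div_distrib]
  simp

open Classical in
/-- If the buckets are light, some schedule makes a walk from a random starting point accept with
almost the right probability. -/
lemma exists_schedule {Q m n : ℕ} [Fact Q.Prime] (hm : 0 < m) (hn : n ≤ Q) (hQ : 4 * m ≤ Q)
    (A : Fin n → Finset (Fin m)) (T R L C κ : ℕ) (hR : 0 < R) (hRT : R ≤ T)
    (hκ : (9999 / 10000 : ℝ) ^ κ ≤ 1 / 2) (bucket : Fin n → ℕ) (hb : ∀ i, bucket i < T)
    (hlight : ∀ b, IsLight (fun i => rejectProb (A i))
      (Finset.univ.filter fun i => bucket i = b))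
    (hA : (1 / 2 : ℝ) ^ (C * L) ≤ ∏ i, (1 - rejectProb (A i))) :
    ∃ Z < 2 ^ (2 * ((6 + C) * T)),
      (Q : ℝ) ^ 2 * 5 ^ (κ * (1 + L / R) * (2 * ((6 + C) * T))) *
        ((3 / 16) ^ T * ∏ i, (1 - rejectProb (A i))) ≤
      ∑ v : ZMod Q × ZMod Q,
        ∑ G ∈ Finset.range (5 ^ (κ * (1 + L / R) * (2 * ((6 + C) * T)))),
          if ∀ i, torusValue hm i (torusPos G
            (κ * (1 + L / R) * onePos (2 * ((6 + C) * T)) Z (bucket i + 1)) v) ∈ A i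
          then (1 : ℝ) else 0 := by
  have : NeZero Q := ⟨(Fact.out : Q.Prime).ne_zero⟩
  have hQpos : (0 : ℝ) < Q := by exact_mod_cast (Fact.out : Q.Prime).pos
  set H := 2 * ((6 + C) * T) with hH
  set u := κ * (1 + L / R) with hu
  let B : ℕ → Finset (ZMod Q × ZMod Q) := fun b => Finset.univ.filter fun v =>
    ∀ i ∈ Finset.univ.filter (fun i => bucket i = b), torusValue hm i v ∈ A i
  have hnn : ∀ i, 0 ≤ 1 - rejectProb (A i) := fun i => by linarith [rejectProb_le_one (A i)]
  have hpA : 0 < ∏ i, (1 - rejectProb (A i)) := lt_of_lt_of_le (by positivity) hA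
  have hpi : ∀ i, 0 < 1 - rejectProb (A i) := fun i =>
    lt_of_le_of_ne (hnn i) fun h => hpA.ne' (Finset.prod_eq_zero (Finset.mem_univ i) h.symm)
  have hVcard : ((Finset.univ : Finset (ZMod Q × ZMod Q)).card : ℝ) = (Q : ℝ) ^ 2 := by
    rw [Finset.card_univ, Fintype.card_prod, ZMod.card]
    push_cast
    ring
  have hBle : ∀ b, torusDensity (B b) ≤ 1 := by
    intro b
    rw [torusDensity, div_le_one (by positivity), ← hVcard]
    exact_mod_cast Finset.card_le_univ _
  -- each bucket is governed by its heaviest coordinate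
  have hBge : ∀ b, (1 / 4) * ∏ i ∈ Finset.univ.filter (fun i => bucket i = b),
      (1 - rejectProb (A i)) ≤ torusDensity (B b) := by
    intro b
    rcases hlight b with h | ⟨M, hM, h⟩
    · have hB : B b = Finset.univ := by
        simp only [B, h]
        simp
      rw [h, Finset.prod_empty, torusDensity, hB, hVcard, div_self (by positivity)]
      norm_num
    · have h1 := quarter_le_torusDensity hm hn hQ A _ M h
      refine le_trans ?_ h1
      have h2 : ∏ i ∈ Finset.univ.filter (fun i => bucket i = b), (1 - rejectProb (A i)) ≤
          1 - rejectProb (A M) := by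
        rw [← Finset.mul_prod_erase _ _ hM]
        refine mul_le_of_le_one_right (hnn M) ?_
        exact Finset.prod_le_one (fun i _ => hnn i) fun i _ => by
          linarith [rejectProb_nonneg (A i)]
      linarith
  have hBpos : ∀ b, 0 < torusDensity (B b) := fun b =>
    lt_of_lt_of_le (mul_pos (by norm_num) (Finset.prod_pos fun i _ => hpi i)) (hBge b)
  have hprod : (1 / 4 : ℝ) ^ T * ∏ i, (1 - rejectProb (A i)) ≤
      ∏ b ∈ Finset.range T, torusDensity (B b) := by
    rw [← Finset.prod_fiberwise_of_maps_to (s := Finset.univ) (t := Finset.range T) (g := bucket)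
      (fun i _ => Finset.mem_range.2 (hb i))]
    have : (1 / 4 : ℝ) ^ T = ∏ b ∈ Finset.range T, (1 / 4 : ℝ) := by simp
    rw [this, ← Finset.prod_mul_distrib]
    exact Finset.prod_le_prod
      (fun b _ => mul_nonneg (by norm_num) (Finset.prod_nonneg fun i _ => hnn i)) fun b _ => hBge b
  obtain ⟨k, hk0, hksum, hk⟩ := exists_gaps T R L C κ hR hRT hκ (fun b => torusDensity (B b))
    (fun b _ => hBpos b) (fun b _ => hBle b)
    ((mul_le_mul_of_nonneg_left hA (by positivity)).trans hprod)
  let j : ℕ → ℕ := fun b => if b = 0 then k 0 else k (b - 1) + k b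
  have hj0 : ∀ b, 0 < j b := by
    intro b
    have := hk0 0
    have := hk0 b
    simp only [j]
    split_ifs <;> omega
  have hjsum : ∑ b ∈ Finset.range T, j b ≤ H := by
    have : ∀ t, ∑ b ∈ Finset.range t, j b ≤ 2 * ∑ b ∈ Finset.range t, k b := by
      intro t
      have h1 : ∀ t, ∑ b ∈ Finset.range (t + 1), j b + k t = 2 * ∑ b ∈ Finset.range (t + 1), k b := by
        intro t
        induction t with
        | zero => simp [j]; ring
        | succ t ih =>
          rw [Finset.sum_range_succ, Finset.sum_range_succ k]
          simp only [j, Nat.add_eq_zero_iff, one_ne_zero, and_false, if_false, Nat.add_sub_cancel]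
            at ih ⊢
          omega
      cases t with
      | zero => simp
      | succ t => have := h1 t; omega
    exact (this T).trans (Nat.mul_le_mul_left _ hksum)
  obtain ⟨Z, hZ, hZ'⟩ := exists_onePos_eq_sum T j hj0 H hjsum
  refine ⟨Z, hZ, ?_⟩
  have hmain := le_card_walks T (u * H) (fun b => u * j b) B
    (by rw [← Finset.mul_sum]; exact Nat.mul_le_mul_left _ hjsum) (fun b _ => hBpos b)
    (by
      intro b hbT
      have h1 := hk b (by omega)
      have h2 := hk (b + 1) hbT
      simp only [j, Nat.add_eq_zero_iff, one_ne_zero, and_false, if_false, Nat.add_sub_cancel,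
        mul_add, pow_add]
      calc _ ≤ torusDensity (B b) / 8 * (torusDensity (B (b + 1)) / 8) :=
            mul_le_mul h1 h2 (by positivity) (by linarith [hBpos b])
        _ = _ := by ring)
  refine le_trans ?_ (hmain.trans ?_)
  · refine mul_le_mul_of_nonneg_left ?_ (by positivity)
    rw [Finset.prod_mul_distrib, Finset.prod_const, Finset.card_range]
    calc (3 / 16 : ℝ) ^ T * ∏ i, (1 - rejectProb (A i))
        = (3 / 4) ^ T * ((1 / 4) ^ T * ∏ i, (1 - rejectProb (A i))) := by
          rw [← mul_assoc, ← mul_pow]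
          norm_num
      _ ≤ _ := mul_le_mul_of_nonneg_left hprod (by positivity)
  · refine Finset.sum_le_sum fun v _ => Finset.sum_le_sum fun G _ => ?_
    by_cases h : ∀ b < T, torusPos G (∑ i ∈ Finset.range (b + 1), u * j i) v ∈ B b
    · rw [if_pos h, if_pos]
      intro i
      have h1 := h (bucket i) (hb i)
      rw [← Finset.mul_sum, ← hZ' _ (hb i)] at h1
      exact (Finset.mem_filter.1 h1).2 i (Finset.mem_filter.2 ⟨Finset.mem_univ _, rfl⟩)
    · rw [if_neg h]
      split_ifs <;> norm_num

/-- The coordinate `i` of the point of `[m]^n` that is built from the components of a seed: `a` and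
`W` hash `i` into a bucket, where `F` marks the buckets that are too heavy; `Z` schedules the
buckets along a walk on the torus that starts at `(y₁, y₂)` and makes the moves `G`; the position
at the time of the bucket encodes the coordinate. -/
def seedCoord {Q m : ℕ} (hm : 0 < m) (q U l H u : ℕ) (a W F Z y₁ y₂ G i : ℕ) : Fin m :=
  torusValue hm i (torusPos G (u * onePos H Z (bucketOf q F.testBit (l + 1) W (a * i % Q % U) + 1))
    ((y₁ : ZMod Q), (y₂ : ZMod Q)))

/-- The point of `[m]^n` with seed `s`. The digits of `s` in the mixed base
`Q, nW, nF, nZ, Q, Q, …` are the components of the seed. -/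
def seedPoint {Q m : ℕ} (hm : 0 < m) (q U l H u nW nF nZ n s : ℕ) (i : Fin n) : Fin m :=
  seedCoord (Q := Q) hm q U l H u (s % Q) (s / Q % nW) (s / Q / nW % nF) (s / Q / nW / nF % nZ)
    (s / Q / nW / nF / nZ % Q) (s / Q / nW / nF / nZ / Q % Q) (s / Q / nW / nF / nZ / Q / Q) i

lemma sum_range_range_eq_sum_torus {Q : ℕ} [NeZero Q] (φ : ZMod Q × ZMod Q → ℝ) :
    ∑ y₁ ∈ Finset.range Q, ∑ y₂ ∈ Finset.range Q, φ ((y₁ : ZMod Q), (y₂ : ZMod Q)) =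
      ∑ v, φ v := by
  have h : ∀ ψ : ZMod Q → ℝ, ∑ y ∈ Finset.range Q, ψ (y : ZMod Q) = ∑ a, ψ a := by
    intro ψ
    refine Finset.sum_bij' (fun y _ => (y : ZMod Q)) (fun a _ => a.val) ?_ ?_ ?_ ?_ ?_
    · simp
    · intro a _
      simpa using ZMod.val_lt a
    · intro y hy
      exact ZMod.val_natCast_of_lt (Finset.mem_range.1 hy)
    · intro a _
      simp
    · simp
  rw [Fintype.sum_prod_type, ← h]
  exact Finset.sum_congr rfl fun y _ => h fun b => φ ((y : ZMod Q), b)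

open Classical in
/-- A good hash function `a` followed by a good digit sequence `W` splits the coordinates into light
buckets; that happens for a fraction of at least `1 / (4 R)` of the pairs `(a, W)`. -/
lemma card_good_hashes {n q Q l : ℕ} (hq : q.Prime) (hQ : Q.Prime) (hnQ : n ≤ Q)
    (hqU : 96 * (2 ^ l) ^ 2 < q) (hQU : 96 * (2 ^ l) ^ 2 ≤ Q) (w : Fin n → ℝ) (hw : ∀ i, 0 ≤ w i)
    (hsum : ∑ i, w i ≤ 2 ^ l) :
    (Q : ℝ) * q ^ (l + 1) ≤ 4 * 2 ^ l * ∑ a ∈ Finset.range Q, ∑ W ∈ Finset.range (q ^ (l + 1)),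
      if ∃ F : ℕ → Bool, ∀ b, IsLight w (Finset.univ.filter fun i : Fin n =>
        bucketOf q F (l + 1) W (a * i % Q % (96 * (2 ^ l) ^ 2)) = b) then (1 : ℝ) else 0 := by
  set R : ℕ := 2 ^ l with hR
  have hR1 : 1 ≤ R := Nat.one_le_two_pow
  have hRpos : (0 : ℝ) < R := by exact_mod_cast hR1
  have hRl : (2 : ℝ) ^ l = R := by rw [hR]; push_cast; rfl
  set U := 96 * R ^ 2 with hU
  have hUpos : 0 < U := by positivity
  let h : ℕ → Fin n → ℕ := fun a i => a * i % Q % U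
  have hhalf : Q ≤ 2 * ((Finset.range Q).filter fun a =>
      collisionWeight w (h a) Finset.univ ≤ 2 * (1 / 32)).card := by
    refine le_two_mul_card_filter_le Q _ (fun a => collisionWeight_nonneg w hw _ _) _
      (by positivity) ?_
    refine (sum_collisionWeight_le w hw Q U R (by exact_mod_cast hUpos) h (fun i => i.val)
      Finset.univ ?_ (by rw [← hRl]; exact hsum)).trans ?_
    · intro i _ j _ hij
      have := card_hash_collisions_mul_le hQ hUpos hQU (i.isLt.trans_le hnQ) (j.isLt.trans_le hnQ)
        hij
      exact_mod_cast this
    · refine mul_le_mul_of_nonneg_left ?_ (Nat.cast_nonneg _)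
      have h0 : collisionWeight w (fun i : Fin n => i.val) Finset.univ = 0 := by
        refine Finset.sum_eq_zero fun i _ => Finset.sum_eq_zero fun j _ => if_neg ?_
        rintro ⟨h1, h2⟩
        exact h1 (Fin.ext h2)
      rw [h0, zero_add, hU]
      push_cast
      rw [div_le_div_iff₀ (by positivity) (by norm_num)]
      ring_nf
      rfl
  set P : ℕ → ℕ → Prop := fun a W => ∃ F : ℕ → Bool, ∀ b, IsLight w
    (Finset.univ.filter fun i : Fin n => bucketOf q F (l + 1) W (a * i % Q % U) = b) with hP
  have hstep : ∀ a ∈ (Finset.range Q).filter fun a =>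
      collisionWeight w (h a) Finset.univ ≤ 2 * (1 / 32),
      (q : ℝ) ^ (l + 1) ≤ 2 ^ (l + 1) * ∑ W ∈ Finset.range (q ^ (l + 1)),
        if P a W then (1 : ℝ) else 0 := by
    intro a ha
    have h1 := pow_le_card_bucketOf_isLight w hw q hq (h a)
      (fun j => (Nat.mod_lt _ hUpos).trans hqU) (l + 1)
      (by
        rw [pow_succ, ← hR]
        nlinarith)
      Finset.univ (by linarith [(Finset.mem_filter.1 ha).2])
      (by rw [pow_succ]; linarith)
    rw [← Finset.sum_filter, Finset.sum_const, nsmul_eq_mul, mul_one]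
    exact_mod_cast h1
  have hnn : ∀ a, 0 ≤ ∑ W ∈ Finset.range (q ^ (l + 1)), if P a W then (1 : ℝ) else 0 :=
    fun a => Finset.sum_nonneg fun W _ => by split_ifs <;> norm_num
  have hsub := Finset.sum_le_sum_of_subset_of_nonneg
    (Finset.filter_subset (fun a => collisionWeight w (h a) Finset.univ ≤ 2 * (1 / 32))
      (Finset.range Q))
    (f := fun a => ∑ W ∈ Finset.range (q ^ (l + 1)), if P a W then (1 : ℝ) else 0)
    fun a _ _ => hnn a
  have h5 := Finset.card_nsmul_le_sum _ _ _ hstep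
  rw [nsmul_eq_mul, ← Finset.mul_sum] at h5
  have hhalfR : (Q : ℝ) ≤ 2 * ((Finset.range Q).filter fun a =>
      collisionWeight w (h a) Finset.univ ≤ 2 * (1 / 32)).card := by exact_mod_cast hhalf
  have h6 : (0 : ℝ) ≤ (q : ℝ) ^ (l + 1) := by positivity
  have h7 := mul_le_mul_of_nonneg_right hhalfR h6
  have h8 := mul_le_mul_of_nonneg_left hsub (show (0 : ℝ) ≤ 2 * 2 ^ (l + 1) by positivity)
  have h9 : (2 : ℝ) * 2 ^ (l + 1) = 4 * 2 ^ l := by rw [pow_succ]; ring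
  rw [h9] at h8
  rw [hRl] at h8 ⊢
  have h10 : (2 : ℝ) ^ (l + 1) = 2 * R := by rw [pow_succ, hRl]; ring
  rw [h10] at h5
  linarith

/-- The exponent of the loss in the density of good seeds. -/
def lossExponent (C : ℕ) : ℕ := 3 + 96 * (16 + 2 * C)

open Classical in
/-- The fraction of good seeds: the points of `[m]^n` given by the seeds hit a rectangle with at
least its density, up to a factor that is exponential in `R`. -/
lemma le_card_seedPoint {n m q Q l L C κ : ℕ} (hm : 0 < m) (hq : q.Prime) (hQ : Q.Prime)
    (hnQ : n ≤ Q) (hmQ : 4 * m ≤ Q)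
    (hqU : 96 * (2 ^ l) ^ 2 < q) (hQU : 96 * (2 ^ l) ^ 2 ≤ Q)
    (hκ : (9999 / 10000 : ℝ) ^ κ ≤ 1 / 2)
    (nW nF nZ nG H u : ℕ) (hnW : nW = q ^ (l + 1)) (hnF : nF = 2 ^ (96 * 2 ^ l))
    (hH : H = 2 * ((6 + C) * (96 * 2 ^ l))) (hnZ : nZ = 2 ^ H) (hu : u = κ * (1 + L / 2 ^ l))
    (hnG : nG = 5 ^ (u * H))
    (A : Fin n → Finset (Fin m)) (hsum : ∑ i, rejectProb (A i) ≤ 2 ^ l)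
    (hA : (1 / 2 : ℝ) ^ (C * L) ≤ ∏ i, (1 - rejectProb (A i))) :
    ((Q * (nW * (nF * (nZ * (Q * (Q * nG))))) : ℕ) : ℝ) *
        ((∏ i, (1 - rejectProb (A i))) / 2 ^ (lossExponent C * 2 ^ l)) ≤
      ((Finset.range (Q * (nW * (nF * (nZ * (Q * (Q * nG))))))).filter fun s =>
        ∀ i, seedPoint (Q := Q) hm q (96 * (2 ^ l) ^ 2) l H u nW nF nZ n s i ∈ A i).card := by
  have : Fact Q.Prime := ⟨hQ⟩
  have : NeZero Q := ⟨hQ.ne_zero⟩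
  set R : ℕ := 2 ^ l with hR
  have hR1 : 1 ≤ R := Nat.one_le_two_pow
  set U := 96 * R ^ 2 with hU
  set T := 96 * R with hT
  set p := ∏ i, (1 - rejectProb (A i)) with hp
  have hp0 : 0 < p := lt_of_lt_of_le (by positivity) hA
  let good : ℕ → ℕ → ℕ → ℕ → ℕ → ℕ → ℕ → Prop := fun a W F Z y₁ y₂ G => ∀ i : Fin n,
    seedCoord (Q := Q) hm q U l H u a W F Z y₁ y₂ G i ∈ A i
  -- the number of good seeds as an iterated sum over the components
  have hcount : (((Finset.range (Q * (nW * (nF * (nZ * (Q * (Q * nG))))))).filter fun s =>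
        ∀ i, seedPoint (Q := Q) hm q U l H u nW nF nZ n s i ∈ A i).card : ℝ) =
      ∑ a ∈ Finset.range Q, ∑ W ∈ Finset.range nW, ∑ F ∈ Finset.range nF, ∑ Z ∈ Finset.range nZ,
        ∑ y₁ ∈ Finset.range Q, ∑ y₂ ∈ Finset.range Q, ∑ G ∈ Finset.range nG,
          if good a W F Z y₁ y₂ G then (1 : ℝ) else 0 := by
    rw [Finset.natCast_card_filter]
    refine (Finset.sum_range_mul_eq Q _ fun a s => if good a (s % nW) (s / nW % nF)
      (s / nW / nF % nZ) (s / nW / nF / nZ % Q) (s / nW / nF / nZ / Q % Q)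
      (s / nW / nF / nZ / Q / Q) then (1 : ℝ) else 0).trans ?_
    refine Finset.sum_congr rfl fun a _ => ?_
    refine (Finset.sum_range_mul_eq nW _ fun W s => if good a W (s % nF)
      (s / nF % nZ) (s / nF / nZ % Q) (s / nF / nZ / Q % Q)
      (s / nF / nZ / Q / Q) then (1 : ℝ) else 0).trans ?_
    refine Finset.sum_congr rfl fun W _ => ?_
    refine (Finset.sum_range_mul_eq nF _ fun F s => if good a W F
      (s % nZ) (s / nZ % Q) (s / nZ / Q % Q) (s / nZ / Q / Q) then (1 : ℝ) else 0).trans ?_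
    refine Finset.sum_congr rfl fun F _ => ?_
    refine (Finset.sum_range_mul_eq nZ _ fun Z s => if good a W F Z
      (s % Q) (s / Q % Q) (s / Q / Q) then (1 : ℝ) else 0).trans ?_
    refine Finset.sum_congr rfl fun Z _ => ?_
    refine (Finset.sum_range_mul_eq Q _ fun y₁ s => if good a W F Z y₁
      (s % Q) (s / Q) then (1 : ℝ) else 0).trans ?_
    refine Finset.sum_congr rfl fun y₁ _ => ?_
    exact Finset.sum_range_mul_eq Q _ fun y₂ G => if good a W F Z y₁ y₂ G then (1 : ℝ) else 0
  set c : ℝ := (Q : ℝ) ^ 2 * nG * ((3 / 16) ^ T * p) with hc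
  have hc0 : 0 ≤ c := by positivity
  -- for a good pair `(a, W)`, single out the right marks `F` and the right schedule `Z`
  have hgood : ∀ a W : ℕ, (if ∃ F : ℕ → Bool, ∀ b, IsLight (fun i => rejectProb (A i))
        (Finset.univ.filter fun i : Fin n => bucketOf q F (l + 1) W (a * i % Q % U) = b)
        then (1 : ℝ) else 0) * c ≤
      ∑ F ∈ Finset.range nF, ∑ Z ∈ Finset.range nZ,
        ∑ y₁ ∈ Finset.range Q, ∑ y₂ ∈ Finset.range Q, ∑ G ∈ Finset.range nG,
          if good a W F Z y₁ y₂ G then (1 : ℝ) else 0 := by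
    intro a W
    have hnn : ∀ F Z, 0 ≤ ∑ y₁ ∈ Finset.range Q, ∑ y₂ ∈ Finset.range Q, ∑ G ∈ Finset.range nG,
        if good a W F Z y₁ y₂ G then (1 : ℝ) else 0 := fun F Z =>
      Finset.sum_nonneg fun _ _ => Finset.sum_nonneg fun _ _ => Finset.sum_nonneg fun _ _ => by
        split_ifs <;> norm_num
    split_ifs with h
    · obtain ⟨F, hF⟩ := h
      set F₀ := Nat.ofBits fun b : Fin T => F b with hF₀
      have hF₀lt : F₀ < nF := by
        rw [hnF]
        exact Nat.ofBits_lt_two_pow _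
      have hT2 : 48 * 2 ^ (l + 1) = T := by rw [pow_succ, hT, hR]; ring
      have hbucket : ∀ x, bucketOf q F (l + 1) W x = bucketOf q F₀.testBit (l + 1) W x := by
        intro x
        refine bucketOf_congr q (l + 1) W x fun b hb => ?_
        rw [hT2] at hb
        rw [hF₀, Nat.testBit_ofBits_lt _ _ hb]
      obtain ⟨Z, hZ, hZc⟩ := exists_schedule hm hnQ hmQ A T R L C κ hR1 (by omega) hκ
        (fun i => bucketOf q F₀.testBit (l + 1) W (a * i % Q % U))
        (fun i => by rw [← hT2]; exact bucketOf_lt _ _ _ _ _)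
        (by
          intro b
          have := hF b
          simp_rw [hbucket] at this
          exact this) hA
      have hZlt : Z < nZ := by rw [hnZ, hH]; exact hZ
      rw [← hH, ← hu, ← hnG] at hZc
      have hnG' : (nG : ℝ) = 5 ^ (u * H) := by rw [hnG]; push_cast; rfl
      rw [one_mul, hc, hnG', hp]
      refine hZc.trans ?_
      refine le_trans ?_ (Finset.single_le_sum (f := fun F => ∑ Z ∈ Finset.range nZ,
        ∑ y₁ ∈ Finset.range Q, ∑ y₂ ∈ Finset.range Q, ∑ G ∈ Finset.range nG,
          if good a W F Z y₁ y₂ G then (1 : ℝ) else 0)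
        (fun F _ => Finset.sum_nonneg fun Z _ => hnn F Z) (Finset.mem_range.2 hF₀lt))
      refine le_trans ?_ (Finset.single_le_sum (f := fun Z =>
        ∑ y₁ ∈ Finset.range Q, ∑ y₂ ∈ Finset.range Q, ∑ G ∈ Finset.range nG,
          if good a W F₀ Z y₁ y₂ G then (1 : ℝ) else 0)
        (fun Z _ => hnn F₀ Z) (Finset.mem_range.2 hZlt))
      rw [← sum_range_range_eq_sum_torus]
      refine Finset.sum_le_sum fun y₁ _ => Finset.sum_le_sum fun y₂ _ =>
        Finset.sum_le_sum fun G _ => le_of_eq ?_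
      exact if_congr Iff.rfl rfl rfl
    · rw [zero_mul]
      exact Finset.sum_nonneg fun F _ => Finset.sum_nonneg fun Z _ => hnn F Z
  have hhash := card_good_hashes hq hQ hnQ hqU hQU (fun i => rejectProb (A i))
    (fun i => rejectProb_nonneg _) hsum
  rw [hcount]
  refine le_trans ?_ (Finset.sum_le_sum fun a _ => Finset.sum_le_sum fun W _ => hgood a W)
  simp_rw [← Finset.sum_mul]
  set Y := ∑ a ∈ Finset.range Q, ∑ W ∈ Finset.range nW,
    if ∃ F : ℕ → Bool, ∀ b, IsLight (fun i => rejectProb (A i))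
      (Finset.univ.filter fun i : Fin n => bucketOf q F (l + 1) W (a * i % Q % U) = b)
      then (1 : ℝ) else 0 with hY
  have hRl : (2 : ℝ) ^ l = R := by rw [hR]; push_cast; rfl
  have hY' : (Q : ℝ) * nW ≤ 4 * R * Y := by
    rw [hY, hnW, ← hRl]
    push_cast
    exact hhash
  -- the losses of the separate choices add up to `lossExponent C * R`
  have hloss : 4 * (R : ℝ) * (nF * nZ) ≤ (3 / 16) ^ T * 2 ^ (lossExponent C * R) := by
    have e1 : lossExponent C * R = 3 * R + T + H + 3 * T := by
      rw [lossExponent, hH, hT]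
      ring
    have h1 : 4 * (R : ℝ) ≤ 2 ^ (3 * R) := by
      have h2 : 4 * R ≤ 2 ^ (3 * R) := by
        calc 4 * R ≤ 2 ^ 2 * 2 ^ R := Nat.mul_le_mul (by norm_num) Nat.lt_two_pow_self.le
          _ = 2 ^ (2 + R) := (pow_add _ _ _).symm
          _ ≤ 2 ^ (3 * R) := Nat.pow_le_pow_right (by norm_num) (by omega)
      exact_mod_cast h2
    have h3 : (1 : ℝ) ≤ (3 / 16) ^ T * 2 ^ (3 * T) := by
      rw [pow_mul 2 3 T, ← mul_pow]
      exact one_le_pow₀ (by norm_num)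
    have h4 : (nF : ℝ) * nZ = 2 ^ (T + H) := by
      rw [hnF, hnZ, pow_add]
      push_cast
      rfl
    rw [h4, e1]
    calc 4 * (R : ℝ) * 2 ^ (T + H) ≤ 2 ^ (3 * R) * 2 ^ (T + H) * 1 := by
          rw [mul_one]
          exact mul_le_mul_of_nonneg_right h1 (by positivity)
      _ ≤ 2 ^ (3 * R) * 2 ^ (T + H) * ((3 / 16) ^ T * 2 ^ (3 * T)) :=
          mul_le_mul_of_nonneg_left h3 (by positivity)
      _ = _ := by ring
  rw [mul_div_assoc', div_le_iff₀ (by positivity)]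
  push_cast
  have hRpos : (0 : ℝ) < R := by exact_mod_cast hR1
  have hY0 : 0 ≤ Y := Finset.sum_nonneg fun _ _ => Finset.sum_nonneg fun _ _ => by
    split_ifs <;> norm_num
  calc (Q : ℝ) * (nW * (nF * (nZ * (Q * (Q * nG))))) * p
      = (Q * nW) * ((nF * nZ) * (Q ^ 2 * nG * p)) := by ring
    _ ≤ (4 * R * Y) * ((nF * nZ) * (Q ^ 2 * nG * p)) :=
        mul_le_mul_of_nonneg_right hY' (by positivity)
    _ = (4 * R * (nF * nZ)) * (Y * (Q ^ 2 * nG * p)) := by ring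
    _ ≤ ((3 / 16) ^ T * 2 ^ (lossExponent C * R)) * (Y * (Q ^ 2 * nG * p)) :=
        mul_le_mul_of_nonneg_right hloss (by positivity)
    _ = Y * c * 2 ^ (lossExponent C * R) := by
        rw [hc]
        ring

/-! ### Reasoning about programs with a time bound -/

namespace RAM

@[simp] lemma Store.setReg_reg (σ : Store) (x v y : ℕ) :
    (σ.setReg x v).reg y = if y = x then v else σ.reg y := by
  simp [Store.setReg, Function.update_apply]

/-- A bound for the growth of an expression: on registers that are at most `B`, its value is at most
`(B + 2) ^ weight`. -/
def Expr.weight : Expr → ℕ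
  | .const k => k + 1
  | .var _ => 1
  | .load _ e => e.weight
  | .add e f => e.weight + f.weight + 1
  | .sub e f => e.weight + f.weight + 1
  | .lt e f => e.weight + f.weight + 1
  | .mul e f => e.weight + f.weight + 1
  | .div e f => e.weight + f.weight + 1
  | .mod e f => e.weight + f.weight + 1

/-- The expression does not access the arrays. -/
def Expr.NoLoad : Expr → Prop
  | .const _ => True
  | .var _ => True
  | .load _ _ => False
  | .add e f => e.NoLoad ∧ f.NoLoad
  | .sub e f => e.NoLoad ∧ f.NoLoad
  | .lt e f => e.NoLoad ∧ f.NoLoad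
  | .mul e f => e.NoLoad ∧ f.NoLoad
  | .div e f => e.NoLoad ∧ f.NoLoad
  | .mod e f => e.NoLoad ∧ f.NoLoad

/-- All registers hold numbers that are at most `B`. -/
def Store.Bounded (B : ℕ) (σ : Store) : Prop := ∀ x, σ.reg x ≤ B

lemma Store.Bounded.setReg {B : ℕ} {σ : Store} (h : σ.Bounded B) {x v : ℕ} (hv : v ≤ B) :
    (σ.setReg x v).Bounded B := by
  intro y
  rw [Store.setReg_reg]
  split_ifs
  · exact hv
  · exact h y

lemma Expr.eval_and_cost_le {B : ℕ} {σ : Store} (hσ : σ.Bounded B) (e : Expr) (he : e.NoLoad) :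
    2 ≤ (B + 2) ^ e.weight ∧ e.eval σ ≤ (B + 2) ^ e.weight ∧ e.cost σ ≤ 3 * (B + 2) ^ e.weight := by
  have hbin : ∀ {a b x y c d : ℕ}, 2 ≤ (B + 2) ^ a → 2 ≤ (B + 2) ^ b → x ≤ (B + 2) ^ a →
      y ≤ (B + 2) ^ b → c ≤ 3 * (B + 2) ^ a → d ≤ 3 * (B + 2) ^ b →
      2 ≤ (B + 2) ^ (a + b + 1) ∧ x + y ≤ (B + 2) ^ (a + b + 1) ∧ x * y ≤ (B + 2) ^ (a + b + 1) ∧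
        c + d + (x + y + 1) ≤ 3 * (B + 2) ^ (a + b + 1) := by
    intro a b x y c d ha hb hx hy hc hd
    rw [pow_succ, pow_add]
    set X := (B + 2) ^ a
    set Y := (B + 2) ^ b
    have h1 : X + Y ≤ X * Y := by nlinarith
    have h2 : 2 * (X * Y) ≤ X * Y * (B + 2) := by nlinarith [Nat.zero_le (X * Y * B)]
    have h3 : x * y ≤ X * Y := Nat.mul_le_mul hx hy
    refine ⟨by omega, by omega, by omega, by omega⟩
  have hsize : ∀ x : ℕ, Nat.size x ≤ x := fun x => Nat.size_le.2 Nat.lt_two_pow_self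
  induction e with
  | const k =>
    have h1 : 2 ≤ (B + 2) ^ (k + 1) := by
      calc 2 ≤ B + 2 := by omega
        _ = (B + 2) ^ 1 := (pow_one _).symm
        _ ≤ (B + 2) ^ (k + 1) := Nat.pow_le_pow_right (by omega) (by omega)
    have h2 : k ≤ (B + 2) ^ (k + 1) := by
      calc k ≤ k + 1 := by omega
        _ ≤ 2 ^ (k + 1) := Nat.lt_two_pow_self.le
        _ ≤ (B + 2) ^ (k + 1) := Nat.pow_le_pow_left (by omega) _
    exact ⟨h1, h2, by simp only [Expr.cost, Expr.weight]; omega⟩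
  | var x =>
    have := hσ x
    simp only [Expr.weight, Expr.eval, Expr.cost, pow_one]
    omega
  | load a e _ => exact he.elim
  | add e f ihe ihf =>
    obtain ⟨a1, a2, a3⟩ := ihe he.1
    obtain ⟨b1, b2, b3⟩ := ihf he.2
    obtain ⟨h1, h2, h3, h4⟩ := hbin a1 b1 a2 b2 a3 b3
    exact ⟨h1, h2, by simp only [Expr.cost, Expr.weight]; omega⟩
  | sub e f ihe ihf =>
    obtain ⟨a1, a2, a3⟩ := ihe he.1
    obtain ⟨b1, b2, b3⟩ := ihf he.2
    obtain ⟨h1, h2, h3, h4⟩ := hbin a1 b1 a2 b2 a3 b3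
    exact ⟨h1, by simp only [Expr.eval, Expr.weight]; omega,
      by simp only [Expr.cost, Expr.weight]; omega⟩
  | lt e f ihe ihf =>
    obtain ⟨a1, a2, a3⟩ := ihe he.1
    obtain ⟨b1, b2, b3⟩ := ihf he.2
    obtain ⟨h1, h2, h3, h4⟩ := hbin a1 b1 a2 b2 a3 b3
    exact ⟨h1, by simp only [Expr.eval, Expr.weight]; split_ifs <;> omega,
      by simp only [Expr.cost, Expr.weight]; omega⟩
  | mul e f ihe ihf =>
    obtain ⟨a1, a2, a3⟩ := ihe he.1
    obtain ⟨b1, b2, b3⟩ := ihf he.2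
    obtain ⟨h1, h2, h3, h4⟩ := hbin a1 b1 a2 b2 a3 b3
    have := hsize (e.eval σ)
    have := hsize (f.eval σ)
    exact ⟨h1, h3, by simp only [Expr.cost, Expr.weight]; omega⟩
  | div e f ihe ihf =>
    obtain ⟨a1, a2, a3⟩ := ihe he.1
    obtain ⟨b1, b2, b3⟩ := ihf he.2
    obtain ⟨h1, h2, h3, h4⟩ := hbin a1 b1 a2 b2 a3 b3
    have := hsize (e.eval σ)
    have := hsize (f.eval σ)
    have := Nat.div_le_self (e.eval σ) (f.eval σ)
    exact ⟨h1, by simp only [Expr.eval, Expr.weight]; omega,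
      by simp only [Expr.cost, Expr.weight]; omega⟩
  | mod e f ihe ihf =>
    obtain ⟨a1, a2, a3⟩ := ihe he.1
    obtain ⟨b1, b2, b3⟩ := ihf he.2
    obtain ⟨h1, h2, h3, h4⟩ := hbin a1 b1 a2 b2 a3 b3
    have := hsize (e.eval σ)
    have := hsize (f.eval σ)
    have := Nat.mod_le (e.eval σ) (f.eval σ)
    exact ⟨h1, by simp only [Expr.eval, Expr.weight]; omega,
      by simp only [Expr.cost, Expr.weight]; omega⟩

/-- A bound for the cost of one instruction with an expression of weight at most `w` on registers
that are at most `B`. -/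
def unitCost (B w : ℕ) : ℕ := 3 * (B + 2) ^ w + 1

lemma Expr.cost_le {B w : ℕ} {σ : Store} (hσ : σ.Bounded B) {e : Expr} (he : e.NoLoad)
    (hw : e.weight ≤ w) : e.cost σ + 1 ≤ unitCost B w := by
  have h := (e.eval_and_cost_le hσ he).2.2
  have h2 : (B + 2) ^ e.weight ≤ (B + 2) ^ w := Nat.pow_le_pow_right (by omega) hw
  rw [unitCost]
  omega

/-- The program `P`, started with memory `σ`, halts within `a * (B + 1) ^ d` unit costs, with all
registers bounded by `B` and a memory that satisfies `Φ`. The number `d` is the depth of nested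
loops. -/
def Within (B w a d : ℕ) (P : Prog) (σ : Store) (Φ : Store → Prop) : Prop :=
  ∃ τ t, Run P σ τ t ∧ t ≤ a * ((B + 1) ^ d * unitCost B w) ∧ τ.Bounded B ∧ Φ τ

lemma Within.mono {B w a a' d d' : ℕ} {P : Prog} {σ : Store} {Φ Ψ : Store → Prop}
    (h : Within B w a d P σ Φ) (ha : a ≤ a') (hd : d ≤ d') (hΦ : ∀ τ, τ.Bounded B → Φ τ → Ψ τ) :
    Within B w a' d' P σ Ψ := by
  obtain ⟨τ, t, hr, ht, hb, hp⟩ := h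
  refine ⟨τ, t, hr, ht.trans ?_, hb, hΦ τ hb hp⟩
  exact Nat.mul_le_mul ha (Nat.mul_le_mul_right _ (Nat.pow_le_pow_right (by omega) hd))

/-- The rule for sequences, with an intermediate assertion `Ψ`. -/
lemma Within.seq {B w d : ℕ} (a b : ℕ) {P Q : Prog} {σ : Store} {Φ : Store → Prop}
    (Ψ : Store → Prop) (h : Within B w a d P σ Ψ)
    (h' : ∀ τ, τ.Bounded B → Ψ τ → Within B w b d Q τ Φ) :
    Within B w (a + b) d (.seq P Q) σ Φ := by
  obtain ⟨τ, t, hr, ht, hb, h2⟩ := h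
  obtain ⟨υ, s, hr', hs, hb', h3⟩ := h' τ hb h2
  exact ⟨υ, t + s, Run.seq hr hr', by rw [add_mul]; omega, hb', h3⟩

/-- The loop rule. `V N` is an invariant that leaves at most `N` iterations to go. -/
lemma Within.loop {B w a d : ℕ} {e : Expr} {P : Prog} {Φ : Store → Prop} (V : ℕ → Store → Prop)
    (he : e.NoLoad) (hw : e.weight ≤ w)
    (hexit : ∀ N σ, σ.Bounded B → V N σ → e.eval σ = 0 → Φ σ)
    (hstep : ∀ N σ, σ.Bounded B → V N σ → e.eval σ ≠ 0 →
      ∃ N', N = N' + 1 ∧ Within B w a d P σ (V N'))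
    {N : ℕ} {σ : Store} (hσ : σ.Bounded B) (hN : N ≤ B) (hV : V N σ) :
    Within B w (a + 1) (d + 1) (.loop e P) σ Φ := by
  set E := unitCost B w with hE
  have main : ∀ N σ, σ.Bounded B → V N σ → ∃ τ t, Run (.loop e P) σ τ t ∧
      t ≤ N * ((a + 1) * ((B + 1) ^ d * E)) + E ∧ τ.Bounded B ∧ Φ τ := by
    intro N
    induction N with
    | zero =>
      intro σ hσ hV
      by_cases h0 : e.eval σ = 0
      · have hc := Expr.cost_le hσ he hw
        exact ⟨σ, _, Run.loop_exit h0, by rw [← hE] at hc; omega, hσ, hexit 0 σ hσ hV h0⟩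
      · obtain ⟨N', h, _⟩ := hstep 0 σ hσ hV h0
        omega
    | succ N ih =>
      intro σ hσ hV
      have hc := Expr.cost_le hσ he hw
      rw [← hE] at hc
      by_cases h0 : e.eval σ = 0
      · exact ⟨σ, _, Run.loop_exit h0, by omega, hσ, hexit _ σ hσ hV h0⟩
      · obtain ⟨N', h, τ, s, hr, hs, hb, hV'⟩ := hstep _ σ hσ hV h0
        obtain rfl : N' = N := by omega
        obtain ⟨υ, t, hr', ht, hb', hΦ⟩ := ih τ hb hV'
        refine ⟨υ, _, Run.loop_step h0 hr hr', ?_, hb', hΦ⟩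
        rw [← hE] at hs
        have h1 : E ≤ (B + 1) ^ d * E := Nat.le_mul_of_pos_left _ (by positivity)
        rw [add_mul a 1, one_mul] at ht ⊢
        rw [add_mul N' 1, one_mul]
        omega
  obtain ⟨τ, t, hr, ht, hb, hΦ⟩ := main N σ hσ hV
  refine ⟨τ, t, hr, ht.trans ?_, hb, hΦ⟩
  have h1 : E ≤ (B + 1) ^ d * E := Nat.le_mul_of_pos_left _ (by positivity)
  have h2 : N * ((a + 1) * ((B + 1) ^ d * E)) ≤ B * ((a + 1) * ((B + 1) ^ d * E)) :=
    Nat.mul_le_mul_right _ hN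
  have h3 : (a + 1) * ((B + 1) ^ (d + 1) * E) =
      B * ((a + 1) * ((B + 1) ^ d * E)) + (a * ((B + 1) ^ d * E) + (B + 1) ^ d * E) := by
    rw [pow_succ]
    ring
  rw [h3]
  have := Nat.zero_le (a * ((B + 1) ^ d * E))
  omega

lemma Within.cond {B w a d : ℕ} {e : Expr} {P Q : Prog} {σ : Store} {Φ : Store → Prop}
    (hσ : σ.Bounded B) (he : e.NoLoad) (hw : e.weight ≤ w)
    (h1 : e.eval σ ≠ 0 → Within B w a d P σ Φ) (h2 : e.eval σ = 0 → Within B w a d Q σ Φ) :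
    Within B w (a + 1) d (.cond e P Q) σ Φ := by
  have hc := Expr.cost_le hσ he hw
  have h3 : unitCost B w ≤ (B + 1) ^ d * unitCost B w := Nat.le_mul_of_pos_left _ (by positivity)
  by_cases h0 : e.eval σ = 0
  · obtain ⟨τ, t, hr, ht, hb, hp⟩ := h2 h0
    exact ⟨τ, _, Run.cond_false h0 hr, by rw [add_mul]; omega, hb, hp⟩
  · obtain ⟨τ, t, hr, ht, hb, hp⟩ := h1 h0
    exact ⟨τ, _, Run.cond_true h0 hr, by rw [add_mul]; omega, hb, hp⟩

/-- A sequence of assignments. -/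
def block : List (ℕ × Expr) → Prog
  | [] => .skip
  | p :: l => .seq (.assign p.1 p.2) (block l)

/-- The memory after a sequence of assignments. -/
def exec : List (ℕ × Expr) → Store → Store
  | [], σ => σ
  | p :: l, σ => exec l (σ.setReg p.1 (p.2.eval σ))

/-- The side conditions for the time bound of a sequence of assignments: its expressions have weight
at most `w`, and their values are at most `B`. -/
def BlockOk (B w : ℕ) : List (ℕ × Expr) → Store → Prop
  | [], _ => True
  | p :: l, σ => p.2.NoLoad ∧ p.2.weight ≤ w ∧ p.2.eval σ ≤ B ∧
      BlockOk B w l (σ.setReg p.1 (p.2.eval σ))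

lemma Within.block {B w a d : ℕ} (l : List (ℕ × Expr)) {σ : Store} {Φ : Store → Prop}
    (hσ : σ.Bounded B) (ha : l.length + 1 ≤ a) (hl : BlockOk B w l σ) (hΦ : Φ (exec l σ)) :
    Within B w a d (block l) σ Φ := by
  suffices h : Within B w (l.length + 1) 0 (RAM.block l) σ Φ from
    h.mono ha (Nat.zero_le d) fun _ _ h => h
  clear ha
  induction l generalizing σ with
  | nil =>
    refine ⟨σ, 1, Run.skip σ, ?_, hσ, hΦ⟩
    simp [unitCost]
  | cons p l ih =>
    obtain ⟨h1, h2, h3, h4⟩ := hl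
    have hb := hσ.setReg (x := p.1) h3
    obtain ⟨τ, t, hr, ht, hb', hp⟩ := ih hb h4 hΦ
    refine ⟨τ, _, Run.seq (Run.assign σ p.1 p.2) hr, ?_, hb', hp⟩
    have hc := Expr.cost_le hσ h1 h2
    rw [pow_zero, one_mul] at ht ⊢
    rw [List.length_cons, add_mul (l.length + 1) 1, one_mul]
    omega

/-- The stores have the same arrays and the same registers below number `r`. -/
def Agree (r : ℕ) (σ τ : Store) : Prop := (∀ x < r, τ.reg x = σ.reg x) ∧ τ.arr = σ.arr

lemma Agree.refl (r : ℕ) (σ : Store) : Agree r σ σ := ⟨fun _ _ => rfl, rfl⟩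

lemma Agree.trans {r r' : ℕ} {σ τ υ : Store} (h : Agree r σ τ) (h' : Agree r' τ υ) (hr : r ≤ r') :
    Agree r σ υ :=
  ⟨fun x hx => (h'.1 x (hx.trans_le hr)).trans (h.1 x hx), h'.2.trans h.2⟩

lemma agree_exec (r : ℕ) (l : List (ℕ × Expr)) (σ : Store) (hl : ∀ p ∈ l, r ≤ p.1) :
    Agree r σ (exec l σ) := by
  induction l generalizing σ with
  | nil => exact Agree.refl r σ
  | cons p l ih =>
    have h1 : Agree r σ (σ.setReg p.1 (p.2.eval σ)) := by
      refine ⟨fun x hx => ?_, rfl⟩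
      have := hl p (by simp)
      rw [Store.setReg_reg, if_neg (by omega)]
    exact h1.trans (ih _ fun p hp => hl p (by simp [hp])) le_rfl

/-! ### Programs for powers and primes -/

/-- Register `dst` gets the value `base ^ expo`; register `30` counts down. -/
def powProg (dst : ℕ) (base expo : Expr) : Prog :=
  .seq (block [(dst, .const 1), (30, expo)])
    (.loop (.var 30) (block [(dst, .mul (.var dst) base), (30, .sub (.var 30) (.const 1))]))

lemma within_powProg {B w dst b e : ℕ} (base expo : Expr) {σ : Store} (hσ : σ.Bounded B)
    (hdst : dst < 30) (hbase : base.NoLoad) (hbw : base.weight + 2 ≤ w) (hexpo : expo.NoLoad)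
    (hew : expo.weight ≤ w) (hw : 10 ≤ w)
    (hb : ∀ τ, Agree dst σ τ → base.eval τ = b)
    (he : ∀ τ, Agree dst σ τ → expo.eval τ = e) (heB : e ≤ B) (hb1 : 1 ≤ b) (hpow : b ^ e ≤ B) :
    Within B w 7 1 (powProg dst base expo) σ fun τ => Agree dst σ τ ∧ τ.reg dst = b ^ e := by
  have hB1 : 1 ≤ B := (Nat.one_le_pow _ _ hb1).trans hpow
  have hd : dst ≠ 30 := by omega
  have hd' : (30 : ℕ) ≠ dst := by omega
  have hag : Agree dst σ (exec [(dst, .const 1), (30, expo)] σ) :=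
    agree_exec _ _ _ (by simp; omega)
  have h1 : Agree dst σ (σ.setReg dst 1) := agree_exec dst [(dst, .const 1)] σ (by simp)
  refine Within.seq 3 4 (fun τ => Agree dst σ τ ∧ τ.reg dst = 1 ∧ τ.reg 30 = e)
    (Within.block _ hσ (by simp) ?_ ?_) ?_
  · simp [BlockOk, Expr.NoLoad, Expr.weight, Expr.eval, hexpo, hew, hB1, he _ h1, heB]
    omega
  · refine ⟨hag, ?_, ?_⟩
    · simp [exec, Expr.eval, hd]
    · simp [exec, Expr.eval, he _ h1]
  · rintro τ hτ ⟨hτ1, hτ2, hτ3⟩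
    refine Within.loop (a := 3) (d := 0) (N := e)
      (fun N υ => Agree dst σ υ ∧ υ.reg dst * b ^ N = b ^ e ∧ υ.reg 30 = N) (by trivial)
      (by simp [Expr.weight]; omega) ?_ ?_ hτ heB ⟨hτ1, by rw [hτ2, one_mul], hτ3⟩
    · rintro N υ - ⟨h1, h2, h3⟩ h0
      have : N = 0 := by rw [← h3]; exact h0
      subst this
      exact ⟨h1, by simpa using h2⟩
    · rintro N υ hυ ⟨h1, h2, h3⟩ h0
      have hN : N ≠ 0 := by rw [← h3]; exact h0
      obtain ⟨N', rfl⟩ := Nat.exists_eq_succ_of_ne_zero hN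
      refine ⟨N', rfl, ?_⟩
      have hbv := hb υ h1
      have hval : υ.reg dst * b * b ^ N' = b ^ e := by rw [← h2, pow_succ]; ring
      have hle : υ.reg dst * b ≤ B := by
        refine le_trans ?_ hpow
        rw [← hval]
        exact Nat.le_mul_of_pos_right _ (by positivity)
      refine Within.block _ hυ (by simp) ?_ ?_
      · have := hυ 30
        simp [BlockOk, Expr.NoLoad, Expr.weight, Expr.eval, hbase, hbv, hle, hd']
        omega
      · refine ⟨h1.trans (agree_exec dst _ υ (by simp; omega)) le_rfl, ?_, ?_⟩
        · simp [exec, Expr.eval, hd, hbv, hval]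
        · simp [exec, Expr.eval, hd', h3]

/-- Register `dst` gets the largest prime in the interval `(N, 2 N]`, where `N` is the value of
register `src`: every number of the interval is tested in turn, by trial division, and overwrites
`dst` if it is prime. -/
def primeProg (dst src : ℕ) : Prog :=
  .seq (block [(dst, .const 0), (30, .var src)])
    (.loop (.lt (.var 30) (.mul (.const 2) (.var src)))
      (.seq (block [(30, .add (.var 30) (.const 1)), (31, .const 2), (32, .const 1)])
        (.seq
          (.loop (.lt (.var 31) (.var 30))
            (block [(32, .mul (.var 32) (.lt (.const 0) (.mod (.var 30) (.var 31)))),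
              (31, .add (.var 31) (.const 1))]))
          (.cond (.var 32) (block [(dst, .var 30)]) (block [])))))

open Classical in
lemma within_primeProg {B w dst src : ℕ} {σ : Store} (hσ : σ.Bounded B) (hdst : dst < 30)
    (hsrc : src < dst) (hw : 10 ≤ w) (hN : 1 ≤ σ.reg src) (hB : 2 * σ.reg src ≤ B) :
    Within B w 15 2 (primeProg dst src) σ fun τ => Agree dst σ τ ∧ (τ.reg dst).Prime ∧
      σ.reg src < τ.reg dst ∧ τ.reg dst ≤ 2 * σ.reg src := by
  set N := σ.reg src with hNdef
  have hd : dst ≠ 30 := by omega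
  have hd' : (30 : ℕ) ≠ dst := by omega
  have hs : src ≠ dst := by omega
  let I : ℕ → Store → Prop := fun y τ => Agree dst σ τ ∧
    ((τ.reg dst = 0 ∧ ∀ p, N < p → p ≤ y → ¬ p.Prime) ∨
      ((τ.reg dst).Prime ∧ N < τ.reg dst ∧ τ.reg dst ≤ 2 * N))
  refine Within.seq 3 12 (fun τ => I N τ ∧ τ.reg 30 = N)
    (Within.block _ hσ (by simp) ?_ ?_) ?_
  · simp [BlockOk, Expr.NoLoad, Expr.weight, Expr.eval, hs]
    omega
  · refine ⟨⟨agree_exec dst _ σ (by simp; omega), Or.inl ⟨?_, fun p h1 h2 => by omega⟩⟩, ?_⟩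
    · simp [exec, Expr.eval, hd]
    · simp [exec, Expr.eval, hs, hNdef]
  rintro τ hτ ⟨hI, h30⟩
  refine Within.loop (a := 11) (d := 1) (N := N)
    (fun K υ => ∃ y, I y υ ∧ υ.reg 30 = y ∧ N ≤ y ∧ y + K = 2 * N)
    (by simp [Expr.NoLoad])
    (by simp [Expr.weight]; omega) ?_ ?_ hτ (by omega) ⟨N, hI, h30, le_rfl, by omega⟩
  · rintro K υ - ⟨y, ⟨h1, h2⟩, h3, h4, h5⟩ h0
    refine ⟨h1, ?_⟩
    rcases h2 with ⟨-, h2⟩ | h2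
    · have hsv : υ.reg src = N := h1.1 src hsrc
      simp only [Expr.eval, h3, hsv, ite_eq_right_iff, one_ne_zero, imp_false, not_lt] at h0
      obtain ⟨p, hp, hp1, hp2⟩ := Nat.exists_prime_lt_and_le_two_mul N (by omega)
      exact absurd hp (h2 p hp1 (by omega))
    · exact h2
  rintro K υ hυ ⟨y, ⟨h1, h2⟩, h3, h4, h5⟩ h0
  have hsv : υ.reg src = N := h1.1 src hsrc
  simp only [Expr.eval, h3, hsv, ne_eq, ite_eq_right_iff, one_ne_zero, imp_false, not_not] at h0
  obtain ⟨K', rfl⟩ : ∃ K', K = K' + 1 := ⟨K - 1, by omega⟩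
  refine ⟨K', rfl, ?_⟩
  refine Within.seq 4 7
    (fun τ => Agree 30 υ τ ∧ τ.reg 30 = y + 1 ∧ τ.reg 31 = 2 ∧ τ.reg 32 = 1)
    (Within.block _ hυ (by simp) ?_ ?_) ?_
  · simp [BlockOk, Expr.NoLoad, Expr.weight, Expr.eval, h3]
    omega
  · refine ⟨agree_exec 30 _ υ (by simp), ?_, ?_, ?_⟩ <;> simp [exec, Expr.eval, h3]
  rintro τ hτ ⟨ha, t1, t2, t3⟩
  refine Within.seq 4 3
    (fun τ => Agree 30 υ τ ∧ τ.reg 30 = y + 1 ∧ τ.reg 32 = if (y + 1).Prime then 1 else 0)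
    (Within.loop (a := 3) (d := 0) (N := y - 1)
      (fun M ρ => Agree 30 υ ρ ∧ ρ.reg 30 = y + 1 ∧ ∃ d, ρ.reg 31 = d ∧ 2 ≤ d ∧ d + M = y + 1 ∧
        ρ.reg 32 = if ∀ e, 2 ≤ e → e < d → ¬ e ∣ y + 1 then 1 else 0)
      (by simp [Expr.NoLoad])
      (by simp [Expr.weight]; omega) ?_ ?_ hτ (by omega)
      ⟨ha, t1, 2, t2, le_rfl, by omega, by rw [t3, if_pos]; intro e _ _; omega⟩) ?_
  · rintro M ρ - ⟨r1, r2, d, r3, r4, r5, r6⟩ h0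
    refine ⟨r1, r2, ?_⟩
    rw [r6]
    simp only [Expr.eval, r2, r3, ite_eq_right_iff, one_ne_zero, imp_false, not_lt] at h0
    have hde : d = y + 1 := by omega
    refine if_congr ?_ rfl rfl
    rw [Nat.prime_def_lt', hde]
    constructor
    · exact fun h => ⟨by omega, h⟩
    · exact fun h => h.2
  · rintro M ρ hρ ⟨r1, r2, d, r3, r4, r5, r6⟩ h0
    simp only [Expr.eval, r2, r3, ne_eq, ite_eq_right_iff, one_ne_zero, imp_false, not_not] at h0
    refine ⟨M - 1, by omega, ?_⟩
    have hB32 := hρ 32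
    have hr6 : ρ.reg 32 ≤ 1 := by rw [r6]; split_ifs <;> omega
    refine Within.block _ hρ (by simp) ?_ ?_
    · simp [BlockOk, Expr.NoLoad, Expr.weight, Expr.eval, r2, r3]
      refine ⟨by omega, ?_, by omega⟩
      split_ifs <;> omega
    · refine ⟨r1.trans (agree_exec 30 _ ρ (by simp)) le_rfl, ?_, d + 1, ?_, by omega, by omega, ?_⟩
      · simp [exec, Expr.eval, r2]
      · simp [exec, Expr.eval, r3]
      · simp only [exec, Expr.eval, Store.setReg_reg, r2, r3, r6]
        by_cases hdiv : d ∣ y + 1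
        · have h1 : ¬ 0 < (y + 1) % d := by rw [Nat.mod_eq_zero_of_dvd hdiv]; omega
          have h2 : ¬ ∀ e, 2 ≤ e → e < d + 1 → ¬ e ∣ y + 1 := fun h => h d r4 (by omega) hdiv
          rw [if_neg h1, if_neg h2, mul_zero]
          simp
        · have h1 : 0 < (y + 1) % d := Nat.pos_of_ne_zero fun h => hdiv (Nat.dvd_of_mod_eq_zero h)
          have h2 : (∀ e, 2 ≤ e → e < d + 1 → ¬ e ∣ y + 1) ↔
              ∀ e, 2 ≤ e → e < d → ¬ e ∣ y + 1 := by
            constructor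
            · exact fun h e he1 he2 => h e he1 (by omega)
            · intro h e he1 he2
              rcases Nat.lt_succ_iff_lt_or_eq.1 he2 with h' | h'
              · exact h e he1 h'
              · rwa [h']
          rw [if_pos h1, mul_one]
          exact (if_congr h2 rfl rfl).symm
  rintro ρ hρ ⟨r1, r2, r3⟩
  have hag : Agree dst σ ρ := h1.trans r1 hdst.le
  have hdv : ρ.reg dst = υ.reg dst := r1.1 dst hdst
  have hp : ¬ (y + 1).Prime → ∀ p, N < p → p ≤ y + 1 → (∀ p, N < p → p ≤ y → ¬ p.Prime) →
      ¬ p.Prime := by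
    intro h p hp1 hp2 hp3
    rcases Nat.le_succ_iff.1 hp2 with h' | h'
    · exact hp3 p hp1 h'
    · rwa [h']
  refine Within.cond (a := 2) hρ trivial (by simp [Expr.weight]; omega) ?_ ?_
  · intro hc
    have hpr : (y + 1).Prime := by
      by_contra h
      exact hc (by rw [Expr.eval, r3, if_neg h])
    refine Within.block _ hρ (by simp) ?_ ⟨y + 1, ⟨hag.trans (agree_exec dst _ ρ (by simp)) le_rfl,
      Or.inr ?_⟩, ?_, by omega, by omega⟩
    · simp [BlockOk, Expr.NoLoad, Expr.weight, Expr.eval, r2]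
      omega
    · simp only [exec, Expr.eval, Store.setReg_reg, if_pos, r2]
      exact ⟨hpr, by omega, by omega⟩
    · simp [exec, Expr.eval, hd', r2]
  · intro hc
    have hpr : ¬ (y + 1).Prime := by
      intro h
      rw [Expr.eval, r3, if_pos h] at hc
      exact one_ne_zero hc
    refine Within.block _ hρ (by simp) trivial ⟨y + 1, ⟨hag, ?_⟩, r2, by omega, by omega⟩
    rw [exec, hdv]
    exact h2.imp (fun h => ⟨h.1, fun p h3 h4 => hp hpr p h3 h4 h.2⟩) id

/-! ### The program that lists the points -/

/-- The program that runs `X` for all pairs `(s, i)` with `s < N` and `i < n`, in registers `16` and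
`17`, and collects the values of register `34` in array `0`. The numbers `n` and `N` stand in
registers `0` and `15`. -/
def outProg (X : Prog) : Prog :=
  .seq (block [(16, .const 0)])
    (.seq
      (.loop (.lt (.var 16) (.var 15))
        (.seq (block [(17, .const 0)])
          (.seq
            (.loop (.lt (.var 17) (.var 0))
              (.seq X
                (.seq (.store 0 (.add (.mul (.var 16) (.var 0)) (.var 17)) (.var 34))
                  (block [(17, .add (.var 17) (.const 1))]))))
            (block [(16, .add (.var 16) (.const 1))]))))
      (block [(0, .var 15)]))

lemma Within.store {B w a d : ℕ} {A : ℕ} {i e : Expr} {σ : Store} {Φ : Store → Prop}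
    (hσ : σ.Bounded B) (ha : 2 ≤ a) (hi : i.NoLoad) (hiw : i.weight ≤ w) (he : e.NoLoad)
    (hew : e.weight ≤ w) (hΦ : Φ (σ.setArr A (i.eval σ) (e.eval σ))) :
    Within B w a d (.store A i e) σ Φ := by
  refine ⟨_, _, Run.store σ A i e, ?_, hσ, hΦ⟩
  have h1 := Expr.cost_le hσ hi hiw
  have h2 := Expr.cost_le hσ he hew
  have h3 : unitCost B w ≤ (B + 1) ^ d * unitCost B w := Nat.le_mul_of_pos_left _ (by positivity)
  have h4 := Nat.mul_le_mul_right ((B + 1) ^ d * unitCost B w) ha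
  omega

/-- The list is complete if `X` computes `f`: the array is filled in the order of the pairs, and the
entry of `(s, i)` has index `s n + i`, which no later pair overwrites. -/
lemma within_outProg {B w a d n N : ℕ} {X : Prog} {f : ℕ → ℕ → ℕ} {σ : Store}
    (hσ : σ.Bounded B) (hw : 10 ≤ w) (hn : σ.reg 0 = n) (hN : σ.reg 15 = N)
    (hX : ∀ τ, τ.Bounded B → (∀ x < 16, τ.reg x = σ.reg x) → τ.reg 16 < N → τ.reg 17 < n →
      Within B w a d X τ fun υ => Agree 18 τ υ ∧ υ.reg 34 = f (τ.reg 16) (τ.reg 17)) :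
    Within B w (a + 14) (d + 2) (outProg X) σ fun τ =>
      τ.reg 0 = N ∧ ∀ s < N, ∀ i < n, τ.arr 0 (s * n + i) = f s i := by
  have hnB : n ≤ B := hn ▸ hσ 0
  have hNB : N ≤ B := hN ▸ hσ 15
  have hassign : ∀ {r k : ℕ} {d : ℕ} {τ : Store}, τ.Bounded B → k = 0 →
      Within B w 2 d (block [(r, .const k)]) τ fun υ => Agree r τ υ ∧ υ.reg r = 0 := by
    rintro r k d τ hτ rfl
    refine Within.block _ hτ (by simp) ?_ ⟨agree_exec r _ τ (by simp), ?_⟩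
    · simp [BlockOk, Expr.NoLoad, Expr.weight, Expr.eval]
      omega
    · simp [exec, Expr.eval]
  have hsucc : ∀ {r d : ℕ} {τ : Store}, τ.Bounded B → τ.reg r < B →
      Within B w 2 d (block [(r, .add (.var r) (.const 1))]) τ
        fun υ => Agree r τ υ ∧ υ.reg r = τ.reg r + 1 := by
    intro r d τ hτ hr
    refine Within.block _ hτ (by simp) ?_ ⟨agree_exec r _ τ (by simp), ?_⟩
    · simp [BlockOk, Expr.NoLoad, Expr.weight, Expr.eval]
      omega
    · simp [exec, Expr.eval]
  refine (Within.seq 2 (2 + (a + 5 + 2) + 1 + 2) _ (hassign hσ rfl) ?_).mono (by omega) le_rfl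
    fun _ _ h => h
  rintro τ hτ ⟨h1, h2⟩
  refine Within.seq (2 + (a + 5 + 2) + 1) 2 (fun τ => (∀ x < 16, τ.reg x = σ.reg x) ∧
    ∀ s < N, ∀ i < n, τ.arr 0 (s * n + i) = f s i) ?_ ?_
  · refine Within.loop (a := 2 + (a + 5 + 2)) (d := d + 1) (N := N)
      (fun M τ => (∀ x < 16, τ.reg x = σ.reg x) ∧ τ.reg 16 + M = N ∧
        ∀ s < τ.reg 16, ∀ i < n, τ.arr 0 (s * n + i) = f s i) (by simp [Expr.NoLoad])
      (by simp [Expr.weight]; omega) ?_ ?_ hτ hNB ⟨h1.1, by omega, by simp [h2]⟩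
    · rintro M υ - ⟨u1, u2, u3⟩ h0
      have hυN : υ.reg 15 = N := (u1 15 (by omega)).trans hN
      refine ⟨u1, fun s hs => u3 s ?_⟩
      simp only [Expr.eval, hυN, ite_eq_right_iff, one_ne_zero, imp_false, not_lt] at h0
      omega
    · rintro M υ hυ ⟨u1, u2, u3⟩ h0
      have hυN : υ.reg 15 = N := (u1 15 (by omega)).trans hN
      simp only [Expr.eval, hυN, ne_eq, ite_eq_right_iff, one_ne_zero, imp_false, not_not] at h0
      refine ⟨M - 1, by omega, ?_⟩
      refine Within.seq 2 (a + 5 + 2) _ (hassign hυ rfl) ?_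
      rintro ρ hρ ⟨r1, r2⟩
      set s := υ.reg 16 with hs
      -- the invariant of the inner loop: the entries before `(s, i)` are in place
      let V : ℕ → Store → Prop := fun M τ => (∀ x < 17, τ.reg x = υ.reg x) ∧ τ.reg 17 + M = n ∧
        (∀ s' < s, ∀ i < n, τ.arr 0 (s' * n + i) = f s' i) ∧
        ∀ i < τ.reg 17, τ.arr 0 (s * n + i) = f s i
      refine Within.seq (a + 5) 2 (V 0) (Within.loop (N := n)
        (a := a + 4) (d := d) V (by simp [Expr.NoLoad]) (by simp [Expr.weight]; omega)
        ?_ ?_ hρ hnB ?_) ?_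
      · rintro M τ - ⟨t1, t2, t3, t4⟩ h0
        have hτn : τ.reg 0 = n := (t1 0 (by omega)).trans ((u1 0 (by omega)).trans hn)
        simp only [Expr.eval, hτn, ite_eq_right_iff, one_ne_zero, imp_false, not_lt] at h0
        exact ⟨t1, by omega, t3, t4⟩
      · rintro M τ hτ ⟨t1, t2, t3, t4⟩ h0
        have hτn : τ.reg 0 = n := (t1 0 (by omega)).trans ((u1 0 (by omega)).trans hn)
        have hτs : τ.reg 16 = s := t1 16 (by omega)
        simp only [Expr.eval, hτn, ne_eq, ite_eq_right_iff, one_ne_zero, imp_false, not_not] at h0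
        refine ⟨M - 1, by omega, ?_⟩
        set i := τ.reg 17 with hi
        refine Within.seq a 4 _ (hX τ hτ (fun x hx => (t1 x (by omega)).trans (u1 x hx))
          (by omega) (by omega)) ?_
        rintro π hπ ⟨p1, p2⟩
        have hπs : π.reg 16 = s := (p1.1 16 (by omega)).trans hτs
        have hπn : π.reg 0 = n := (p1.1 0 (by omega)).trans hτn
        have hπi : π.reg 17 = i := p1.1 17 (by omega)
        refine Within.seq 2 2 (fun ω => ω.reg = π.reg ∧ ∀ k, ω.arr 0 k =
          if k = s * n + i then f s i else τ.arr 0 k) (Within.store hπ le_rfl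
            (by simp [Expr.NoLoad]) (by simp [Expr.weight]; omega) (by simp [Expr.NoLoad])
            (by simp [Expr.weight]; omega) ⟨rfl, fun k => ?_⟩) ?_
        · simp [Store.setArr, Expr.eval, Function.update_apply, hπs, hπn, hπi, p2, hτs, p1.2]
          rfl
        rintro ω hω ⟨o1, o2⟩
        have hωi : ω.reg 17 = i := by rw [o1, hπi]
        refine (hsucc hω (by omega)).mono le_rfl le_rfl ?_
        rintro α - ⟨a1, a2⟩
        refine ⟨fun x hx => ?_, by omega, fun s' hs' j hj => ?_, fun j hj => ?_⟩
        · rw [a1.1 x hx, o1, p1.1 x (by omega), t1 x hx]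
        · have h5 : s' * n + n ≤ s * n := by
            rw [← Nat.succ_mul]
            exact Nat.mul_le_mul_right n hs'
          rw [a1.2, o2, if_neg (by omega), t3 s' hs' j hj]
        · rw [a1.2, o2]
          split_ifs with h6
          · rw [show j = i by omega]
          · exact t4 j (by omega)
      · exact ⟨r1.1, by omega, fun s' hs' j hj => by rw [r1.2]; exact u3 s' hs' j hj, by simp [r2]⟩
      · rintro τ hτ ⟨t1, t2, t3, t4⟩
        have hτs : τ.reg 16 = s := t1 16 (by omega)
        refine (hsucc hτ (by omega)).mono le_rfl le_rfl ?_
        rintro α - ⟨a1, a2⟩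
        refine ⟨fun x hx => ?_, by omega, fun s' hs' j hj => ?_⟩
        · rw [a1.1 x hx, t1 x (by omega), u1 x hx]
        · rw [a1.2]
          rcases Nat.lt_or_ge s' s with h7 | h7
          · exact t3 s' h7 j hj
          · rw [show s' = s by omega]
            exact t4 j (by omega)
  · rintro τ hτ ⟨h1, h2⟩
    have hτN : τ.reg 15 = N := (h1 15 (by omega)).trans hN
    refine Within.block _ hτ (by simp) ?_ ⟨?_, ?_⟩
    · simp [BlockOk, Expr.NoLoad, Expr.weight, Expr.eval, hτN, hNB]
      omega
    · simp [exec, Expr.eval, hτN]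
    · exact h2

/-! ### The program for one coordinate of a seed's point -/

/-- The expression with value `1` if `e` and `f` have the same value, and `0` otherwise. -/
def eqExpr (e f : Expr) : Expr := .sub (.const 1) (.add (.lt e f) (.lt f e))

lemma eval_eqExpr (σ : Store) (e f : Expr) :
    (eqExpr e f).eval σ = if e.eval σ = f.eval σ then 1 else 0 := by
  simp only [eqExpr, Expr.eval]
  split_ifs <;> omega

/-- The bucket of the number in register `18`, for the digits in register `24` and the marks in
register `19`; the number of levels is given by the power of two in register `26`, and the bucket is
put into register `27`. -/
def bucketProg : Prog :=
  .loop (.var 26)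
    (.seq
      (block [(28, .add (.mul (.const 48) (.var 26))
          (.mod (.mod (.mul (.mod (.var 24) (.var 6)) (.var 18)) (.var 6))
            (.mul (.const 48) (.var 26)))),
        (29, .var 19), (30, .var 28)])
      (.seq
        (.loop (.var 30)
          (block [(29, .div (.var 29) (.const 2)), (30, .sub (.var 30) (.const 1))]))
        (.cond (.mod (.var 29) (.const 2))
          (block [(26, .div (.var 26) (.const 2)), (24, .div (.var 24) (.var 6))])
          (block [(27, .var 28), (26, .const 0)]))))

lemma within_bucketProg {B w l q F W x : ℕ} {σ : Store} (hσ : σ.Bounded B) (hw : 200 ≤ w)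
    (hq : σ.reg 6 = q) (hx : σ.reg 18 = x) (hF : σ.reg 19 = F) (hW : σ.reg 24 = W)
    (hD : σ.reg 26 = 2 ^ l) (hb : σ.reg 27 = 0) (hB : 96 * 2 ^ l ≤ B) :
    Within B w 13 2 bucketProg σ fun τ => Agree 24 σ τ ∧
      τ.reg 27 = bucketOf q F.testBit (l + 1) W x := by
  set b := bucketOf q F.testBit (l + 1) W x with hbdef
  have hl : l < 2 ^ l := Nat.lt_two_pow_self
  refine Within.loop (a := 12) (d := 1) (N := l + 1) (fun N τ => Agree 24 σ τ ∧
    ((N ≤ l + 1 ∧ τ.reg 26 = 2 ^ N / 2 ∧ τ.reg 27 = 0 ∧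
      bucketOf q F.testBit N (τ.reg 24) x = b) ∨ (τ.reg 26 = 0 ∧ τ.reg 27 = b)))
    (by simp [Expr.NoLoad]) (by simp [Expr.weight]; omega) ?_ ?_ hσ (by omega)
    ⟨Agree.refl _ _, Or.inl ⟨le_rfl, by rw [hD, pow_succ]; simp, hb, by rw [hW]⟩⟩
  · rintro N τ - ⟨h1, h2⟩ h0
    refine ⟨h1, ?_⟩
    rcases h2 with ⟨-, h2, h3, h4⟩ | ⟨-, h2⟩
    · rw [Expr.eval, h2] at h0
      cases N with
      | zero => rw [h3, ← h4, bucketOf]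
      | succ N =>
        rw [pow_succ, Nat.mul_div_cancel _ (by norm_num)] at h0
        exact absurd h0 (by positivity)
    · exact h2
  · rintro N τ hτ ⟨h1, h2⟩ h0
    rw [Expr.eval] at h0
    rcases h2 with ⟨hN, h2, h3, h4⟩ | ⟨h2, -⟩
    swap
    · exact absurd h2 h0
    cases N with
    | zero => exact absurd h2 h0
    | succ N =>
    refine ⟨N, rfl, ?_⟩
    rw [pow_succ, Nat.mul_div_cancel _ (by norm_num)] at h2
    have hN2 : 2 ^ N ≤ 2 ^ l := Nat.pow_le_pow_right (by norm_num) (by omega)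
    have e1 : τ.reg 6 = q := (h1.1 6 (by omega)).trans hq
    have e2 : τ.reg 18 = x := (h1.1 18 (by omega)).trans hx
    have e3 : τ.reg 19 = F := (h1.1 19 (by omega)).trans hF
    set W' := τ.reg 24 with hW'
    set t := 48 * 2 ^ N + W' % q * x % q % (48 * 2 ^ N) with ht
    have ht' : t < 96 * 2 ^ N := by
      have := Nat.mod_lt (W' % q * x % q) (show 0 < 48 * 2 ^ N by positivity)
      omega
    have hb' : b = if F.testBit t then bucketOf q F.testBit N (W' / q) x else t := by
      rw [← h4, bucketOf]
    refine Within.seq 4 8 (fun υ => Agree 28 τ υ ∧ υ.reg 28 = t ∧ υ.reg 29 = F ∧ υ.reg 30 = t)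
      (Within.block _ hτ (by simp) ?_ ⟨agree_exec 28 _ τ (by simp), ?_⟩) ?_
    · have := hF ▸ hσ 19
      simp [BlockOk, Expr.NoLoad, Expr.weight, Expr.eval, e1, e2, e3, h2, ← hW', ← ht, -Nat.mod_mul_mod]
      omega
    · simp [exec, Expr.eval, e1, e2, e3, h2, ← hW', ht]
    rintro υ hυ ⟨u1, u2, u3, u4⟩
    refine Within.seq 4 4 (fun υ => Agree 28 τ υ ∧ υ.reg 28 = t ∧ υ.reg 29 = F / 2 ^ t)
      (Within.loop (a := 3) (d := 0) (N := t) (fun M υ => Agree 28 τ υ ∧ υ.reg 28 = t ∧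
        υ.reg 30 = M ∧ υ.reg 29 / 2 ^ M = F / 2 ^ t) (by simp [Expr.NoLoad])
        (by simp [Expr.weight]; omega) ?_ ?_ hυ (by omega) ⟨u1, u2, u4, by rw [u3]⟩) ?_
    · rintro M ρ - ⟨r1, r2, r3, r4⟩ h0
      rw [Expr.eval, r3] at h0
      subst h0
      exact ⟨r1, r2, by simpa using r4⟩
    · rintro M ρ hρ ⟨r1, r2, r3, r4⟩ h0
      rw [Expr.eval, r3] at h0
      obtain ⟨M, rfl⟩ := Nat.exists_eq_succ_of_ne_zero h0
      refine ⟨M, rfl, Within.block _ hρ (by simp) ?_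
        ⟨r1.trans (agree_exec 28 _ ρ (by simp)) le_rfl, ?_, ?_, ?_⟩⟩
      · have := hρ 29
        have := hρ 30
        simp [BlockOk, Expr.NoLoad, Expr.weight, Expr.eval]
        omega
      · simp [exec, r2]
      · simp [exec, Expr.eval, r3]
      · simp only [exec, Expr.eval, Store.setReg_reg]
        rw [if_neg (by norm_num), if_pos trivial, Nat.div_div_eq_div_mul, ← pow_succ']
        exact r4
    · rintro ρ hρ ⟨r1, r2, r3⟩
      have f1 : ρ.reg 6 = q := (r1.1 6 (by omega)).trans e1
      have f2 : ρ.reg 26 = 2 ^ N := (r1.1 26 (by omega)).trans h2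
      have f3 : ρ.reg 24 = W' := r1.1 24 (by omega)
      have f4 : ρ.reg 27 = 0 := (r1.1 27 (by omega)).trans h3
      have hag : Agree 24 σ ρ := h1.trans r1 (by norm_num)
      refine Within.cond (a := 3) hρ (by simp [Expr.NoLoad]) (by simp [Expr.weight]; omega)
        ?_ ?_
      · intro hc
        have hbit : F.testBit t = true := by
          rw [Nat.testBit_eq_decide_div_mod_eq, decide_eq_true_eq]
          simp only [Expr.eval, r3] at hc
          omega
        refine Within.block _ hρ (by simp) ?_ ⟨hag.trans (agree_exec 24 _ ρ (by simp)) le_rfl,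
          Or.inl ⟨by omega, ?_, ?_, ?_⟩⟩
        · have h5 := Nat.div_le_self (2 ^ N) 2
          have h6 := (Nat.div_le_self W' q).trans (hτ 24)
          simp [BlockOk, Expr.NoLoad, Expr.weight, Expr.eval, f1, f2, f3]
          omega
        · simp [exec, Expr.eval, f2]
        · simp [exec, f4]
        · rw [hb', if_pos hbit]
          simp [exec, Expr.eval, f1, f3]
      · intro hc
        have hbit : F.testBit t = false := by
          rw [Nat.testBit_eq_decide_div_mod_eq, decide_eq_false_iff_not]
          simp only [Expr.eval, r3] at hc
          omega
        refine Within.block _ hρ (by simp) ?_ ⟨hag.trans (agree_exec 24 _ ρ (by simp)) le_rfl,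
          Or.inr ⟨?_, ?_⟩⟩
        · simp [BlockOk, Expr.NoLoad, Expr.weight, Expr.eval, r2]
          omega
        · simp [exec, Expr.eval]
        · rw [hb', if_neg (by simp [hbit])]
          simp [exec, Expr.eval, r2]

/-- Register `31` gets the number of binary digits of the number in register `20` that have to be
read until more ones have been seen than the value of register `27`; at most as many digits are read
as register `10` says. -/
def selectProg : Prog :=
  .seq (block [(25, .add (.var 27) (.const 1)), (28, .var 20), (31, .const 0), (32, .var 10)])
    (.loop (.var 32)
      (block [(31, .add (.var 31) (.lt (.const 0) (.var 25))),
        (25, .sub (.var 25) (.mod (.var 28) (.const 2))), (28, .div (.var 28) (.const 2)),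
        (32, .sub (.var 32) (.const 1))]))

lemma within_selectProg {B w H Z b : ℕ} {σ : Store} (hσ : σ.Bounded B) (hw : 200 ≤ w)
    (hH : σ.reg 10 = H) (hZ : σ.reg 20 = Z) (hb : σ.reg 27 = b) (hbB : b < B) :
    Within B w 11 1 selectProg σ fun τ => Agree 24 σ τ ∧ τ.reg 31 = onePos H Z (b + 1) := by
  have hHB : H ≤ B := hH ▸ hσ 10
  have hZB : Z ≤ B := hZ ▸ hσ 20
  refine Within.seq 5 6 (fun τ => Agree 24 σ τ ∧ τ.reg 25 = b + 1 ∧ τ.reg 28 = Z ∧ τ.reg 31 = 0 ∧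
    τ.reg 32 = H) (Within.block _ hσ (by simp) ?_ ⟨agree_exec 24 _ σ (by simp), ?_⟩) ?_
  · simp [BlockOk, Expr.NoLoad, Expr.weight, Expr.eval, hH, hZ, hb]
    omega
  · simp [exec, Expr.eval, hH, hZ, hb]
  rintro τ hτ ⟨t1, t2, t3, t4, t5⟩
  refine Within.loop (a := 5) (d := 0) (N := H) (fun N τ => Agree 24 σ τ ∧ τ.reg 32 = N ∧
    τ.reg 31 + onePos N (τ.reg 28) (τ.reg 25) = onePos H Z (b + 1)) (by simp [Expr.NoLoad])
    (by simp [Expr.weight]; omega) ?_ ?_ hτ hHB ⟨t1, t5, by rw [t2, t3, t4, zero_add]⟩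
  · rintro N υ - ⟨u1, u2, u3⟩ h0
    rw [Expr.eval, u2] at h0
    subst h0
    exact ⟨u1, by simpa [onePos] using u3⟩
  · rintro N υ hυ ⟨u1, u2, u3⟩ h0
    rw [Expr.eval, u2] at h0
    obtain ⟨N, rfl⟩ := Nat.exists_eq_succ_of_ne_zero h0
    have hle := onePos_le H Z (b + 1)
    have h25 := hυ 25
    have h28 := hυ 28
    have h32 := u2 ▸ hυ 32
    rw [Nat.succ_eq_add_one, onePos] at u3
    refine ⟨N, rfl, Within.block _ hυ (by simp) ?_ ⟨u1.trans (agree_exec 24 _ υ (by simp)) le_rfl,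
      ?_, ?_⟩⟩
    · by_cases hc : 0 < υ.reg 25 <;> simp only [hc, if_true, if_false] at u3 <;>
        simp [BlockOk, Expr.NoLoad, Expr.weight, Expr.eval, u2, hc] <;> omega
    · simp [exec, Expr.eval, u2]
    · by_cases hc : 0 < υ.reg 25 <;> simp only [hc, if_true, if_false] at u3 <;>
        simpa [exec, Expr.eval, add_assoc, hc] using u3

/-- The walk on the torus that starts at the point in registers `21, 22` and makes the moves given
by the digits of register `23` to the base `5`. Register `8` holds the modulus, and the product of
registers `11` and `31` is the number of moves. -/
def walkProg : Prog :=
  .seq (block [(32, .mul (.var 11) (.var 31))])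
    (.loop (.var 32)
      (block [(25, .mod (.var 23) (.const 5)),
        (26, .mod (.add (.var 21) (.add (eqExpr (.var 25) (.const 1))
          (.mul (.var 22) (eqExpr (.var 25) (.const 3))))) (.var 8)),
        (22, .mod (.add (.var 22) (.add (eqExpr (.var 25) (.const 2))
          (.mul (.var 21) (eqExpr (.var 25) (.const 4))))) (.var 8)),
        (21, .var 26), (23, .div (.var 23) (.const 5)), (32, .sub (.var 32) (.const 1))]))

lemma torusStep_natCast (Q d y₁ y₂ : ℕ) :
    torusStep d ((y₁ : ZMod Q), (y₂ : ZMod Q)) =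
      ((((y₁ + ((if d = 1 then 1 else 0) + y₂ * if d = 3 then 1 else 0)) % Q : ℕ) : ZMod Q),
        (((y₂ + ((if d = 2 then 1 else 0) + y₁ * if d = 4 then 1 else 0)) % Q : ℕ) : ZMod Q)) := by
  match d with
  | 0 => simp [torusStep]
  | 1 => simp [torusStep]
  | 2 => simp [torusStep]
  | 3 => simp [torusStep]
  | 4 => simp [torusStep]
  | d + 5 => simp [torusStep]

lemma within_walkProg {B w Q u e y₁ y₂ G : ℕ} {σ : Store} (hσ : σ.Bounded B) (hw : 200 ≤ w)
    (hQ : σ.reg 8 = Q) (hQ0 : 0 < Q) (hu : σ.reg 11 = u) (he : σ.reg 31 = e) (hy₁ : σ.reg 21 = y₁)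
    (hy₂ : σ.reg 22 = y₂) (hG : σ.reg 23 = G) (hB : u * e ≤ B) :
    Within B w 10 1 walkProg σ fun τ => Agree 21 σ τ ∧
      torusPos G (u * e) ((y₁ : ZMod Q), (y₂ : ZMod Q)) =
        ((τ.reg 21 : ZMod Q), (τ.reg 22 : ZMod Q)) := by
  have hQB : Q ≤ B := hQ ▸ hσ 8
  refine Within.seq 2 8 (fun τ => Agree 24 σ τ ∧ τ.reg 32 = u * e)
    (Within.block _ hσ (by simp) ?_ ⟨agree_exec 24 _ σ (by simp), ?_⟩) ?_
  · simp [BlockOk, Expr.NoLoad, Expr.weight, Expr.eval, hu, he, hB]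
    omega
  · simp [exec, Expr.eval, hu, he]
  rintro τ hτ ⟨t1, t2⟩
  refine Within.loop (a := 7) (d := 0) (N := u * e) (fun N τ => Agree 21 σ τ ∧ τ.reg 32 = N ∧
    torusPos (τ.reg 23) N ((τ.reg 21 : ZMod Q), (τ.reg 22 : ZMod Q)) =
      torusPos G (u * e) ((y₁ : ZMod Q), (y₂ : ZMod Q))) (by simp [Expr.NoLoad])
    (by simp [Expr.weight]; omega) ?_ ?_ hτ hB ⟨(Agree.refl 21 σ).trans t1 (by norm_num), t2, by
      rw [t1.1 21 (by omega), t1.1 22 (by omega), t1.1 23 (by omega), hy₁, hy₂, hG]⟩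
  · rintro N υ - ⟨u1, u2, u3⟩ h0
    rw [Expr.eval, u2] at h0
    subst h0
    exact ⟨u1, u3.symm⟩
  · rintro N υ hυ ⟨u1, u2, u3⟩ h0
    rw [Expr.eval, u2] at h0
    obtain ⟨N, rfl⟩ := Nat.exists_eq_succ_of_ne_zero h0
    have hυQ : υ.reg 8 = Q := (u1.1 8 (by omega)).trans hQ
    have hmod : ∀ x, x % Q ≤ B := fun x => (Nat.mod_lt x hQ0).le.trans hQB
    have h23 := hυ 23
    have hd5 := (Nat.div_le_self (υ.reg 23) 5).trans h23
    have hm5 := (Nat.mod_le (υ.reg 23) 5).trans h23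
    have hN := u2 ▸ hυ 32
    refine ⟨N, rfl, Within.block _ hυ (by simp) ?_ ⟨u1.trans (agree_exec 21 _ υ (by simp)) le_rfl,
      ?_, ?_⟩⟩
    · simp [BlockOk, Expr.NoLoad, Expr.weight, eqExpr]
      simp [Expr.eval, u2, hυQ, hmod, hd5, hm5]
      omega
    · simp [exec, Expr.eval, u2]
    · rw [← u3, Nat.succ_eq_add_one, torusPos, torusStep_natCast]
      simp [exec, eval_eqExpr, Expr.eval, hυQ]

/-- Register `34` gets the coordinate with the number in register `17` of the point whose seed stands
in register `16`. The parameters of the seeds stand in the registers below `16`, as `paramProg`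
leaves them; the components of the seed go to registers `18, …, 24`. -/
def coordProg : Prog :=
  .seq
    (block [(18, .mod (.var 16) (.var 8)), (33, .div (.var 16) (.var 8)),
      (24, .mod (.var 33) (.var 12)), (33, .div (.var 33) (.var 12)),
      (19, .mod (.var 33) (.var 13)), (33, .div (.var 33) (.var 13)),
      (20, .mod (.var 33) (.var 14)), (33, .div (.var 33) (.var 14)),
      (21, .mod (.var 33) (.var 8)), (33, .div (.var 33) (.var 8)),
      (22, .mod (.var 33) (.var 8)), (23, .div (.var 33) (.var 8)),
      (18, .mod (.mod (.mul (.var 18) (.var 17)) (.var 8)) (.var 5)),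
      (26, .var 3), (27, .const 0)])
    (.seq bucketProg (.seq selectProg (.seq walkProg
      (block [(34, .mod (.mod (.add (.var 21) (.mul (.var 17) (.var 22))) (.var 8)) (.var 1))]))))

lemma within_coordProg {B w n m q Q U l H u nW nF nZ s : ℕ} (hm : 0 < m) (hQ0 : 0 < Q) {σ : Store}
    (i : Fin n) (hσ : σ.Bounded B) (hw : 200 ≤ w) (h1 : σ.reg 1 = m) (h3 : σ.reg 3 = 2 ^ l)
    (h5 : σ.reg 5 = U) (h6 : σ.reg 6 = q) (h8 : σ.reg 8 = Q) (h10 : σ.reg 10 = H)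
    (h11 : σ.reg 11 = u) (h12 : σ.reg 12 = nW) (h13 : σ.reg 13 = nF) (h14 : σ.reg 14 = nZ)
    (h16 : σ.reg 16 = s) (h17 : σ.reg 17 = i) (hU : 0 < U) (hl : 96 * 2 ^ l ≤ B)
    (hB : u * H ≤ B) :
    Within B w 52 2 coordProg σ fun τ => Agree 18 σ τ ∧
      τ.reg 34 = seedPoint (Q := Q) hm q U l H u nW nF nZ n s i := by
  have hmod : ∀ {x y}, x ≤ B → x % y ≤ B := fun h => (Nat.mod_le _ _).trans h
  have hdiv : ∀ {x y}, x ≤ B → x / y ≤ B := fun h => (Nat.div_le_self _ _).trans h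
  have hmodU : ∀ {x}, x % U ≤ B := fun {x} =>
    (Nat.mod_lt x hU).le.trans (h5 ▸ hσ 5)
  have hsB : s ≤ B := h16 ▸ hσ 16
  have hRB : 2 ^ l ≤ B := h3 ▸ hσ 3
  have hmB : m ≤ B := h1 ▸ hσ 1
  set b := bucketOf q (s / Q / nW % nF).testBit (l + 1) (s / Q % nW) (s % Q * i % Q % U) with hb
  set e := onePos H (s / Q / nW / nF % nZ) (b + 1) with he
  have hbB : b < B := by
    have := bucketOf_lt q (s / Q / nW % nF).testBit (l + 1) (s / Q % nW) (s % Q * i % Q % U)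
    rw [pow_succ] at this
    omega
  refine (Within.seq 16 (13 + (11 + (10 + 2))) (fun τ => Agree 18 σ τ ∧
    τ.reg 18 = s % Q * i % Q % U ∧ τ.reg 19 = s / Q / nW % nF ∧
    τ.reg 20 = s / Q / nW / nF % nZ ∧ τ.reg 21 = s / Q / nW / nF / nZ % Q ∧
    τ.reg 22 = s / Q / nW / nF / nZ / Q % Q ∧ τ.reg 23 = s / Q / nW / nF / nZ / Q / Q ∧
    τ.reg 24 = s / Q % nW ∧ τ.reg 26 = 2 ^ l ∧ τ.reg 27 = 0)
    (Within.block _ hσ (by simp) ?_ ⟨agree_exec 18 _ σ (by simp), ?_⟩) ?_).mono le_rfl le_rfl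
    fun _ _ h => h
  · simp (maxDischargeDepth := 12) [BlockOk, Expr.NoLoad, Expr.weight, Expr.eval, h3, h5, h8, h12,
      h13, h14, h16, h17, hmod,
      hdiv, hmodU, hsB, hRB]
    omega
  · simp [exec, Expr.eval, h3, h5, h8, h12, h13, h14, h16, h17, -Nat.mod_mul_mod]
  rintro τ hτ ⟨t0, t18, t19, t20, t21, t22, t23, t24, t26, t27⟩
  refine Within.seq 13 _ _ (within_bucketProg hτ hw ((t0.1 6 (by omega)).trans h6) t18 t19 t24 t26
    t27 hl) ?_
  rintro υ hυ ⟨u0, u27⟩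
  rw [← hb] at u27
  have u1 := t0.trans u0 (by norm_num)
  refine Within.seq 11 _ _ ((within_selectProg hυ hw ((u1.1 10 (by omega)).trans h10)
    ((u0.1 20 (by omega)).trans t20) u27 hbB).mono le_rfl (by norm_num) fun _ _ h => h) ?_
  rintro ρ hρ ⟨r0, r31⟩
  rw [← he] at r31
  have r1 := u0.trans r0 le_rfl
  have r2 := t0.trans r1 (by norm_num)
  have heH : u * e ≤ B := (Nat.mul_le_mul_left u (onePos_le _ _ _)).trans hB
  refine Within.seq 10 _ _ ((within_walkProg hρ hw ((r2.1 8 (by omega)).trans h8) hQ0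
    ((r2.1 11 (by omega)).trans h11) r31 ((r1.1 21 (by omega)).trans t21)
    ((r1.1 22 (by omega)).trans t22) ((r1.1 23 (by omega)).trans t23) heH).mono le_rfl (by norm_num)
    fun _ _ h => h) ?_
  rintro π hπ ⟨p0, p1⟩
  have p2 := r2.trans p0 (by norm_num)
  have e1 : π.reg 1 = m := (p2.1 1 (by omega)).trans h1
  have e8 : π.reg 8 = Q := (p2.1 8 (by omega)).trans h8
  have e17 : π.reg 17 = i := (p2.1 17 (by omega)).trans h17
  refine Within.block _ hπ (by simp) ?_ ⟨p2.trans (agree_exec 18 _ π (by simp)) le_rfl, ?_⟩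
  · have h := (Nat.mod_lt ((π.reg 21 + i * π.reg 22) % Q) hm).le.trans hmB
    simp [BlockOk, Expr.NoLoad, Expr.weight, Expr.eval, e1, e8, e17, h]
    omega
  · have hval : seedPoint (Q := Q) hm q U l H u nW nF nZ n s i =
        torusValue hm i (torusPos (s / Q / nW / nF / nZ / Q / Q) (u * e)
          (((s / Q / nW / nF / nZ % Q : ℕ) : ZMod Q),
            ((s / Q / nW / nF / nZ / Q % Q : ℕ) : ZMod Q))) := rfl
    rw [hval, p1, torusValue]
    simp only [exec, Expr.eval, Store.setReg_reg, e1, e8, e17, if_true]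
    rw [← ZMod.val_natCast Q (π.reg 21 + i * π.reg 22)]
    push_cast
    rfl

end RAM

/-- The number of seeds: the product of the ranges of their components. -/
def seedCount (q Q l H u : ℕ) : ℕ :=
  Q * (q ^ (l + 1) * (2 ^ (96 * 2 ^ l) * (2 ^ H * (Q * (Q * 5 ^ (u * H))))))

lemma seedCount_mono {q q' Q Q' : ℕ} (hq : q ≤ q') (hQ : Q ≤ Q') (l H u : ℕ) :
    seedCount q Q l H u ≤ seedCount q' Q' l H u := by
  unfold seedCount
  gcongr

lemma factors_le_of_seedCount_le {q Q l H u B : ℕ} (hq : 0 < q) (hQ : 0 < Q)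
    (h : seedCount q Q l H u ≤ B) :
    Q ≤ B ∧ q ^ (l + 1) ≤ B ∧ 2 ^ (96 * 2 ^ l) ≤ B ∧ 2 ^ H ≤ B ∧ 5 ^ (u * H) ≤ B := by
  have hsplit : ∀ {x y : ℕ}, 0 < x → 0 < y → x * y ≤ B → x ≤ B ∧ y ≤ B := fun hx hy hxy =>
    ⟨(Nat.le_mul_of_pos_right _ hy).trans hxy, (Nat.le_mul_of_pos_left _ hx).trans hxy⟩
  unfold seedCount at h
  obtain ⟨h1, h⟩ := hsplit (by positivity) (by positivity) h
  obtain ⟨h2, h⟩ := hsplit (by positivity) (by positivity) h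
  obtain ⟨h3, h⟩ := hsplit (by positivity) (by positivity) h
  obtain ⟨h4, h⟩ := hsplit (by positivity) (by positivity) h
  obtain ⟨-, h⟩ := hsplit (by positivity) (by positivity) h
  obtain ⟨-, h5⟩ := hsplit (by positivity) (by positivity) h
  exact ⟨h1, h2, h3, h4, h5⟩

namespace RAM

/-! ### The program for the parameters -/

/-- Register `pw` gets the first power of two for which the test `e` fails, and register `cnt` gets
its exponent. -/
def doubleProg (pw cnt : ℕ) (e : Expr) : Prog :=
  .seq (block [(pw, .const 1), (cnt, .const 0)])
    (.loop e (block [(pw, .mul (.const 2) (.var pw)), (cnt, .add (.var cnt) (.const 1))]))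

lemma within_doubleProg {B w r pw cnt l : ℕ} (e : Expr) {σ : Store} (hσ : σ.Bounded B)
    (hw : 200 ≤ w) (hpw : r ≤ pw) (hcnt : r ≤ cnt) (hne : pw ≠ cnt) (he : e.NoLoad)
    (hew : e.weight ≤ w)
    (htest : ∀ τ j, j ≤ l → Agree r σ τ → τ.reg pw = 2 ^ j → (e.eval τ = 0 ↔ l ≤ j))
    (hB : 2 ^ l ≤ B) :
    Within B w 7 1 (doubleProg pw cnt e) σ fun τ =>
      Agree r σ τ ∧ τ.reg pw = 2 ^ l ∧ τ.reg cnt = l := by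
  have hl : l < 2 ^ l := Nat.lt_two_pow_self
  refine Within.seq 3 4 (fun τ => Agree r σ τ ∧ τ.reg pw = 1 ∧ τ.reg cnt = 0)
    (Within.block _ hσ (by simp) ?_ ⟨agree_exec r _ σ (by simp [hpw, hcnt]), ?_⟩) ?_
  · simp [BlockOk, Expr.NoLoad, Expr.weight, Expr.eval]
    omega
  · simp [exec, Expr.eval, hne]
  rintro τ hτ ⟨t1, t2, t3⟩
  refine Within.loop (a := 3) (d := 0) (N := l) (fun N τ => Agree r σ τ ∧ ∃ j, j + N = l ∧
    τ.reg pw = 2 ^ j ∧ τ.reg cnt = j) he hew ?_ ?_ hτ (by omega) ⟨t1, 0, by simp [t2, t3]⟩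
  · rintro N υ - ⟨u1, j, u2, u3, u4⟩ h0
    have := (htest υ j (by omega) u1 u3).1 h0
    obtain rfl : j = l := by omega
    exact ⟨u1, u3, u4⟩
  · rintro N υ hυ ⟨u1, j, u2, u3, u4⟩ h0
    have h5 : ¬ l ≤ j := fun h => h0 ((htest υ j (by omega) u1 u3).2 h)
    have h6 : 2 ^ (j + 1) ≤ 2 ^ l := Nat.pow_le_pow_right (by norm_num) (by omega)
    rw [pow_succ] at h6
    refine ⟨N - 1, by omega, Within.block _ hυ (by simp) ?_
      ⟨u1.trans (agree_exec r _ υ (by simp [hpw, hcnt])) le_rfl, j + 1, by omega, ?_, ?_⟩⟩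
    · simp [BlockOk, Expr.NoLoad, Expr.weight, Expr.eval, u3, u4, hne.symm]
      omega
    · simp [exec, Expr.eval, u3, hne, pow_succ']
    · simp [exec, Expr.eval, u4, hne.symm]

/-- The program that computes the parameters of the seeds. It leaves `R = 2 ^ l`, `l`, `U`, `q`,
`n + 4 m + U`, `Q`, `L`, `H`, `u`, the ranges of the components `W`, `F`, `Z`, and the number of
seeds in registers `3, …, 15`, in this order. -/
def paramProg (C κ : ℕ) : Prog :=
  .seq (doubleProg 3 4 (.sub (.const 1) (.lt (.var 2) (.mul (.var 3) (.var 1)))))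
  (.seq (block [(5, .mul (.const 96) (.mul (.var 3) (.var 3)))])
  (.seq (primeProg 6 5)
  (.seq (block [(7, .add (.add (.var 0) (.mul (.const 4) (.var 1))) (.var 5))])
  (.seq (primeProg 8 7)
  (.seq (doubleProg 30 9 (.lt (.var 30) (.var 0)))
  (.seq (block [(10, .mul (.const 2) (.mul (.const (6 + C)) (.mul (.const 96) (.var 3)))),
    (11, .mul (.const κ) (.add (.const 1) (.div (.var 9) (.var 3))))])
  (.seq (powProg 12 (.var 6) (.add (.var 4) (.const 1)))
  (.seq (powProg 13 (.const 2) (.mul (.const 96) (.var 3)))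
  (.seq (powProg 14 (.const 2) (.var 10))
  (.seq (powProg 15 (.const 5) (.mul (.var 11) (.var 10)))
    (block [(15, .mul (.var 8) (.mul (.var 12) (.mul (.var 13) (.mul (.var 14)
      (.mul (.var 8) (.mul (.var 8) (.var 15)))))))])))))))))))

lemma within_paramProg {B w n m k l L C κ U N₀ H u : ℕ} {σ : Store} (hσ : σ.Bounded B)
    (hw : 200 + C + κ ≤ w) (h0 : σ.reg 0 = n) (h1 : σ.reg 1 = m) (h2 : σ.reg 2 = k) (hn : 0 < n)
    (hl : ∀ j ≤ l, k < 2 ^ j * m ↔ l ≤ j) (hL : ∀ j ≤ L, n ≤ 2 ^ j ↔ L ≤ j)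
    (hU : U = 96 * (2 ^ l) ^ 2) (hN₀ : N₀ = n + 4 * m + U)
    (hH : H = 2 * ((6 + C) * (96 * 2 ^ l))) (hu : u = κ * (1 + L / 2 ^ l))
    (hB : seedCount (2 * U) (2 * N₀) l H u ≤ B) :
    Within B w 81 2 (paramProg C κ) σ fun τ => ∃ q Q, q.Prime ∧ U < q ∧ q ≤ 2 * U ∧ Q.Prime ∧
      N₀ < Q ∧ Q ≤ 2 * N₀ ∧ Agree 3 σ τ ∧ τ.reg 3 = 2 ^ l ∧ τ.reg 5 = U ∧ τ.reg 6 = q ∧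
      τ.reg 8 = Q ∧ τ.reg 10 = H ∧ τ.reg 11 = u ∧ τ.reg 12 = q ^ (l + 1) ∧
      τ.reg 13 = 2 ^ (96 * 2 ^ l) ∧ τ.reg 14 = 2 ^ H ∧ τ.reg 15 = seedCount q Q l H u := by
  have hR : 0 < 2 ^ l := by positivity
  have hRsq : 2 ^ l ≤ (2 ^ l) ^ 2 := Nat.le_self_pow (by norm_num) _
  have hUpos : 0 < U := by rw [hU]; positivity
  obtain ⟨b1, b2, b3, b4, b5⟩ := factors_le_of_seedCount_le (by omega) (by omega) hB
  have hlt : ∀ x : ℕ, x < 2 ^ x := fun x => Nat.lt_two_pow_self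
  have hlR := hlt l
  have hTB : 96 * 2 ^ l ≤ B := (hlt _).le.trans b3
  have hHB : H ≤ B := (hlt _).le.trans b4
  have huHB : u * H ≤ B := by
    refine (hlt _).le.trans (le_trans ?_ b5)
    exact Nat.pow_le_pow_left (by norm_num) _
  have huB : u ≤ B := by
    refine le_trans (Nat.le_mul_of_pos_right u ?_) huHB
    rw [hH]
    positivity
  have hLn : 2 ^ L ≤ 2 * n := by
    cases L with
    | zero => simp; omega
    | succ L =>
      have := (hL L (by omega)).not.2 (by omega)
      rw [pow_succ]
      omega
  have hLL := hlt L
  -- the power of two above `k / m`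
  refine (Within.seq 7 (2 + (15 + (2 + (15 + (7 + (3 + (7 + (7 + (7 + (7 + 2)))))))))) _
    ((within_doubleProg (l := l) (r := 3) _ hσ (by omega) le_rfl (by norm_num) (by norm_num)
      (by simp [Expr.NoLoad]) (by simp [Expr.weight]; omega) ?_ (by omega)).mono le_rfl
      (by norm_num) fun _ _ h => h) ?_).mono le_rfl le_rfl fun _ _ h => h
  · intro τ j hj hag hp
    have e1 : τ.reg 1 = m := (hag.1 1 (by omega)).trans h1
    have e2 : τ.reg 2 = k := (hag.1 2 (by omega)).trans h2
    rw [← hl j hj]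
    simp only [Expr.eval, hp, e1, e2]
    split_ifs with h <;> simp [h]
  rintro τ hτ ⟨t1, t3, t4⟩
  refine Within.seq 2 _ (fun υ => Agree 5 τ υ ∧ υ.reg 5 = U) (Within.block _ hτ (by simp) ?_
    ⟨agree_exec 5 _ τ (by simp), ?_⟩) ?_
  · simp [BlockOk, Expr.NoLoad, Expr.weight, Expr.eval, t3]
    rw [← pow_two, ← hU]
    omega
  · simp [exec, Expr.eval, t3, hU, pow_two]
  rintro υ hυ ⟨u1, u5⟩
  refine Within.seq 15 _ _ (within_primeProg hυ (by norm_num) (by norm_num) (by omega) (by omega)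
    (by omega)) ?_
  rintro υ' hυ' ⟨u1', hq, hqU, hq2⟩
  set q := υ'.reg 6 with hqdef
  rw [u5] at hqU hq2
  have v5 : υ'.reg 5 = U := (u1'.1 5 (by omega)).trans u5
  have v1 : Agree 5 τ υ' := u1.trans u1' (by norm_num)
  have v0 : Agree 3 σ υ' := t1.trans v1 (by norm_num)
  have vm : υ'.reg 1 = m := (v0.1 1 (by omega)).trans h1
  have vn : υ'.reg 0 = n := (v0.1 0 (by omega)).trans h0
  refine Within.seq 2 _ (fun ρ => Agree 7 υ' ρ ∧ ρ.reg 7 = N₀) (Within.block _ hυ' (by simp) ?_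
    ⟨agree_exec 7 _ υ' (by simp), ?_⟩) ?_
  · simp [BlockOk, Expr.NoLoad, Expr.weight, Expr.eval, vm, vn, v5]
    omega
  · simp [exec, Expr.eval, vm, vn, v5, hN₀]
  rintro ρ hρ ⟨r1, r7⟩
  refine Within.seq 15 _ _ (within_primeProg hρ (by norm_num) (by norm_num) (by omega) (by omega)
    (by omega)) ?_
  rintro ρ' hρ' ⟨r1', hQ, hQN, hQ2⟩
  set Q := ρ'.reg 8 with hQdef
  rw [r7] at hQN hQ2
  have w1 : Agree 7 υ' ρ' := r1.trans r1' (by norm_num)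
  have w0 : Agree 3 σ ρ' := v0.trans w1 (by norm_num)
  have wn : ρ'.reg 0 = n := (w0.1 0 (by omega)).trans h0
  -- the binary logarithm of `n`
  refine Within.seq 7 _ _ ((within_doubleProg (l := L) (r := 9) _ hρ' (by omega) (by norm_num)
    (by norm_num) (by norm_num) (by simp [Expr.NoLoad]) (by simp [Expr.weight]; omega) ?_
    (by omega)).mono le_rfl (by norm_num) fun _ _ h => h) ?_
  · intro τ j hj hag hp
    have e0 : τ.reg 0 = n := (hag.1 0 (by omega)).trans wn
    rw [← hL j hj]
    simp only [Expr.eval, hp, e0, ite_eq_right_iff, one_ne_zero, imp_false, not_lt]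
  rintro α hα ⟨a1, -, a9⟩
  have α3 : α.reg 3 = 2 ^ l := by rw [a1.1 3 (by omega), w1.1 3 (by omega), v1.1 3 (by omega), t3]
  have α4 : α.reg 4 = l := by rw [a1.1 4 (by omega), w1.1 4 (by omega), v1.1 4 (by omega), t4]
  have α5 : α.reg 5 = U := by rw [a1.1 5 (by omega), w1.1 5 (by omega), v5]
  have α6 : α.reg 6 = q := by rw [a1.1 6 (by omega), w1.1 6 (by omega)]
  have α8 : α.reg 8 = Q := a1.1 8 (by omega)
  have α0 : Agree 3 σ α := w0.trans a1 (by norm_num)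
  have hsc := (seedCount_mono hq2 hQ2 l H u).trans hB
  obtain ⟨c1, c2, c3, c4, c5⟩ := factors_le_of_seedCount_le hq.pos hQ.pos hsc
  refine Within.seq 3 _ (fun β => Agree 10 α β ∧ β.reg 10 = H ∧ β.reg 11 = u)
    (Within.block _ hα (by simp) ?_ ⟨agree_exec 10 _ α (by simp), ?_⟩) ?_
  · simp [BlockOk, Expr.NoLoad, Expr.weight, Expr.eval, α3, a9, ← hH, ← hu, hHB, huB]
    omega
  · simp [exec, Expr.eval, α3, a9, ← hH, ← hu]
  rintro β hβ ⟨β1, β10, β11⟩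
  refine Within.seq 7 _ _ ((within_powProg (b := q) (e := l + 1) _ _ hβ (by norm_num)
    (by simp [Expr.NoLoad]) (by simp [Expr.weight]; omega) (by simp [Expr.NoLoad])
    (by simp [Expr.weight]; omega) (by omega) (fun τ h => ?_) (fun τ h => ?_) (by omega) hq.one_le
    c2).mono le_rfl (by norm_num) fun _ _ h => h) ?_
  · rw [Expr.eval, h.1 6 (by omega), β1.1 6 (by omega), α6]
  · rw [Expr.eval, Expr.eval, Expr.eval, h.1 4 (by omega), β1.1 4 (by omega), α4]
  rintro γ hγ ⟨γ1, γ12⟩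
  refine Within.seq 7 _ _ ((within_powProg (b := 2) (e := 96 * 2 ^ l) _ _ hγ (by norm_num)
    (by simp [Expr.NoLoad]) (by simp [Expr.weight]; omega) (by simp [Expr.NoLoad])
    (by simp [Expr.weight]; omega) (by omega) (fun τ h => rfl) (fun τ h => ?_) hTB (by norm_num)
    c3).mono le_rfl (by norm_num) fun _ _ h => h) ?_
  · rw [Expr.eval, Expr.eval, Expr.eval, h.1 3 (by omega), γ1.1 3 (by omega), β1.1 3 (by omega), α3]
  rintro δ hδ ⟨δ1, δ13⟩
  have γ10 : γ.reg 10 = H := (γ1.1 10 (by omega)).trans β10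
  have γ11 : γ.reg 11 = u := (γ1.1 11 (by omega)).trans β11
  have δ10 : δ.reg 10 = H := (δ1.1 10 (by omega)).trans γ10
  have δ11 : δ.reg 11 = u := (δ1.1 11 (by omega)).trans γ11
  refine Within.seq 7 _ _ ((within_powProg (b := 2) (e := H) _ _ hδ (by norm_num)
    (by simp [Expr.NoLoad]) (by simp [Expr.weight]; omega) (by simp [Expr.NoLoad])
    (by simp [Expr.weight]; omega) (by omega) (fun τ h => rfl) (fun τ h => ?_) hHB (by norm_num)
    c4).mono le_rfl (by norm_num) fun _ _ h => h) ?_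
  · rw [Expr.eval, h.1 10 (by omega), δ10]
  rintro ε hε ⟨ε1, ε14⟩
  have ε10 : ε.reg 10 = H := (ε1.1 10 (by omega)).trans δ10
  have ε11 : ε.reg 11 = u := (ε1.1 11 (by omega)).trans δ11
  refine Within.seq 7 _ _ ((within_powProg (b := 5) (e := u * H) _ _ hε (by norm_num)
    (by simp [Expr.NoLoad]) (by simp [Expr.weight]; omega) (by simp [Expr.NoLoad])
    (by simp [Expr.weight]; omega) (by omega) (fun τ h => rfl) (fun τ h => ?_) huHB (by norm_num)
    c5).mono le_rfl (by norm_num) fun _ _ h => h) ?_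
  · rw [Expr.eval, Expr.eval, Expr.eval, h.1 10 (by omega), h.1 11 (by omega), ε10, ε11]
  rintro ζ hζ ⟨ζ1, ζ15⟩
  have hαζ : Agree 10 α ζ := ((β1.trans γ1 (by norm_num)).trans (δ1.trans ε1 (by norm_num))
    (by norm_num)).trans ζ1 (by norm_num)
  have z3 : ζ.reg 3 = 2 ^ l := (hαζ.1 3 (by omega)).trans α3
  have z5 : ζ.reg 5 = U := (hαζ.1 5 (by omega)).trans α5
  have z6 : ζ.reg 6 = q := (hαζ.1 6 (by omega)).trans α6
  have z8 : ζ.reg 8 = Q := (hαζ.1 8 (by omega)).trans α8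
  have z10 : ζ.reg 10 = H := (ζ1.1 10 (by omega)).trans ε10
  have z11 : ζ.reg 11 = u := (ζ1.1 11 (by omega)).trans ε11
  have z12 : ζ.reg 12 = q ^ (l + 1) := by
    rw [ζ1.1 12 (by omega), ε1.1 12 (by omega), δ1.1 12 (by omega), γ12]
  have z13 : ζ.reg 13 = 2 ^ (96 * 2 ^ l) := by
    rw [ζ1.1 13 (by omega), ε1.1 13 (by omega), δ13]
  have z14 : ζ.reg 14 = 2 ^ H := by rw [ζ1.1 14 (by omega), ε14]
  have hend : ∀ e, Agree 15 ζ (exec [(15, e)] ζ) := fun e => agree_exec 15 _ ζ (by simp)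
  refine Within.block _ hζ (by simp) ?_ ⟨q, Q, hq, hqU, hq2, hQ, hQN, hQ2,
    (α0.trans hαζ (by norm_num)).trans (hend _) (by norm_num), ((hend _).1 3 (by omega)).trans z3,
    ((hend _).1 5 (by omega)).trans z5, ((hend _).1 6 (by omega)).trans z6,
    ((hend _).1 8 (by omega)).trans z8, ((hend _).1 10 (by omega)).trans z10,
    ((hend _).1 11 (by omega)).trans z11, ((hend _).1 12 (by omega)).trans z12,
    ((hend _).1 13 (by omega)).trans z13, ((hend _).1 14 (by omega)).trans z14, ?_⟩
  · simp [BlockOk, Expr.NoLoad, Expr.weight, Expr.eval, z8, z12, z13, z14, ζ15]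
    exact ⟨by omega, hsc⟩
  · simp [exec, Expr.eval, z8, z12, z13, z14, ζ15, seedCount]

/-! ### The whole program -/

/-- The program that constructs the multiset of points: if `2 k < m`, the points with equal
coordinates, and otherwise the points of all seeds. -/
def mainProg (C κ : ℕ) : Prog :=
  .cond (.lt (.mul (.const 2) (.var 2)) (.var 1))
    (.seq (block [(15, .var 1)]) (outProg (block [(34, .var 16)])))
    (.seq (paramProg C κ) (outProg coordProg))

lemma bounded_input {B n m k : ℕ} (hn : n ≤ B) (hm : m ≤ B) (hk : k ≤ B) :
    (input n m k).Bounded B := by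
  intro x
  simp only [input]
  split_ifs <;> omega

lemma Outputs.mono {n m a b k T T' : ℕ} {P : Prog} {S : List (Fin n → Fin m)}
    (h : Outputs P a b k S T) (hT : T ≤ T') : Outputs P a b k S T' := by
  obtain ⟨τ, t, hr, ht, hS⟩ := h
  exact ⟨τ, t, hr, ht.trans hT, hS⟩

/-- A program that halts with the list of the points `pt s`, for `s < N`, in its memory. -/
lemma Within.outputs {B w a d n m k N : ℕ} {P : Prog} (pt : ℕ → Fin n → Fin m)
    (h : Within B w a d P (input n m k) fun τ => τ.reg 0 = N ∧
      ∀ s < N, ∀ i : Fin n, τ.arr 0 (s * n + i) = pt s i) :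
    Outputs P n m k ((List.range N).map pt) (a * ((B + 1) ^ d * unitCost B w)) := by
  obtain ⟨τ, t, hr, ht, -, h1, h2⟩ := h
  refine ⟨τ, t, hr, ht, by simpa using h1, fun s i => ?_⟩
  have hs : s.val < N := by simpa using s.isLt
  rw [h2 s hs i]
  simp

lemma within_mainProg_of_lt {B w n m k C κ : ℕ} (hw : 200 + C + κ ≤ w) (hn : n ≤ B) (hm : m ≤ B)
    (hk : k ≤ B) (hkm : 2 * k < m) :
    Within B w 148 4 (mainProg C κ) (input n m k) fun τ => τ.reg 0 = m ∧
      ∀ s < m, ∀ i : Fin n, τ.arr 0 (s * n + i) = s := by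
  have hσ := bounded_input hn hm hk
  refine Within.cond (a := 147) hσ (by simp [Expr.NoLoad]) (by simp [Expr.weight]; omega)
    (fun _ => ?_) (fun h => ?_)
  · refine (Within.seq (d := 2) 2 16 (fun τ => Agree 15 (input n m k) τ ∧ τ.reg 15 = m)
      (Within.block _ hσ (by simp) ?_ ⟨agree_exec 15 _ _ (by simp), ?_⟩) ?_).mono (by norm_num)
      (by norm_num) fun _ _ h => h
    · simp [BlockOk, Expr.NoLoad, Expr.weight, Expr.eval, input, hm]
      omega
    · simp [exec, Expr.eval, input]
    rintro τ hτ ⟨t1, t2⟩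
    refine (within_outProg (a := 2) (d := 0) (n := n) (N := m) (f := fun s _ => s) hτ (by omega)
      (t1.1 0 (by omega)) t2 ?_).mono le_rfl le_rfl fun υ _ h => ⟨h.1, fun s hs i =>
        h.2 s hs i i.isLt⟩
    intro υ hυ _ h16 _
    refine Within.block _ hυ (by simp) ?_ ⟨agree_exec 18 _ _ (by simp), ?_⟩
    · simp [BlockOk, Expr.NoLoad, Expr.weight, Expr.eval, hυ 16]
      omega
    · simp [exec, Expr.eval]
  · simp [Expr.eval, input] at h
    omega

/-- If `m ≤ 2 k`, the program lists the points of all seeds, for some primes `q` and `Q` in the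
required ranges. -/
lemma within_mainProg_of_le {B w n m k l L C κ U N₀ H u : ℕ} (hw : 200 + C + κ ≤ w) (hn : n ≤ B)
    (hm : m ≤ B) (hk : k ≤ B) (hkm : m ≤ 2 * k) (hn0 : 0 < n) (hm0 : 0 < m)
    (hl : ∀ j ≤ l, k < 2 ^ j * m ↔ l ≤ j) (hL : ∀ j ≤ L, n ≤ 2 ^ j ↔ L ≤ j)
    (hU : U = 96 * (2 ^ l) ^ 2) (hN₀ : N₀ = n + 4 * m + U)
    (hH : H = 2 * ((6 + C) * (96 * 2 ^ l))) (hu : u = κ * (1 + L / 2 ^ l))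
    (hB : seedCount (2 * U) (2 * N₀) l H u ≤ B) :
    ∃ q Q, q.Prime ∧ U < q ∧ q ≤ 2 * U ∧ Q.Prime ∧ N₀ < Q ∧ Q ≤ 2 * N₀ ∧
      Within B w 148 4 (mainProg C κ) (input n m k) fun τ => τ.reg 0 = seedCount q Q l H u ∧
        ∀ s < seedCount q Q l H u, ∀ i : Fin n, τ.arr 0 (s * n + i) = seedPoint (Q := Q) hm0 q U l H
          u (q ^ (l + 1)) (2 ^ (96 * 2 ^ l)) (2 ^ H) n s i := by
  have hσ := bounded_input hn hm hk
  -- The primes that the program finds are determined by its run.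
  obtain ⟨τ, t, hr, ht, hτ, q, Q, hq, hqU, hq2, hQ, hQN, hQ2, t0, t3, t5, t6, t8, t10, t11, t12,
    t13, t14, t15⟩ := within_paramProg (σ := input n m k) hσ hw rfl rfl rfl hn0 hl hL hU hN₀ hH hu hB
  have hUpos : 0 < U := by rw [hU]; positivity
  obtain ⟨-, -, b3, -, b5⟩ := factors_le_of_seedCount_le (by omega) (by omega) hB
  have hTB : 96 * 2 ^ l ≤ B := Nat.lt_two_pow_self.le.trans b3
  have huHB : u * H ≤ B :=
    Nat.lt_two_pow_self.le.trans ((Nat.pow_le_pow_left (by norm_num) _).trans b5)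
  refine ⟨q, Q, hq, hqU, hq2, hQ, hQN, hQ2, ?_⟩
  refine Within.cond (a := 147) hσ (by simp [Expr.NoLoad]) (by simp [Expr.weight]; omega)
    (fun h => ?_) (fun _ => ?_)
  · simp [Expr.eval, input] at h
    omega
  refine Within.seq 81 66 (· = τ) ⟨τ, t, hr, ht.trans ?_, hτ, rfl⟩ ?_
  · exact Nat.mul_le_mul_left _ (Nat.mul_le_mul_right _ (Nat.pow_le_pow_right (by omega)
      (by norm_num)))
  rintro _ - rfl
  refine (within_outProg (a := 52) (d := 2) (n := n) (N := seedCount q Q l H u)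
    (f := fun s i => if h : i < n then (seedPoint (Q := Q) hm0 q U l H
          u (q ^ (l + 1)) (2 ^ (96 * 2 ^ l)) (2 ^ H) n s ⟨i, h⟩ : Fin m).val else 0) hτ (by omega)
      (t0.1 0 (by omega)) t15 ?_).mono le_rfl le_rfl fun υ _ h => ⟨h.1, fun s hs i => ?_⟩
  · intro υ hυ hag _ h17
    have hag' : ∀ {x v}, x < 16 → _ = v → υ.reg x = v := fun hx h => (hag _ hx).trans h
    refine (within_coordProg hm0 hQ.pos ⟨υ.reg 17, h17⟩ hυ (by omega)
      (hag' (by omega) (t0.1 1 (by omega))) (hag' (by omega) t3) (hag' (by omega) t5)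
      (hag' (by omega) t6) (hag' (by omega) t8) (hag' (by omega) t10) (hag' (by omega) t11)
      (hag' (by omega) t12) (hag' (by omega) t13) (hag' (by omega) t14) rfl rfl hUpos hTB
      huHB).mono le_rfl le_rfl fun π _ h => ⟨h.1, ?_⟩
    rw [h.2, dif_pos h17]
  · rw [h.2 s hs i i.isLt, dif_pos i.isLt]

/-- Bounds that are polynomial in `n` for the numbers in the registers make the time polynomial. -/
lemma time_le {n X w a d K : ℕ} (hn : 1 ≤ n) (hX : 1 ≤ X)
    (hK : a * 4 * (3 * X) ^ (d + w) + X * (d + w) ≤ K) :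
    a * ((X * n ^ X + 1) ^ d * unitCost (X * n ^ X) w) ≤ K * n ^ K := by
  set B := X * n ^ X with hB
  have hB1 : 1 ≤ B := Nat.mul_pos hX (by positivity)
  have h1 : unitCost B w ≤ 4 * (B + 2) ^ w := by
    have : 1 ≤ (B + 2) ^ w := Nat.one_le_pow _ _ (by omega)
    rw [unitCost]
    omega
  have h2 : B + 2 ≤ 3 * X * n ^ X := by rw [mul_assoc]; omega
  calc a * ((B + 1) ^ d * unitCost B w)
      ≤ a * ((B + 2) ^ d * (4 * (B + 2) ^ w)) := by gcongr; omega
    _ = a * 4 * (B + 2) ^ (d + w) := by rw [pow_add]; ring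
    _ ≤ a * 4 * (3 * X * n ^ X) ^ (d + w) := by gcongr
    _ = a * 4 * (3 * X) ^ (d + w) * n ^ (X * (d + w)) := by rw [mul_pow, ← pow_mul]; ring
    _ ≤ K * n ^ K := Nat.mul_le_mul (by omega) (Nat.pow_le_pow_right hn (by omega))

end RAM

/-! ### Size of the seeds -/

/-- The number of seeds is at most `2 ^ (sizeExponent C κ * L)` if `n ≤ 2 ^ L`, `m ≤ 2 ^ (C L)` and
`R ≤ 2 C L`. -/
def sizeExponent (C κ : ℕ) : ℕ :=
  3 * (6 + 19 * C) + 112 * (2 * C) + 192 * (6 + C) * (2 * C) + 576 * (κ * (6 + C)) * (2 * C + 1)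

lemma two_mul_add_eight_mul_le (l : ℕ) : (2 * l + 8) * (l + 1) ≤ 16 * 2 ^ l := by
  have h : ∀ l : ℕ, 4 * l + 12 ≤ 16 * 2 ^ l := fun l => by
    have := (Nat.lt_two_pow_self : l < 2 ^ l)
    omega
  induction l with
  | zero => norm_num
  | succ l ih =>
    have := h l
    rw [pow_succ]
    nlinarith

lemma seedCount_le_two_pow {n m l L C κ U N₀ H u : ℕ} (hL1 : 1 ≤ L) (hn : n ≤ 2 ^ L)
    (hm : m ≤ 2 ^ (C * L)) (hR : 2 ^ l ≤ 2 * C * L) (hU : U = 96 * (2 ^ l) ^ 2)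
    (hN₀ : N₀ = n + 4 * m + U) (hH : H = 2 * ((6 + C) * (96 * 2 ^ l)))
    (hu : u = κ * (1 + L / 2 ^ l)) :
    seedCount (2 * U) (2 * N₀) l H u ≤ 2 ^ (sizeExponent C κ * L) := by
  have hU1 : 2 * U ≤ 2 ^ (2 * l + 8) := by
    rw [hU, pow_add, pow_mul' 2 2 l]
    omega
  have hU2 : (2 * U) ^ (l + 1) ≤ 2 ^ (16 * 2 ^ l) := by
    calc (2 * U) ^ (l + 1) ≤ (2 ^ (2 * l + 8)) ^ (l + 1) := Nat.pow_le_pow_left hU1 _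
      _ = 2 ^ ((2 * l + 8) * (l + 1)) := (pow_mul _ _ _).symm
      _ ≤ _ := Nat.pow_le_pow_right (by norm_num) (two_mul_add_eight_mul_le l)
  have hR1 : 1 ≤ 2 ^ l := Nat.one_le_two_pow
  set R := 2 ^ l with hRdef
  have hU3 : U ≤ 2 ^ (9 * R) := by
    have h1 : R ^ 2 ≤ 2 ^ (2 * R) := by
      rw [pow_mul' 2 2 R]
      exact Nat.pow_le_pow_left Nat.lt_two_pow_self.le _
    calc U ≤ 2 ^ 7 * 2 ^ (2 * R) := by rw [hU]; omega
      _ = 2 ^ (7 + 2 * R) := (pow_add _ _ _).symm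
      _ ≤ 2 ^ (9 * R) := Nat.pow_le_pow_right (by norm_num) (by omega)
  have hN : 2 * N₀ ≤ 2 ^ (5 + L + C * L + 9 * R) := by
    have e : 2 ^ (5 + L + C * L + 9 * R) = 32 * 2 ^ (L + C * L + 9 * R) := by
      rw [show 5 + L + C * L + 9 * R = 5 + (L + C * L + 9 * R) by ring, pow_add]
      norm_num
    have h1 : 2 ^ L ≤ 2 ^ (L + C * L + 9 * R) := Nat.pow_le_pow_right (by norm_num) (by omega)
    have h2 : 2 ^ (C * L) ≤ 2 ^ (L + C * L + 9 * R) := Nat.pow_le_pow_right (by norm_num) (by omega)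
    have h3 : 2 ^ (9 * R) ≤ 2 ^ (L + C * L + 9 * R) := Nat.pow_le_pow_right (by norm_num) (by omega)
    omega
  have huH : u * H ≤ 192 * (κ * (6 + C)) * (R + L) := by
    have h1 : (1 + L / R) * R ≤ R + L := by
      rw [add_mul, one_mul]
      exact Nat.add_le_add_left (Nat.div_mul_le_self _ _) _
    calc u * H = 192 * (κ * (6 + C)) * ((1 + L / R) * R) := by rw [hu, hH]; ring
      _ ≤ _ := Nat.mul_le_mul_left _ h1
  have hG : 5 ^ (u * H) ≤ 2 ^ (3 * (192 * (κ * (6 + C)) * (R + L))) := by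
    calc 5 ^ (u * H) ≤ (2 ^ 3) ^ (u * H) := Nat.pow_le_pow_left (by norm_num) _
      _ = 2 ^ (3 * (u * H)) := (pow_mul _ _ _).symm
      _ ≤ _ := Nat.pow_le_pow_right (by norm_num) (Nat.mul_le_mul_left _ huH)
  set E := 5 + L + C * L + 9 * R with hE
  have hexp : E + (16 * R + (96 * R + (H + (E + (E + 3 * (192 * (κ * (6 + C)) * (R + L))))))) ≤
      sizeExponent C κ * L := by
    have h1 : E ≤ (6 + 19 * C) * L := by rw [hE]; nlinarith
    have h2 : H ≤ 192 * (6 + C) * (2 * C * L) := by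
      rw [hH]
      calc 2 * ((6 + C) * (96 * R)) = 192 * (6 + C) * R := by ring
        _ ≤ _ := Nat.mul_le_mul_left _ hR
    have h3 : 192 * (κ * (6 + C)) * (R + L) ≤ 192 * (κ * (6 + C)) * (2 * C * L + L) :=
      Nat.mul_le_mul_left _ (by omega)
    have h4 : sizeExponent C κ * L = 3 * ((6 + 19 * C) * L) + 112 * (2 * C * L) +
        192 * (6 + C) * (2 * C * L) + 3 * (192 * (κ * (6 + C)) * (2 * C * L + L)) := by
      rw [sizeExponent]
      ring
    omega
  calc seedCount (2 * U) (2 * N₀) l H u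
      ≤ 2 ^ E * (2 ^ (16 * R) * (2 ^ (96 * R) * (2 ^ H * (2 ^ E * (2 ^ E *
          2 ^ (3 * (192 * (κ * (6 + C)) * (R + L)))))))) := by
        unfold seedCount
        gcongr
    _ = 2 ^ (E + (16 * R + (96 * R + (H + (E + (E +
          3 * (192 * (κ * (6 + C)) * (R + L)))))))) := by simp only [pow_add]
    _ ≤ _ := Nat.pow_le_pow_right (by norm_num) hexp

/-! ### Acceptance probabilities of the two multisets -/

lemma listProb_map_range {D : Type} (N : ℕ) (pt : ℕ → D) (f : D → Bool) :
    listProb ((List.range N).map pt) f =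
      (((Finset.range N).filter fun s => f (pt s) = true).card : ℝ) / N := by
  rw [listProb, List.countP_map, List.length_map, List.length_range, List.countP_eq_length_filter,
    Finset.card_def, Finset.filter_val, Finset.range_val, Multiset.range, Multiset.filter_coe,
    Multiset.coe_card]
  simp [Function.comp_def]

lemma sum_rejectProb_mul {n m : ℕ} (hm : 0 < m) (A : Fin n → Finset (Fin m)) :
    (∑ i, rejectProb (A i)) * m = ((∑ i, (A i)ᶜ.card : ℕ) : ℝ) := by
  have hm' : (m : ℝ) ≠ 0 := by exact_mod_cast hm.ne'
  rw [Finset.sum_mul, Nat.cast_sum]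
  refine Finset.sum_congr rfl fun i _ => ?_
  have h : (A i).card + (A i)ᶜ.card = m := by rw [Finset.card_add_card_compl, Fintype.card_fin]
  have h' : ((A i).card : ℝ) + (A i)ᶜ.card = m := by exact_mod_cast h
  rw [rejectProb, sub_mul, div_mul_cancel₀ _ hm', one_mul]
  linarith

/-- The points with equal coordinates hit a rectangle with probability at least `1 - ∑ i, q i`, by
the union bound. -/
lemma one_sub_sum_le_listProb_diagonal {n m : ℕ} (hm : 0 < m) (A : Fin n → Finset (Fin m)) :
    1 - ∑ i, rejectProb (A i) ≤ listProb ((List.range m).map fun s (_ : Fin n) =>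
      (⟨s % m, Nat.mod_lt _ hm⟩ : Fin m)) (combRect A) := by
  have hm' : (0 : ℝ) < m := by exact_mod_cast hm
  have key : (m : ℝ) ≤ ((Finset.univ.filter fun a : Fin m => ∀ i, a ∈ A i).card : ℝ) +
      ((∑ i, (A i)ᶜ.card : ℕ) : ℝ) := by
    have h1 : (Finset.univ : Finset (Fin m)) ⊆ (Finset.univ.filter fun a : Fin m => ∀ i, a ∈ A i) ∪
        Finset.univ.biUnion fun i => (A i)ᶜ := by
      intro a _
      by_cases h : ∀ i, a ∈ A i
      · simp [h]
      · push Not at h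
        simp [h]
    have h2 := (Finset.card_le_card h1).trans ((Finset.card_union_le _ _).trans
      (Nat.add_le_add_left Finset.card_biUnion_le _))
    rw [Finset.card_univ, Fintype.card_fin] at h2
    exact_mod_cast h2
  have hcard : ((Finset.range m).filter fun s => combRect A (fun _ : Fin n =>
      (⟨s % m, Nat.mod_lt _ hm⟩ : Fin m)) = true).card =
      (Finset.univ.filter fun a : Fin m => ∀ i, a ∈ A i).card := by
    rw [Finset.card_filter, Finset.sum_range, Finset.card_filter]
    refine Finset.sum_congr rfl fun a _ => ?_
    have ha : (⟨a.val % m, Nat.mod_lt _ hm⟩ : Fin m) = a := Fin.ext (Nat.mod_eq_of_lt a.isLt)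
    simp [combRect, ha]
  rw [listProb_map_range, hcard, le_div_iff₀ hm', sub_mul, sum_rejectProb_mul hm]
  linarith

lemma half_rpow_le_one_sub {x : ℝ} (h0 : 0 ≤ x) (h1 : x ≤ 1 / 2) :
    1 / (2 : ℝ) ^ (2 * x) ≤ 1 - x := by
  have h := rpow_one_add_le_one_add_mul_self (s := -1 / 2) (p := 2 * x) (by norm_num)
    (by linarith) (by linarith)
  rw [show (1 : ℝ) + -1 / 2 = 2⁻¹ by norm_num, Real.inv_rpow (by norm_num)] at h
  rw [one_div]
  linarith

lemma uniformProb_le_one {D : Type} [Fintype D] (f : D → Bool) : uniformProb f ≤ 1 :=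
  div_le_one_of_le₀ (by exact_mod_cast Finset.card_le_univ _) (Nat.cast_nonneg _)

/-- If `∑ i, q i ≤ 1 / 2`, then the points with equal coordinates are good enough. -/
lemma le_listProb_diagonal {n m K : ℕ} (hm : 0 < m) (hK : 2 ≤ K) {ρ p : ℝ}
    (hρ : 2 * ⌊ρ * m⌋₊ < m) (A : Fin n → Finset (Fin m)) (hsum : ∑ i, rejectProb (A i) ≤ ρ)
    (hp : p ≤ 1) :
    p / (2 : ℝ) ^ ((K : ℝ) * ρ) ≤ listProb ((List.range m).map fun s (_ : Fin n) =>
      (⟨s % m, Nat.mod_lt _ hm⟩ : Fin m)) (combRect A) := by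
  have hm' : (0 : ℝ) < m := by exact_mod_cast hm
  set x := ∑ i, rejectProb (A i) with hx
  have hx0 : 0 ≤ x := Finset.sum_nonneg fun i _ => rejectProb_nonneg _
  -- `x` is a multiple of `1 / m`, hence at most `⌊ρ m⌋ / m`
  have hx1 : x ≤ 1 / 2 := by
    have h1 := sum_rejectProb_mul hm A
    have h2 : (∑ i, (A i)ᶜ.card) ≤ ⌊ρ * m⌋₊ := by
      refine Nat.le_floor ?_
      rw [← h1]
      exact mul_le_mul_of_nonneg_right hsum hm'.le
    have h3 : 2 * ∑ i, (A i)ᶜ.card ≤ m := by omega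
    have h4 : (2 : ℝ) * ((∑ i, (A i)ᶜ.card : ℕ) : ℝ) ≤ m := by exact_mod_cast h3
    rw [← h1] at h4
    nlinarith
  have hK' : (2 : ℝ) ≤ K := by exact_mod_cast hK
  calc p / (2 : ℝ) ^ ((K : ℝ) * ρ) ≤ 1 / (2 : ℝ) ^ ((K : ℝ) * ρ) := by gcongr
    _ ≤ 1 / (2 : ℝ) ^ (2 * x) := by
        gcongr
        norm_num
    _ ≤ 1 - x := half_rpow_le_one_sub hx0 hx1
    _ ≤ _ := one_sub_sum_le_listProb_diagonal hm A

/-! ### The construction -/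

/-- If the points with equal coordinates do not suffice, then the points of all seeds do. -/
lemma exists_seedPoint_list {n m k C κ w B : ℕ} {ρ : ℝ} (hn : 2 ≤ n) (hm : 0 < m)
    (hmn : m ≤ n ^ C) (hk : k = ⌊ρ * m⌋₊) (hkm : m ≤ 2 * k) (hρ : ρ ≤ C * Real.logb 2 n)
    (hκ : (9999 / 10000 : ℝ) ^ κ ≤ 1 / 2) (hw : 200 + C + κ ≤ w)
    (hB : n ^ (2 * sizeExponent C κ) ≤ B) (hnB : n ≤ B) (hmB : m ≤ B)
    (hkB : ∀ L, 2 ^ L ≤ n ^ 2 → k ≤ C * L * m → k ≤ B) :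
    ∃ S : List (Fin n → Fin m),
      RAM.Outputs (RAM.mainProg C κ) n m k S (148 * ((B + 1) ^ 4 * RAM.unitCost B w)) ∧
      S.length ≤ n ^ (2 * sizeExponent C κ) ∧
      ∀ A : Fin n → Finset (Fin m), ∑ i, rejectProb (A i) ≤ ρ →
        1 / (n : ℝ) ^ C ≤ uniformProb (combRect A) →
        uniformProb (combRect A) / (2 : ℝ) ^ ((2 * lossExponent C : ℕ) * ρ) ≤
          listProb S (combRect A) := by
  have hmR : (0 : ℝ) < m := by exact_mod_cast hm
  have hk1 : 1 ≤ k := by omega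
  have hkρ : (k : ℝ) ≤ ρ * m := by
    rw [hk]
    refine Nat.floor_le ?_
    by_contra h
    have := Nat.floor_of_nonpos (not_le.1 h).le
    omega
  -- `2 ^ l` is the first power of two above `k / m`, and `2 ^ L` the first one from `n` on
  obtain ⟨l, hl, hlmin⟩ : ∃ l, k < 2 ^ l * m ∧ ∀ j < l, 2 ^ j * m ≤ k := by
    have hex : ∃ l, k < 2 ^ l * m :=
      ⟨k, Nat.lt_two_pow_self.trans_le (Nat.le_mul_of_pos_right _ hm)⟩
    classical
    exact ⟨Nat.find hex, Nat.find_spec hex, fun j hj => not_lt.1 (Nat.find_min hex hj)⟩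
  set L := Nat.clog 2 n with hLdef
  have hnL : n ≤ 2 ^ L := Nat.le_pow_clog (by norm_num) n
  have hL1 : 1 ≤ L := Nat.clog_pos (by norm_num) hn
  have hLn : 2 ^ L ≤ n ^ 2 := by
    have h1 : 2 ^ (L - 1) < n := Nat.pow_pred_clog_lt_self (by norm_num) hn
    obtain ⟨L', hL'⟩ : ∃ L', L = L' + 1 := ⟨L - 1, by omega⟩
    rw [hL', Nat.add_sub_cancel] at h1
    rw [hL', pow_succ]
    nlinarith
  have hlogL : Real.logb 2 n ≤ L := by
    rw [Real.logb_le_iff_le_rpow (by norm_num) (by exact_mod_cast (by omega : 0 < n)),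
      Real.rpow_natCast]
    exact_mod_cast hnL
  have hρL : ρ ≤ C * L := hρ.trans (mul_le_mul_of_nonneg_left hlogL (Nat.cast_nonneg _))
  have hRk : 2 ^ l * m ≤ 2 * k := by
    cases l with
    | zero => simpa using hkm
    | succ l =>
      have := hlmin l (by omega)
      rw [pow_succ]
      nlinarith
  have hRρ : (2 : ℝ) ^ l ≤ 2 * ρ := by
    have h1 : (2 : ℝ) ^ l * m ≤ 2 * k := by exact_mod_cast hRk
    nlinarith
  have hρR : ρ ≤ (2 : ℝ) ^ l := by
    have h1 : ρ * m < k + 1 := by rw [hk]; exact Nat.lt_floor_add_one _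
    have h2 : (k : ℝ) + 1 ≤ 2 ^ l * m := by exact_mod_cast hl
    nlinarith
  have hRL : 2 ^ l ≤ 2 * C * L := by
    have h1 : (2 : ℝ) ^ l ≤ 2 * C * L := by nlinarith
    exact_mod_cast h1
  have hmL : m ≤ 2 ^ (C * L) := by
    rw [pow_mul' 2 C L]
    exact hmn.trans (Nat.pow_le_pow_left hnL _)
  obtain ⟨U, hU⟩ : ∃ U, U = 96 * (2 ^ l) ^ 2 := ⟨_, rfl⟩
  obtain ⟨N₀, hN₀⟩ : ∃ N₀, N₀ = n + 4 * m + U := ⟨_, rfl⟩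
  obtain ⟨H, hH⟩ : ∃ H, H = 2 * ((6 + C) * (96 * 2 ^ l)) := ⟨_, rfl⟩
  obtain ⟨u, hu⟩ : ∃ u, u = κ * (1 + L / 2 ^ l) := ⟨_, rfl⟩
  have hcount : seedCount (2 * U) (2 * N₀) l H u ≤ n ^ (2 * sizeExponent C κ) := by
    refine (seedCount_le_two_pow hL1 hnL hmL hRL hU hN₀ hH hu).trans ?_
    rw [mul_comm, pow_mul, pow_mul]
    exact Nat.pow_le_pow_left hLn _
  have hkL : k ≤ C * L * m := by
    have h1 : (k : ℝ) ≤ C * L * m := hkρ.trans (mul_le_mul_of_nonneg_right hρL hmR.le)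
    exact_mod_cast h1
  obtain ⟨q, Q, hq, hqU, hq2, hQ, hQN, hQ2, hrun⟩ := RAM.within_mainProg_of_le (w := w) (B := B)
    hw hnB hmB (hkB L hLn hkL) hkm (by omega) hm
    (fun j hj => ⟨fun h => by
        by_contra h'
        have := hlmin j (by omega)
        omega,
      fun h => by
        obtain rfl : j = l := by omega
        exact hl⟩)
    (fun j _ => (Nat.clog_le_iff_le_pow (by norm_num)).symm) hU hN₀ hH hu (hcount.trans hB)
  refine ⟨_, hrun.outputs _, ?_, fun A hsum hA => ?_⟩
  · rw [List.length_map, List.length_range]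
    exact (seedCount_mono hq2 hQ2 l H u).trans hcount
  rw [uniformProb_combRect hm] at hA ⊢
  set P := ∏ i, (1 - rejectProb (A i)) with hP
  have hn0 : (0 : ℝ) < n := by exact_mod_cast (by omega : 0 < n)
  have hP0 : 0 < P := lt_of_lt_of_le (by positivity) hA
  have hPL : (1 / 2 : ℝ) ^ (C * L) ≤ P := by
    refine le_trans ?_ hA
    rw [one_div_pow, pow_mul' 2 C L]
    have h1 : (n : ℝ) ^ C ≤ ((2 : ℝ) ^ L) ^ C := by
      have h2 : (n : ℝ) ≤ 2 ^ L := by exact_mod_cast hnL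
      gcongr
    exact one_div_le_one_div_of_le (by positivity) h1
  have hgood := le_card_seedPoint (n := n) (m := m) (q := q) (Q := Q) (l := l) (L := L) (C := C)
    (κ := κ) hm hq hQ (by omega) (by omega) (by omega) (by omega) hκ _ _ _ _ H u rfl rfl hH rfl hu
    rfl A (hsum.trans hρR) hPL
  rw [← hU, ← hP] at hgood
  change ((seedCount q Q l H u : ℕ) : ℝ) * _ ≤ _ at hgood
  have hsc : (0 : ℝ) < (seedCount q Q l H u : ℕ) := by
    have := hq.pos
    have := hQ.pos
    rw [Nat.cast_pos, seedCount]
    positivity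
  rw [listProb_map_range]
  calc P / (2 : ℝ) ^ ((2 * lossExponent C : ℕ) * ρ) ≤ P / 2 ^ (lossExponent C * 2 ^ l) := by
        gcongr
        rw [← Real.rpow_natCast]
        refine Real.rpow_le_rpow_of_exponent_le (by norm_num) ?_
        push_cast
        have : (0 : ℝ) ≤ lossExponent C := Nat.cast_nonneg _
        nlinarith
    _ ≤ _ := by
        rw [le_div_iff₀ hsc, mul_comm]
        refine hgood.trans (le_of_eq ?_)
        congr 2
        ext s
        simp only [Finset.mem_filter, combRect, decide_eq_true_eq, seedCount]

theorem mainTheorem6 (c : ℝ) (hc : 0 < c) :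
    ∃ (K : ℕ) (P : RAM.Prog), ∀ (n m : ℕ) (ρ : ℝ), 1 ≤ n → (m : ℝ) = (n : ℝ) ^ c →
      ρ ≤ c * Real.logb 2 n →
      ∃ S : List (Fin n → Fin m),
        RAM.Outputs P n m ⌊ρ * m⌋₊ S (K * n ^ K) ∧
        S.length ≤ n ^ K ∧
        ∀ (A : Fin n → Finset (Fin m)) (p : ℝ),
          ∑ i, rejectProb (A i) ≤ ρ →
          1 / (n : ℝ) ^ c ≤ p →
          p ≤ uniformProb (combRect A) →
          p / (2 : ℝ) ^ ((K : ℝ) * ρ) ≤ listProb S (combRect A) := by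
  obtain ⟨κ, hκ⟩ := exists_pow_lt_of_lt_one (show (0 : ℝ) < 1 / 2 by norm_num)
    (show (9999 / 10000 : ℝ) < 1 by norm_num)
  set C := ⌈c⌉₊ with hC
  have hcC : c ≤ C := Nat.le_ceil c
  set w := 200 + C + κ with hw
  set X := 2 * sizeExponent C κ + 2 * C + 3 with hX
  obtain ⟨K, hK⟩ : ∃ K, K = 148 * 4 * (3 * X) ^ (4 + w) + X * (4 + w) + 2 * lossExponent C :=
    ⟨_, rfl⟩
  have hXK : X ≤ K := by
    have : X * 1 ≤ X * (4 + w) := Nat.mul_le_mul_left _ (by omega)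
    omega
  refine ⟨K, RAM.mainProg C κ, fun n m ρ hn hmn hρ => ?_⟩
  have hn1 : (1 : ℝ) ≤ n := by exact_mod_cast hn
  have hn0 : (0 : ℝ) < n := by linarith
  have hm : 0 < m := by
    have : (0 : ℝ) < m := by rw [hmn]; positivity
    exact_mod_cast this
  have hlog : 0 ≤ Real.logb 2 n := Real.logb_nonneg (by norm_num) hn1
  have hcC' : (n : ℝ) ^ c ≤ (n : ℝ) ^ C := by
    rw [← Real.rpow_natCast]
    exact Real.rpow_le_rpow_of_exponent_le hn1 hcC
  have hmC : m ≤ n ^ C := by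
    have h1 : (m : ℝ) ≤ (n : ℝ) ^ C := hmn.le.trans hcC'
    exact_mod_cast h1
  have hpow : ∀ {a b : ℕ}, a ≤ b → n ^ a ≤ n ^ b := fun h => Nat.pow_le_pow_right hn h
  have hmX : m ≤ n ^ X := hmC.trans (hpow (by omega))
  have hnX : n ≤ n ^ X := Nat.le_self_pow (by omega) n
  have hXX : n ^ X ≤ X * n ^ X := Nat.le_mul_of_pos_left _ (by omega)
  -- `X * n ^ X` bounds all registers
  have htime := RAM.time_le (n := n) (X := X) (w := w) (a := 148) (d := 4) (K := K) hn (by omega)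
    (by omega)
  set k := ⌊ρ * m⌋₊ with hk
  by_cases hkm : 2 * k < m
  · have hrun := RAM.within_mainProg_of_lt (w := w) (B := X * n ^ X) (κ := κ) (C := C) le_rfl
      (hnX.trans hXX) (hmX.trans hXX) (by omega) hkm
    refine ⟨_, RAM.Outputs.mono (RAM.Within.outputs (fun s (_ : Fin n) =>
      (⟨s % m, Nat.mod_lt _ hm⟩ : Fin m)) (hrun.mono le_rfl le_rfl fun τ _ h => ⟨h.1, ?_⟩)) htime,
      ?_, fun A p hsum hp1 hp2 => ?_⟩
    · intro s hs i
      rw [h.2 s hs i]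
      exact (Nat.mod_eq_of_lt hs).symm
    · rw [List.length_map, List.length_range]
      exact hmX.trans (hpow hXK)
    · exact le_listProb_diagonal hm (by omega) hkm A hsum (hp2.trans (uniformProb_le_one _))
  · -- here `k` is positive, which excludes `ρ ≤ 0`, and with it `n = 1`
    have hρ0 : 0 < ρ := by
      by_contra h
      have : k = 0 := Nat.floor_of_nonpos (mul_nonpos_of_nonpos_of_nonneg (not_lt.1 h)
        (Nat.cast_nonneg _))
      omega
    have hn2 : 2 ≤ n := by
      by_contra h
      obtain rfl : n = 1 := by omega
      rw [Nat.cast_one, Real.logb_one, mul_zero] at hρ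
      linarith
    have hX2 : n ^ (2 * sizeExponent C κ) ≤ n ^ X := hpow (by omega)
    have hkB : ∀ L, 2 ^ L ≤ n ^ 2 → k ≤ C * L * m → k ≤ X * n ^ X := by
      intro L hL hkL
      calc k ≤ C * L * m := hkL
        _ ≤ X * n ^ 2 * n ^ C := by
            have h1 := Nat.lt_two_pow_self.le.trans hL
            have h2 : C ≤ X := by omega
            gcongr
        _ = X * n ^ (2 + C) := by rw [pow_add]; ring
        _ ≤ X * n ^ X := Nat.mul_le_mul_left _ (hpow (by omega))
    obtain ⟨S, h1, h2, h3⟩ := exists_seedPoint_list (w := w) (B := X * n ^ X) hn2 hm hmC hk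
      (not_lt.1 hkm) (hρ.trans (mul_le_mul_of_nonneg_right hcC hlog)) hκ.le le_rfl (by omega)
      (by omega) (by omega) hkB
    refine ⟨S, h1.mono htime, h2.trans (hpow (by omega)), fun A p hsum hp1 hp2 => ?_⟩
    have hA : 1 / (n : ℝ) ^ C ≤ uniformProb (combRect A) :=
      (one_div_le_one_div_of_le (by positivity) hcC').trans (hp1.trans hp2)
    refine le_trans ?_ (h3 A hsum hA)
    have h4 : (0 : ℝ) ≤ uniformProb (combRect A) := le_trans (by positivity) hA
    have h5 : ((2 * lossExponent C : ℕ) : ℝ) ≤ K := by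
      exact_mod_cast (by omega : 2 * lossExponent C ≤ K)
    gcongr
    norm_num
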